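/- Let $1\le q_1\le q_2\le\cdots$ be an infinite sequence of real numbers for which there are constants $\alpha,\beta>0$, $A\ge 0$ and $B>\max\{A,1\}$ such that, with $\beta'=(2+\beta)^2$, $$\mathcal A(x):=\#\{n: q_n\le x\}=\alpha\int_{\beta'}^x(\log (t/\beta))^{A-1}\bigl(1+O(1/(\log t)^B)\bigr)\,dt\qquad (x\ge 2\beta').$$ Put $H(x)=\sum_{q_n\le x}1/q_n$. Then the constant $$C_{\mathcal A}=\lim_{y\to\infty}\Bigl(H(y)-\tfrac{\alpha}{A}(\log (y/\beta))^A\Bigr)\ (A>0),\qquad C_{\mathcal A}=\lim_{y\to\infty}\bigl(H(y)-\alpha\log\log (y/\beta)\bigr)\ (A=0)$$ exists. Say that independent real random variables $\{\mathbb Y(n)\}_{n\ge 1}$ satisfy CRVH$(\mathbb Y)$ if * each $\mathbb Y(n)$ is supported on $[-1,1]$ and has $\mathbb E(\mathbb Y(n))=0$; * there are $c_0,\kappa>0$ with $\mathbb P(\mathbb Y(n)>1-1/t)\ge \kappa\exp(-c_0e^{\sqrt t})$ for all $n\ge 1$ and all $t\ge 1$; * there are independent random variables $\{\mathbb Y_n\}_{n\ge1}$,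 each distributed identically to $\mathbb Y$, and a constant $C_1$ such that $|\mathbb Y(n)-\mathbb Y_n|\le C_1/(\log n)^2$ almost surely for all $n\ge 2$. Let $f_{\mathbb Y}(t)=\log\mathbb E(e^{t\mathbb Y})$ for $0\le t<1$, $f_{\mathbb Y}(t)=\log\mathbb E(e^{t\mathbb Y})-t$ for $t\ge 1$, and $\eta_{\mathbb Y}=\int_0^\infty f_{\mathbb Y}(u)u^{-2}\,du$; this integral converges absolutely whenever CRVH$(\mathbb Y)$ holds. Let $\Phi_Q(\mathbb Y,V)=\mathbb P\bigl(\sum_{q_n\le Q}\mathbb Y(n)/q_n>V\bigr)$. **Theorem.** There are constants $\Theta>0$, $c>1$, $K$ and $Q_0$, depending only on the sequence $(q_n)$, on $\alpha,\beta,A,B$ and on the constants $c_0,\kappa,C_1$, such that the following holds for all real $Q\ge Q_0$ and all independent random variables $\{\mathbb Y(n)\}_{n\ge1}$ satisfying CRVH$(\mathbb Y)$ with these constants. Suppose that $c\le V\le R$, where $$R=\begin{cases}\frac{\alpha}{A}(\log Q)^A+C_{\mathcal A}-(\alpha\log\log Q+\Theta)(\log Q)^{A-1}&\text{if }A>0,\\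 \alpha\log\log Q+C_{\mathcal A}-(\alpha\log\log Q+\Theta)/\log Q&\text{if }A=0.\end{cases}$$ Then there is a smallest number $Z$ with $H(Z)\ge V$, it satisfies $\log Z>1$, and with $$\mathcal E(Z)=\frac{\log\log Z}{\log Z}+\frac1{(\log Z)^{B-1}}$$ we have $$\Phi_Q(\mathbb Y,V)=\exp\Bigl(-\alpha e^{-\eta_{\mathbb Y}-1}Z(\log Z)^{A-1}(1+\theta)\Bigr)\qquad\text{for some real }\theta\text{ with }|\theta|\le K\sqrt{\mathcal E(Z)}.$$ -/

import Mathlib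

universe u v

open MeasureTheory ProbabilityTheory Filter Topology

noncomputable section

namespace LargeDev

/-- The counting function `𝒜(x) = #{n ≥ 1 : q_n ≤ x}`. -/
def count (q : ℕ+ → ℝ) (x : ℝ) : ℕ := {n : ℕ+ | q n ≤ x}.ncard

/-- The sequence `1 ≤ q_1 ≤ q_2 ≤ …` satisfies, for all `x ≥ 2β'` with `β' = (2+β)^2`,
`𝒜(x) = α ∫_{β'}^x (log (t/β))^{A-1} (1 + O(1/(log t)^B)) dt`. The relative error in the
integrand may depend on `x` as well as on `t`; its implied constant depends on neither. -/
structure IsWellDistributed (q : ℕ+ → ℝ) (α β A B : ℝ) : Prop where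
  one_le : 1 ≤ q 1
  mono : Monotone q
  finite : ∀ x : ℝ, {n : ℕ+ | q n ≤ x}.Finite
  asymp : ∃ C₀ : ℝ, ∀ x : ℝ, 2 * (2 + β) ^ 2 ≤ x →
    |(count q x : ℝ) - α * ∫ t in ((2 + β) ^ 2)..x, Real.log (t / β) ^ (A - 1)| ≤
      C₀ * ∫ t in ((2 + β) ^ 2)..x, Real.log (t / β) ^ (A - 1) / Real.log t ^ B

/-- The harmonic sum `H(x) = ∑_{q_n ≤ x} 1/q_n` (a finite sum). -/
def harmonicSum (q : ℕ+ → ℝ) (x : ℝ) : ℝ := ∑ᶠ (n : ℕ+) (_ : q n ≤ x), 1 / q n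

/-- The divergent part of `H(y)`: `(α/A) (log (y/β))^A` if `A > 0`,
and `α log log (y/β)` if `A = 0`. -/
def harmonicMain (α β A y : ℝ) : ℝ :=
  if 0 < A then α / A * Real.log (y / β) ^ A else α * Real.log (Real.log (y / β))

/-- The random sum `H_Y(Q) = ∑_{q_n ≤ Q} Y(n)/q_n` (a finite sum). -/
def randomSum {Ω : Type*} (q : ℕ+ → ℝ) (Y : ℕ+ → Ω → ℝ) (Q : ℝ) (ω : Ω) : ℝ :=
  ∑ᶠ (n : ℕ+) (_ : q n ≤ Q), Y n ω / q n

/-- The tail probability `Φ_Q(Y, V) = ℙ(H_Y(Q) > V)`. -/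
def tailProb {Ω : Type*} [MeasurableSpace Ω] (P : Measure Ω) (q : ℕ+ → ℝ) (Y : ℕ+ → Ω → ℝ)
    (Q V : ℝ) : ℝ :=
  P.real {ω | V < randomSum q Y Q ω}

/-- The independent random variables `{Y(n)}_{n ≥ 1}` satisfy the convergent sequence of random
variables hypothesis `CRVH(𝕐)`, with the constant `c₀` and the implied constant `κ` in the lower
bound `ℙ(Y(n) > 1 - 1/t) ≫ exp(-c₀ e^{√t})`, and the implied constant `C₁` in
`Y(n) = 𝕐_n + O(1/(log n)^2)` (a condition on `n ≥ 2` only, since `log 1 = 0`). -/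
structure CRVH {Ω Ω' : Type*} [MeasurableSpace Ω] [MeasurableSpace Ω'] (P : Measure Ω)
    (P' : Measure Ω') (Y : ℕ+ → Ω → ℝ) (𝕐 : Ω' → ℝ) (c₀ κ C₁ : ℝ) : Prop where
  measurable : ∀ n, Measurable (Y n)
  indep : iIndepFun Y P
  support : ∀ n, ∀ᵐ ω ∂P, Y n ω ∈ Set.Icc (-1 : ℝ) 1
  mean_zero : ∀ n, ∫ ω, Y n ω ∂P = 0
  lower_bound : ∀ n, ∀ t : ℝ, 1 ≤ t →
    κ * Real.exp (-(c₀ * Real.exp (Real.sqrt t))) ≤ P.real {ω | 1 - 1 / t < Y n ω}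
  approx : ∃ Y' : ℕ+ → Ω → ℝ, (∀ n, Measurable (Y' n)) ∧ iIndepFun Y' P ∧
    (∀ n, IdentDistrib (Y' n) 𝕐 P P') ∧
    ∀ n : ℕ+, 2 ≤ n → ∀ᵐ ω ∂P, |Y n ω - Y' n ω| ≤ C₁ / Real.log (n : ℝ) ^ 2

/-- The function `f_𝕐(t)` (used for `t ≥ 0`): `log 𝔼(e^{t𝕐})` if `t < 1`, and
`log 𝔼(e^{t𝕐}) - t` if `t ≥ 1`. -/
def fFun {Ω : Type*} [MeasurableSpace Ω] (P : Measure Ω) (X : Ω → ℝ) (t : ℝ) : ℝ :=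
  if t < 1 then Real.log (∫ ω, Real.exp (t * X ω) ∂P)
  else Real.log (∫ ω, Real.exp (t * X ω) ∂P) - t

/-- `η_𝕐 = ∫_0^∞ f_𝕐(u)/u^2 du`. -/
def eta {Ω : Type*} [MeasurableSpace Ω] (P : Measure Ω) (X : Ω → ℝ) : ℝ :=
  ∫ u in Set.Ioi (0 : ℝ), fFun P X u / u ^ 2

/-- The upper end `R` of the admissible range for `V`. -/
def rangeBound (α A C Θ Q : ℝ) : ℝ :=
  if 0 < A then
    α / A * Real.log Q ^ A + C - (α * Real.log (Real.log Q) + Θ) * Real.log Q ^ (A - 1)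
  else
    α * Real.log (Real.log Q) + C - (α * Real.log (Real.log Q) + Θ) / Real.log Q

/-- `ℰ(Z) = log log Z / log Z + 1/(log Z)^{B-1}`. -/
def errE (B Z : ℝ) : ℝ :=
  Real.log (Real.log Z) / Real.log Z + 1 / Real.log Z ^ (B - 1)

end LargeDev

end

/-! The proof is Chernoff's method together with a matching lower bound obtained by exponential
tilting. The laws of the variables enter the estimates only through `CgfBounds`, the derivative
bound on the limiting cumulant generating function and the closeness of the cumulant generating
functions to it; the constants there depend only on `c₀`, `κ` and `C₁`, which gives the uniformity.

Write g_n for the cumulant generating function of Y(n), so that the random sum has Λ(s) = ∑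
g_n(s/q_n). The lower bound for ℙ(Y(n) > 1 - 1/t) forces u - g_n(u) ≪ u/(1 + log u)², so a term with
q_n ≤ s contributes s/q_n up to a correction, and these main parts add up to s H(s). The
corrections, and the terms with q_n > s, concentrate around q_n ≈ s, where the sequence has density
about α (log s)^(A-1). Partial summation (`exists_abs_sum_sub_integral_le`) and the substitution u =
s/t turn them into α η s (log s)^(A-1), which is `exists_cgf_sum_expansion`.

Now put s = e^v Z. Since H(e^v Z) - V ≈ α v (log Z)^(A-1), the exponent Λ(s) - sV equals W e^v (v +
η) + O(W E) with W = α Z (log Z)^(A-1) and E = ℰ(Z) (`exists_abs_exponent_sub_le`). Its main term is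
least at v = -η - 1, with value -W e^(-η-1), and Chernoff's bound there is the upper half of the
theorem.

For the lower half (`half_exp_cgf_le_measureReal`, `exists_tailProb_eq`) the law is tilted slightly
past the minimum, at v = -η - 1 + δ, and compared with the tilts at δ = 0 and at 2δ. The quadratic
growth W δ² of the exponent must beat the error W E, so δ is a large multiple of √E; confining the
sum to a window above V costs W δ. This is the source of √ℰ(Z) in the statement. The bound on V
(`exists_rangeBound_le`) keeps s log s ≤ Q for all s used, so that the terms cut off at Q do not
matter. -/

namespace LargeDev
open Real Set

/-! ### Real powers, logarithms and their integrals -/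

/-- Comparable positive reals have comparable powers. -/
lemma rpow_le_mul_rpow_of_comparable (p : ℝ) {k : ℝ} (hk : 1 ≤ k) {x y : ℝ} (hx : 0 < x)
    (hy : 0 < y) (hxy : x ≤ k * y) (hyx : y ≤ k * x) : x ^ p ≤ k ^ |p| * y ^ p := by
  have hk0 : 0 < k := by linarith
  rcases le_total 0 p with hp | hp
  · rw [abs_of_nonneg hp, ← mul_rpow hk0.le hy.le]
    exact rpow_le_rpow hx.le hxy hp
  · rw [abs_of_nonpos hp]
    have h1 : (k * x) ^ p ≤ y ^ p := rpow_le_rpow_of_nonpos hy hyx hp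
    rw [mul_rpow hk0.le hx.le] at h1
    have h2 : k ^ (-p) * (k ^ p * x ^ p) ≤ k ^ (-p) * y ^ p := by gcongr
    rwa [← mul_assoc, ← rpow_add hk0, neg_add_cancel, rpow_zero, one_mul] at h2

/-- Every power y^ε dominates the logarithm; ε is so small that its k-th power is at most y^(1/2).
An exponent below 1 is what later leaves manageable integrals of t^(-1/2) and t^(-3/2). -/
lemma one_add_log_rpow_le {k : ℝ} (hk : 0 ≤ k) :
    ∃ C, 1 ≤ C ∧ ∀ y : ℝ, 1 ≤ y → (1 + log y) ^ k ≤ C * y ^ (1 / 2 : ℝ) := by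
  set ε : ℝ := 1 / (2 * (k + 1)) with hε
  have hε0 : 0 < ε := by positivity
  have hεk : ε * k ≤ 1 / 2 := by
    rw [hε, div_mul_eq_mul_div, one_mul, div_le_div_iff₀ (by positivity) (by norm_num)]
    linarith
  refine ⟨(1 + 1 / ε) ^ k, one_le_rpow (by linarith [one_div_pos.mpr hε0]) hk, fun y hy => ?_⟩
  have hy0 : 0 < y := by linarith
  have h1 : 1 + log y ≤ (1 + 1 / ε) * y ^ ε := by
    have := log_le_rpow_div hy0.le hε0
    have h2 : 1 ≤ y ^ ε := one_le_rpow hy hε0.le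
    have : y ^ ε / ε = 1 / ε * y ^ ε := by ring
    linarith
  calc (1 + log y) ^ k ≤ ((1 + 1 / ε) * y ^ ε) ^ k :=
        rpow_le_rpow (by linarith [log_nonneg hy]) h1 hk
    _ = (1 + 1 / ε) ^ k * y ^ (ε * k) := by
        rw [mul_rpow (by positivity) (by positivity), ← rpow_mul hy0.le]
    _ ≤ _ := by
        gcongr

/-- Powers of the logarithm vary slowly. -/
lemma log_rpow_slowly_varying (p : ℝ) :
    ∃ C, 1 ≤ C ∧ ∀ t x : ℝ, exp 1 ≤ t → t ≤ x →
      log t ^ p ≤ C * (x / t) ^ (1 / 2 : ℝ) * log x ^ p ∧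
      log x ^ p ≤ C * (x / t) ^ (1 / 2 : ℝ) * log t ^ p := by
  obtain ⟨C, hC, h⟩ := one_add_log_rpow_le (abs_nonneg p)
  refine ⟨C, hC, fun t x ht htx => ?_⟩
  have ht0 : 0 < t := (exp_pos 1).trans_le ht
  have hlt : 1 ≤ log t := by rwa [le_log_iff_exp_le ht0]
  have hlx : log t ≤ log x := log_le_log ht0 htx
  have hy : 1 ≤ x / t := by rwa [le_div_iff₀ ht0, one_mul]
  have hlog : log x ≤ (1 + log (x / t)) * log t := by
    rw [log_div (by linarith) (by linarith)]
    nlinarith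
  have hk : 1 ≤ 1 + log (x / t) := by linarith [log_nonneg hy]
  have hl : log t ≤ (1 + log (x / t)) * log x := by nlinarith
  have hp1 : 0 ≤ log t ^ p := rpow_nonneg (by linarith) _
  have hp2 : 0 ≤ log x ^ p := rpow_nonneg (by linarith) _
  constructor
  · refine (rpow_le_mul_rpow_of_comparable p hk (by linarith) (by linarith) hl hlog).trans ?_
    gcongr
    exact h _ hy
  · refine (rpow_le_mul_rpow_of_comparable p hk (by linarith) (by linarith) hlog hl).trans ?_
    gcongr
    exact h _ hy

/-- The mean value estimate for powers of comparable reals. -/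
lemma abs_rpow_sub_rpow_le (p : ℝ) {k : ℝ} (hk : 1 ≤ k) {x y : ℝ} (hx : 0 < x)
    (hy : 0 < y) (hxy : x ≤ k * y) (hyx : y ≤ k * x) :
    |x ^ p - y ^ p| ≤ |p| * k ^ |p - 1| * |x - y| * y ^ (p - 1) := by
  have key := Convex.norm_image_sub_le_of_norm_hasDerivWithin_le (f := fun z : ℝ => z ^ p)
    (f' := fun z => p * z ^ (p - 1)) (s := uIcc y x) (x := y) (y := x)
    (C := |p| * (k ^ |p - 1| * y ^ (p - 1))) ?_ ?_ (convex_uIcc y x) left_mem_uIcc right_mem_uIcc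
  · simp only [norm_eq_abs] at key
    linarith
  · intro z hz
    have hz0 : 0 < z := (lt_min hy hx).trans_le hz.1
    exact (hasDerivAt_rpow_const (Or.inl hz0.ne')).hasDerivWithinAt
  · intro z hz
    have hz0 : 0 < z := (lt_min hy hx).trans_le hz.1
    rw [norm_eq_abs, abs_mul, abs_of_nonneg (rpow_nonneg hz0.le _)]
    gcongr
    apply rpow_le_mul_rpow_of_comparable _ hk hz0 hy
    · exact hz.2.trans (max_le (by nlinarith) hxy)
    · rcases min_le_iff.mp hz.1 with h | h
      · nlinarith
      · nlinarith

/-- The antiderivative of `ℓ ↦ α ℓ^(A-1)` through which `harmonicMain` factors. -/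
noncomputable def powAntideriv (α A l : ℝ) : ℝ :=
  if 0 < A then α / A * l ^ A else α * log l

lemma harmonicMain_eq (α β A y : ℝ) :
    harmonicMain α β A y = powAntideriv α A (log (y / β)) := rfl

lemma hasDerivAt_powAntideriv (α : ℝ) {A l : ℝ} (hA : 0 ≤ A) (hl : 0 < l) :
    HasDerivAt (powAntideriv α A) (α * l ^ (A - 1)) l := by
  unfold powAntideriv
  by_cases h : 0 < A
  · simp only [h, if_true]
    have := (hasDerivAt_rpow_const (x := l) (p := A) (Or.inl hl.ne')).const_mul (α / A)
    exact this.congr_deriv (by field_simp)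
  · have hA0 : A = 0 := le_antisymm (not_lt.mp h) hA
    simp only [h, if_false]
    have := (hasDerivAt_log hl.ne').const_mul α
    exact this.congr_deriv (by rw [hA0, zero_sub, rpow_neg_one])

/-- The mean value theorem, in a form that covers the power (A > 0) and the logarithm (A = 0)
together and does not depend on the order of `x` and `y`. -/
lemma exists_powAntideriv_sub_eq (α : ℝ) {A x y : ℝ} (hA : 0 ≤ A) (hx : 0 < x) (hy : 0 < y) :
    ∃ z ∈ uIcc y x, powAntideriv α A x - powAntideriv α A y = α * (x - y) * z ^ (A - 1) := by
  have aux : ∀ a b : ℝ, 0 < a → a < b →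
      ∃ z ∈ Icc a b, powAntideriv α A b - powAntideriv α A a = α * (b - a) * z ^ (A - 1) := by
    intro a b ha hab
    have hd : ∀ z ∈ Icc a b, HasDerivAt (powAntideriv α A) (α * z ^ (A - 1)) z :=
      fun z hz => hasDerivAt_powAntideriv α hA (ha.trans_le hz.1)
    obtain ⟨z, hz, h⟩ := exists_hasDerivAt_eq_slope (powAntideriv α A)
      (fun z => α * z ^ (A - 1)) hab (fun z hz => (hd z hz).continuousAt.continuousWithinAt)
      (fun z hz => hd z (Ioo_subset_Icc_self hz))
    refine ⟨z, Ioo_subset_Icc_self hz, ?_⟩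
    rw [eq_div_iff (by linarith)] at h
    linarith
  rcases lt_trichotomy y x with h | h | h
  · obtain ⟨z, hz, e⟩ := aux y x hy h
    exact ⟨z, Icc_subset_uIcc hz, e⟩
  · exact ⟨y, left_mem_uIcc, by simp [h]⟩
  · obtain ⟨z, hz, e⟩ := aux x y hx h
    exact ⟨z, Icc_subset_uIcc' hz, by linarith⟩

/-- A Taylor bound of second order: the mean value theorem is applied to the antiderivative and then
to l^(A-1), at points that stay within a factor `k` of `y`. -/
lemma abs_powAntideriv_sub_le (α : ℝ) {A k x y : ℝ} (hA : 0 ≤ A) (hk : 1 ≤ k) (hx : 0 < x)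
    (hy : 0 < y) (hxy : x ≤ k * y) (hyx : y ≤ k * x) :
    |powAntideriv α A x - powAntideriv α A y - α * (x - y) * y ^ (A - 1)| ≤
      |α| * (|A - 1| * k ^ |A - 2|) * (x - y) ^ 2 * y ^ (A - 2) := by
  obtain ⟨z, hz, e⟩ := exists_powAntideriv_sub_eq α hA hx hy
  have hz0 : 0 < z := (lt_min hy hx).trans_le hz.1
  have hzk : z ≤ k * y := hz.2.trans (max_le (by nlinarith) hxy)
  have hkz : y ≤ k * z := by
    rcases min_le_iff.mp hz.1 with h | h <;> nlinarith
  have h1 := abs_rpow_sub_rpow_le (A - 1) hk hz0 hy hzk hkz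
  have h2 : |z - y| ≤ |x - y| := by
    have := abs_sub_left_of_mem_uIcc hz
    exact this
  rw [e, ← mul_sub, abs_mul, abs_mul, show A - 1 - 1 = A - 2 by ring] at *
  have h3 : 0 ≤ y ^ (A - 2) := rpow_nonneg hy.le _
  have hk0 : 0 < k := by linarith
  calc |α| * |x - y| * |z ^ (A - 1) - y ^ (A - 1)|
      ≤ |α| * |x - y| * (|A - 1| * k ^ |A - 2| * |z - y| * y ^ (A - 2)) := by gcongr
    _ ≤ |α| * |x - y| * (|A - 1| * k ^ |A - 2| * |x - y| * y ^ (A - 2)) := by gcongr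
    _ = |α| * (|A - 1| * k ^ |A - 2|) * (|x - y| * |x - y|) * y ^ (A - 2) := by ring
    _ = _ := by rw [abs_mul_abs_self, sq]

/-- `log (t / β)` is comparable to `log t` for `t ≥ (2 + β)²`. -/
lemma log_div_comparable {β t : ℝ} (hβ : 0 < β) (ht : (2 + β) ^ 2 ≤ t) :
    exp 1 ≤ t ∧ 1 ≤ log t ∧ 1 ≤ log (t / β) ∧ log t ≤ (2 + |log β|) * log (t / β) ∧
      log (t / β) ≤ (2 + |log β|) * log t := by
  have he : exp 1 ≤ 4 := by linarith [exp_one_lt_d9]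
  have h4 : 4 ≤ (2 + β) ^ 2 := by nlinarith
  have ht0 : 0 < t := by linarith
  have hlt : 1 ≤ log t := by
    rw [le_log_iff_exp_le ht0]; linarith
  have hlog : log (t / β) = log t - log β := log_div ht0.ne' hβ.ne'
  -- The threshold (2 + β)² gives β ≤ √t, so dividing by β removes at most half of log t.
  have h2 : log t / 2 ≤ log (t / β) := by
    have : 2 * log (2 + β) ≤ log t := by
      rw [← log_rpow (by linarith)]
      apply log_le_log (by positivity)
      exact_mod_cast ht
    have h3 : log β ≤ log (2 + β) := log_le_log hβ (by linarith)
    linarith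
  have hb := abs_nonneg (log β)
  refine ⟨by linarith, hlt, ?_, by nlinarith, ?_⟩
  · have : 4 * β ≤ t := by nlinarith
    rw [le_log_iff_exp_le (by positivity), le_div_iff₀ hβ]
    nlinarith
  · rw [hlog]
    have := neg_abs_le (log β)
    nlinarith

lemma hasDerivAt_log_rpow (p : ℝ) {t : ℝ} (ht : 1 < t) :
    HasDerivAt (fun t => log t ^ p) (p * (log t ^ (p - 1) / t)) t := by
  have h := (hasDerivAt_log (by linarith : t ≠ 0)).rpow_const (p := p) (Or.inl (log_pos ht).ne')
  exact h.congr_deriv (by field_simp)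

lemma continuousOn_log_rpow (p : ℝ) : ContinuousOn (fun t => log t ^ p) (Ioi 1) :=
  fun _ ht => (hasDerivAt_log_rpow p ht).continuousAt.continuousWithinAt

/-- The integrand has the antiderivative -(log t)^(-p)/p. The bound is free of `b`; with p = B - A
it controls the accumulated error of the counting function. -/
lemma integral_log_rpow_div_le {a b p : ℝ} (ha : 1 < a) (hab : a ≤ b) (hp : 0 < p) :
    ∫ t in a..b, log t ^ (-p - 1) / t ≤ log a ^ (-p) / p := by
  have hsub : uIcc a b ⊆ Ioi 1 := by
    rw [uIcc_of_le hab]; exact fun t ht => ha.trans_le ht.1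
  have h := intervalIntegral.integral_eq_sub_of_hasDerivAt (a := a) (b := b)
    (f := fun t => (-1 / p) * log t ^ (-p)) (f' := fun t => log t ^ (-p - 1) / t) ?_ ?_
  · rw [h]
    have : 0 ≤ log b ^ (-p) := rpow_nonneg (log_nonneg (by linarith)) _
    have h2 : 0 ≤ 1 / p * log b ^ (-p) := by positivity
    have : log a ^ (-p) / p = 1 / p * log a ^ (-p) := by ring
    rw [this, neg_div]; linarith
  · intro t ht
    have := (hasDerivAt_log_rpow (-p) (hsub ht)).const_mul (-1 / p)
    exact this.congr_deriv (by field_simp)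
  · apply ContinuousOn.intervalIntegrable
    apply ((continuousOn_log_rpow _).mono hsub).div continuousOn_id
    intro t ht
    have := hsub ht
    simp only [mem_Ioi] at this
    simp; linarith

/-- `∫_a^x (log t)^p dt ≪ x (log x)^p`. -/
lemma integral_log_rpow_le (p : ℝ) :
    ∃ C, 0 ≤ C ∧ ∀ a x : ℝ, exp 1 ≤ a → a ≤ x → ∫ t in a..x, log t ^ p ≤ C * (x * log x ^ p) := by
  obtain ⟨C, hC, h⟩ := log_rpow_slowly_varying p
  refine ⟨2 * C, by linarith, fun a x ha hax => ?_⟩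
  have he : (1 : ℝ) < exp 1 := by simp
  have hx : 0 < x := by linarith
  have hsub : uIcc a x ⊆ Ioi 1 := by
    rw [uIcc_of_le hax]; exact fun t ht => by simp only [mem_Ioi]; linarith [ht.1]
  have hxp : 0 ≤ log x ^ p := rpow_nonneg (log_nonneg (by linarith)) _
  have hI : IntervalIntegrable (fun t : ℝ => t ^ (-(1 / 2) : ℝ)) volume a x :=
    intervalIntegral.intervalIntegrable_rpow' (by norm_num)
  calc ∫ t in a..x, log t ^ p
      ≤ ∫ t in a..x, (C * x ^ (1 / 2 : ℝ) * log x ^ p) * t ^ (-(1 / 2) : ℝ) := by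
        apply intervalIntegral.integral_mono_on hax
        · exact ((continuousOn_log_rpow p).mono hsub).intervalIntegrable
        · exact hI.const_mul _
        · intro t ht
          have ht0 : 0 < t := by linarith [ht.1]
          have := (h t x (ha.trans ht.1) ht.2).1
          rw [div_rpow hx.le ht0.le] at this
          rw [rpow_neg ht0.le]
          convert this using 1
          ring
    _ = (C * x ^ (1 / 2 : ℝ) * log x ^ p) * ((x ^ (1 / 2 : ℝ) - a ^ (1 / 2 : ℝ)) * 2) := by
        rw [intervalIntegral.integral_const_mul, integral_rpow (Or.inl (by norm_num))]
        norm_num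
        left; ring
    _ ≤ (C * x ^ (1 / 2 : ℝ) * log x ^ p) * (x ^ (1 / 2 : ℝ) * 2) := by
        gcongr
        linarith [rpow_nonneg (show (0:ℝ) ≤ a by linarith) (1 / 2 : ℝ)]
    _ = 2 * C * ((x ^ (1 / 2 : ℝ) * x ^ (1 / 2 : ℝ)) * log x ^ p) := by ring
    _ = _ := by rw [← rpow_add hx]; norm_num

/-! ### The counting function and partial summation -/

section Counting

variable {q : ℕ+ → ℝ} {α β A B : ℝ}

/-- The finite set of indices `n` with `q n ≤ x`. -/
noncomputable def IsWellDistributed.index (hq : IsWellDistributed q α β A B) (x : ℝ) :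
    Finset ℕ+ := (hq.finite x).toFinset

lemma IsWellDistributed.mem_index (hq : IsWellDistributed q α β A B) {x : ℝ} {n : ℕ+} :
    n ∈ hq.index x ↔ q n ≤ x := by simp [IsWellDistributed.index]

lemma IsWellDistributed.index_mono (hq : IsWellDistributed q α β A B) {x y : ℝ} (h : x ≤ y) :
    hq.index x ⊆ hq.index y := fun n hn => by
  rw [hq.mem_index] at *; exact hn.trans h

lemma IsWellDistributed.count_eq (hq : IsWellDistributed q α β A B) (x : ℝ) :
    count q x = (hq.index x).card := Set.ncard_eq_toFinset_card _ (hq.finite x)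

lemma IsWellDistributed.harmonicSum_eq (hq : IsWellDistributed q α β A B) (x : ℝ) :
    harmonicSum q x = ∑ n ∈ hq.index x, 1 / q n :=
  finsum_mem_eq_finite_toFinset_sum _ (hq.finite x)

lemma IsWellDistributed.randomSum_eq {Ω : Type*} (hq : IsWellDistributed q α β A B)
    (Y : ℕ+ → Ω → ℝ) (x : ℝ) (ω : Ω) :
    randomSum q Y x ω = ∑ n ∈ hq.index x, Y n ω / q n :=
  finsum_mem_eq_finite_toFinset_sum _ (hq.finite x)

lemma IsWellDistributed.one_le_apply (hq : IsWellDistributed q α β A B) (n : ℕ+) : 1 ≤ q n :=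
  hq.one_le.trans (hq.mono _root_.one_le)

lemma continuousOn_log_div_rpow (p : ℝ) (hβ : 0 < β) :
    ContinuousOn (fun t => log (t / β) ^ p) (Ioi β) := by
  have h : MapsTo (fun t => t / β) (Ioi β) (Ioi 1) := fun t ht => by
    simp only [mem_Ioi] at *
    rwa [lt_div_iff₀ hβ, one_mul]
  exact (continuousOn_log_rpow p).comp (by fun_prop) h

lemma lt_of_sq_le {t : ℝ} (hβ : 0 < β) (ht : (2 + β) ^ 2 ≤ t) : β < t := by nlinarith

lemma intervalIntegrable_log_div_rpow (p : ℝ) (hβ : 0 < β) {a b : ℝ} (ha : (2 + β) ^ 2 ≤ a)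
    (hab : a ≤ b) : IntervalIntegrable (fun t => log (t / β) ^ p) volume a b := by
  apply ContinuousOn.intervalIntegrable
  apply (continuousOn_log_div_rpow p hβ).mono
  rw [uIcc_of_le hab]
  exact fun t ht => lt_of_sq_le hβ (ha.trans ht.1)

lemma hasDerivAt_integral_log_div_rpow (p : ℝ) (hβ : 0 < β) {a t : ℝ} (ha : (2 + β) ^ 2 ≤ a)
    (hat : a ≤ t) :
    HasDerivAt (fun x => ∫ s in a..x, log (s / β) ^ p) (log (t / β) ^ p) t := by
  have hc := continuousOn_log_div_rpow p hβ
  have ht : β < t := lt_of_sq_le hβ (ha.trans hat)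
  exact intervalIntegral.integral_hasDerivAt_right
    (intervalIntegrable_log_div_rpow p hβ ha hat)
    (hc.stronglyMeasurableAtFilter isOpen_Ioi t ht) (hc.continuousAt (Ioi_mem_nhds ht))

lemma log_div_rpow_le (p : ℝ) (hβ : 0 < β) :
    ∃ C, 1 ≤ C ∧ ∀ t, (2 + β) ^ 2 ≤ t →
      log (t / β) ^ p ≤ C * log t ^ p ∧ log t ^ p ≤ C * log (t / β) ^ p := by
  have hk : 1 ≤ 2 + |log β| := by linarith [abs_nonneg (log β)]
  refine ⟨(2 + |log β|) ^ |p|, one_le_rpow hk (abs_nonneg p), fun t ht => ?_⟩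
  obtain ⟨-, h1, h2, h3, h4⟩ := log_div_comparable hβ ht
  exact ⟨rpow_le_mul_rpow_of_comparable p hk (by linarith) (by linarith) h4 h3,
    rpow_le_mul_rpow_of_comparable p hk (by linarith) (by linarith) h3 h4⟩

/-- The absolute form of the error term in the counting function. -/
lemma IsWellDistributed.exists_abs_count_sub_le (hq : IsWellDistributed q α β A B) (hβ : 0 < β) :
    ∃ C, 0 ≤ C ∧ ∀ x, 2 * (2 + β) ^ 2 ≤ x →
      |(count q x : ℝ) - α * ∫ t in ((2 + β) ^ 2)..x, log (t / β) ^ (A - 1)| ≤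
        C * (x * log x ^ (A - 1 - B)) := by
  obtain ⟨C₀, h₀⟩ := hq.asymp
  obtain ⟨C₁, hC₁, h₁⟩ := log_div_rpow_le (A - 1) hβ
  obtain ⟨C₂, hC₂, h₂⟩ := integral_log_rpow_le (A - 1 - B)
  refine ⟨|C₀| * (C₁ * C₂), by positivity, fun x hx => (h₀ x hx).trans ?_⟩
  have hb : 0 < (2 + β) ^ 2 := by positivity
  have hbx : (2 + β) ^ 2 ≤ x := by linarith
  have hnn : 0 ≤ ∫ t in ((2 + β) ^ 2)..x, log (t / β) ^ (A - 1) / log t ^ B := by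
    apply intervalIntegral.integral_nonneg hbx
    intro t ht
    obtain ⟨-, h1, h2, -⟩ := log_div_comparable hβ ht.1
    positivity
  have hsub : uIcc ((2 + β) ^ 2) x ⊆ Ioi 1 := by
    rw [uIcc_of_le hbx]; intro t ht; simp only [mem_Ioi]; nlinarith [ht.1]
  have hI := (continuousOn_log_rpow (A - 1 - B)).mono hsub
  have hI2 : IntervalIntegrable (fun t => log (t / β) ^ (A - 1) / log t ^ B) volume
      ((2 + β) ^ 2) x := by
    apply ContinuousOn.intervalIntegrable
    apply ContinuousOn.div
    · apply (continuousOn_log_div_rpow (A - 1) hβ).mono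
      rw [uIcc_of_le hbx]
      exact fun t ht => lt_of_sq_le hβ ht.1
    · exact (continuousOn_log_rpow B).mono hsub
    · intro t ht
      exact (rpow_pos_of_pos (log_pos (hsub ht)) _).ne'
  calc C₀ * ∫ t in ((2 + β) ^ 2)..x, log (t / β) ^ (A - 1) / log t ^ B
      ≤ |C₀| * ∫ t in ((2 + β) ^ 2)..x, log (t / β) ^ (A - 1) / log t ^ B := by
        gcongr; exact le_abs_self _
    _ ≤ |C₀| * ∫ t in ((2 + β) ^ 2)..x, C₁ * log t ^ (A - 1 - B) := by
        gcongr
        apply intervalIntegral.integral_mono_on hbx hI2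
        · exact (hI.intervalIntegrable).const_mul C₁
        intro t ht
        obtain ⟨-, h1, h2, -⟩ := log_div_comparable hβ ht.1
        rw [rpow_sub (by linarith : 0 < log t) (A - 1) B, ← mul_div_assoc]
        gcongr
        exact (h₁ t ht.1).1
    _ = |C₀| * (C₁ * ∫ t in ((2 + β) ^ 2)..x, log t ^ (A - 1 - B)) := by
        rw [intervalIntegral.integral_const_mul]
    _ ≤ |C₀| * (C₁ * (C₂ * (x * log x ^ (A - 1 - B)))) := by
        gcongr
        exact h₂ _ _ (log_div_comparable hβ le_rfl).1 hbx
    _ = _ := by ring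

/-- Counting from `a` makes the integral vanish at t = a, so that integration by parts leaves a
boundary term at `b` only. -/
lemma IsWellDistributed.exists_abs_count_sub_count_le (hq : IsWellDistributed q α β A B)
    (hβ : 0 < β) :
    ∃ C, 0 ≤ C ∧ ∀ a t, 2 * (2 + β) ^ 2 ≤ a → a ≤ t →
      |((hq.index t \ hq.index a).card : ℝ) - α * ∫ s in a..t, log (s / β) ^ (A - 1)| ≤
        C * (t * log t ^ (A - 1 - B) + a * log a ^ (A - 1 - B)) := by
  obtain ⟨C, hC, h⟩ := hq.exists_abs_count_sub_le hβ
  refine ⟨C, hC, fun a t ha hat => ?_⟩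
  have hb : 0 < (2 + β) ^ 2 := by positivity
  have e1 := intervalIntegral.integral_add_adjacent_intervals
    (intervalIntegrable_log_div_rpow (A - 1) hβ le_rfl (by linarith : (2 + β) ^ 2 ≤ a))
    (intervalIntegrable_log_div_rpow (A - 1) hβ (by linarith : (2 + β) ^ 2 ≤ a) hat)
  have e2 : ((hq.index t \ hq.index a).card : ℝ) = count q t - count q a := by
    rw [hq.count_eq, hq.count_eq, Finset.cast_card_sdiff (hq.index_mono hat)]
  have h1 := abs_le.mp (h a ha)
  have h2 := abs_le.mp (h t (by linarith))
  rw [e2, abs_le]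
  rw [← e1] at h2
  constructor <;> linarith [h1.1, h1.2, h2.1, h2.2]

/-- Partial summation against the sequence `q`, for functions of the size of `1 / t`. -/
lemma IsWellDistributed.exists_abs_sum_sub_integral_le (hq : IsWellDistributed q α β A B)
    (hβ : 0 < β) (hB : max A 1 < B) :
    ∃ C, 0 ≤ C ∧ ∀ (a b c : ℝ) (φ φ' : ℝ → ℝ), 2 * (2 + β) ^ 2 ≤ a → a ≤ b → 0 ≤ c →
      (∀ t ∈ Icc a b, HasDerivAt φ (φ' t) t) → ContinuousOn φ' (Icc a b) →
      (∀ t ∈ Icc a b, |φ t| ≤ c / t) → (∀ t ∈ Icc a b, |φ' t| ≤ c / t ^ 2) →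
      |∑ n ∈ hq.index b \ hq.index a, φ (q n) - α * ∫ t in a..b, φ t * log (t / β) ^ (A - 1)| ≤
        C * c * log a ^ (A - B) := by
  obtain ⟨C, hC, hcount⟩ := hq.exists_abs_count_sub_count_le hβ
  have hBA : 0 < B - A := by linarith [le_max_left A 1]
  -- The endpoint `b` contributes 2C and the integral C (1 + 1/(B - A)). Nothing depends on `b`,
  -- which is what makes the harmonic sums Cauchy later.
  refine ⟨C * (3 + 1 / (B - A)), by positivity, ?_⟩
  intro a b c φ φ' ha hab hc hφ hφ' hφb hφb'
  have hb0 : 0 < (2 + β) ^ 2 := by positivity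
  have ha' : (2 + β) ^ 2 ≤ a := by linarith
  have ha0 : 0 < a := by linarith
  have hb : 0 < b := by linarith
  have hla : 1 ≤ log a := (log_div_comparable hβ ha').2.1
  have hlab : log a ≤ log b := log_le_log ha0 hab
  set J := hq.index b \ hq.index a with hJ
  set M : ℝ → ℝ := fun t => ∫ s in a..t, log (s / β) ^ (A - 1) with hM
  have hφI : IntervalIntegrable φ' volume a b := by
    apply ContinuousOn.intervalIntegrable; rwa [uIcc_of_le hab]
  have hparts : ∫ t in a..b, φ t * log (t / β) ^ (A - 1) = φ b * M b - ∫ t in a..b, φ' t * M t := by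
    have := intervalIntegral.integral_mul_deriv_eq_deriv_mul (a := a) (b := b) (u := φ) (v := M)
      (u' := φ') (v' := fun t => log (t / β) ^ (A - 1))
      (by rw [uIcc_of_le hab]; exact hφ)
      (by rw [uIcc_of_le hab]
          exact fun t ht => hasDerivAt_integral_log_div_rpow (A - 1) hβ ha' ht.1) hφI
      (intervalIntegrable_log_div_rpow (A - 1) hβ ha' hab)
    rw [this]; simp [hM]
  have hmemJ : ∀ n ∈ J, a < q n ∧ q n ≤ b := by
    intro n hn
    rw [hJ, Finset.mem_sdiff, hq.mem_index, hq.mem_index] at hn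
    exact ⟨not_le.mp hn.2, hn.1⟩
  -- With the indicator all integrals run over the same interval, so the finite sum moves inside;
  -- there it counts the terms in (a, t] and is compared with α M(t) pointwise.
  have hpt : ∀ n ∈ J, φ (q n) = φ b - ∫ t in a..b, (Ici (q n)).indicator φ' t := by
    intro n hn
    obtain ⟨h1, h2⟩ := hmemJ n hn
    have e : ∫ t in a..b, (Ici (q n)).indicator φ' t = ∫ t in (q n)..b, φ' t := by
      rw [intervalIntegral.integral_of_le hab, intervalIntegral.integral_of_le h2,
        setIntegral_indicator measurableSet_Ici, ← integral_Icc_eq_integral_Ioc]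
      congr 2
      ext t; simp only [mem_inter_iff, mem_Ioc, mem_Ici, mem_Icc]
      constructor
      · rintro ⟨⟨_, h⟩, h'⟩; exact ⟨h', h⟩
      · rintro ⟨h, h'⟩; exact ⟨⟨h1.trans_le h, h'⟩, h⟩
    rw [e, intervalIntegral.integral_eq_sub_of_hasDerivAt (f := φ)]
    · ring
    · rw [uIcc_of_le h2]; exact fun t ht => hφ t ⟨h1.le.trans ht.1, ht.2⟩
    · apply hφI.mono_set
      rw [uIcc_of_le h2, uIcc_of_le hab]; exact Icc_subset_Icc_left h1.le
  have hindI : ∀ n, IntervalIntegrable ((Ici (q n)).indicator φ') volume a b := by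
    intro n
    rw [intervalIntegrable_iff_integrableOn_Ioc_of_le hab] at hφI ⊢
    exact hφI.indicator measurableSet_Ici
  have hsum : ∑ n ∈ J, φ (q n) =
      J.card * φ b - ∫ t in a..b, ∑ n ∈ J, (Ici (q n)).indicator φ' t := by
    rw [Finset.sum_congr rfl hpt, Finset.sum_sub_distrib, Finset.sum_const, nsmul_eq_mul,
      intervalIntegral.integral_finsetSum (fun n _ => hindI n)]
  have hMc : ContinuousOn M (uIcc a b) := by
    rw [uIcc_of_le hab]
    exact fun t ht => (hasDerivAt_integral_log_div_rpow (A - 1) hβ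
      ha' ht.1).continuousAt.continuousWithinAt
  have hcomb : ∑ n ∈ J, φ (q n) - α * ∫ t in a..b, φ t * log (t / β) ^ (A - 1) =
      φ b * (J.card - α * M b) -
        ∫ t in a..b, (∑ n ∈ J, (Ici (q n)).indicator φ' t - α * (φ' t * M t)) := by
    rw [hsum, hparts, intervalIntegral.integral_sub, intervalIntegral.integral_const_mul]
    · ring
    · have := IntervalIntegrable.sum J (fun n _ => hindI n)
      exact this.congr (fun t _ => by simp)
    · exact (hφI.mul_continuousOn hMc).const_mul α
  have hD : ∀ t ∈ Ioc a b, |∑ n ∈ J, (Ici (q n)).indicator φ' t - α * (φ' t * M t)| ≤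
      c / t ^ 2 * (C * (t * log t ^ (A - 1 - B) + a * log a ^ (A - 1 - B))) := by
    intro t ht
    have e : ∑ n ∈ J, (Ici (q n)).indicator φ' t =
        φ' t * ((hq.index t \ hq.index a).card : ℝ) := by
      simp only [indicator_apply, mem_Ici]
      rw [← Finset.sum_filter, Finset.sum_const, nsmul_eq_mul, mul_comm]
      congr 3
      ext n
      simp only [hJ, Finset.mem_filter, Finset.mem_sdiff, hq.mem_index]
      constructor
      · rintro ⟨⟨_, h⟩, h'⟩; exact ⟨h', h⟩
      · rintro ⟨h, h'⟩; exact ⟨⟨h.trans ht.2, h'⟩, h⟩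
    rw [e, show φ' t * ((hq.index t \ hq.index a).card : ℝ) - α * (φ' t * M t) =
      φ' t * (((hq.index t \ hq.index a).card : ℝ) - α * M t) by ring, abs_mul]
    have h0 : 0 ≤ c / t ^ 2 := by positivity
    exact mul_le_mul (hφb' t (Ioc_subset_Icc_self ht)) (hcount a t ha ht.1.le) (abs_nonneg _) h0
  have hsub : uIcc a b ⊆ Ioi 1 := by
    rw [uIcc_of_le hab]; intro t ht; simp only [mem_Ioi]; nlinarith [ht.1]
  have hne : ∀ t ∈ uIcc a b, t ≠ 0 := fun t ht => by
    have := hsub ht; simp only [mem_Ioi] at this; linarith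
  have hint1 : IntervalIntegrable (fun t => log t ^ (A - 1 - B) / t) volume a b :=
    (((continuousOn_log_rpow _).mono hsub).div continuousOn_id hne).intervalIntegrable
  have hint2 : IntervalIntegrable (fun t : ℝ => 1 / t ^ 2) volume a b :=
    (ContinuousOn.div continuousOn_const (by fun_prop)
      (fun t ht => pow_ne_zero 2 (hne t ht))).intervalIntegrable
  have hfun : ∀ t ∈ uIcc a b,
      c / t ^ 2 * (C * (t * log t ^ (A - 1 - B) + a * log a ^ (A - 1 - B))) =
      c * C * (log t ^ (A - 1 - B) / t) + c * C * (a * log a ^ (A - 1 - B)) * (1 / t ^ 2) := by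
    intro t ht
    have := hne t ht
    field_simp
  have hI : |∫ t in a..b, (∑ n ∈ J, (Ici (q n)).indicator φ' t - α * (φ' t * M t))| ≤
      c * C * (1 / (B - A) + 1) * log a ^ (A - B) := by
    have hbd := intervalIntegral.norm_integral_le_of_norm_le hab
      (f := fun t => ∑ n ∈ J, (Ici (q n)).indicator φ' t - α * (φ' t * M t))
      (g := fun t => c * C * (log t ^ (A - 1 - B) / t) +
        c * C * (a * log a ^ (A - 1 - B)) * (1 / t ^ 2)) (μ := volume)
      (by
        filter_upwards with t ht
        rw [← hfun t (by rw [uIcc_of_le hab]; exact Ioc_subset_Icc_self ht)]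
        exact hD t ht) ((hint1.const_mul _).add (hint2.const_mul _))
    rw [norm_eq_abs] at hbd
    refine hbd.trans ?_
    rw [intervalIntegral.integral_add (hint1.const_mul _) (hint2.const_mul _),
      intervalIntegral.integral_const_mul, intervalIntegral.integral_const_mul]
    have h1 := integral_log_rpow_div_le (a := a) (b := b) (p := B - A) (hsub left_mem_uIcc) hab hBA
    rw [show -(B - A) - 1 = A - 1 - B by ring, show -(B - A) = A - B by ring] at h1
    have h2 : ∫ t in a..b, 1 / t ^ 2 ≤ 1 / a := by
      rw [intervalIntegral.integral_eq_sub_of_hasDerivAt (f := fun t => -t⁻¹)]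
      · have : 0 ≤ b⁻¹ := by positivity
        rw [one_div]; linarith
      · intro t ht
        exact ((hasDerivAt_inv (hne t ht)).neg).congr_deriv (by simp)
      · exact hint2
    have h3 : log a ^ (A - 1 - B) ≤ log a ^ (A - B) :=
      rpow_le_rpow_of_exponent_le hla (by linarith)
    have h4 : 0 ≤ log a ^ (A - 1 - B) := by positivity
    calc c * C * (∫ t in a..b, log t ^ (A - 1 - B) / t) +
          c * C * (a * log a ^ (A - 1 - B)) * ∫ t in a..b, 1 / t ^ 2
        ≤ c * C * (log a ^ (A - B) / (B - A)) +
          c * C * (a * log a ^ (A - 1 - B)) * (1 / a) := by gcongr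
      _ = c * C * (log a ^ (A - B) / (B - A)) + c * C * log a ^ (A - 1 - B) := by
          field_simp
      _ ≤ c * C * (log a ^ (A - B) / (B - A)) + c * C * log a ^ (A - B) := by gcongr
      _ = _ := by ring
  have hend : |φ b * (J.card - α * M b)| ≤ c * C * 2 * log a ^ (A - B) := by
    have h3 : log a ^ (A - 1 - B) ≤ log a ^ (A - B) :=
      rpow_le_rpow_of_exponent_le hla (by linarith)
    have h5 : log b ^ (A - 1 - B) ≤ log a ^ (A - 1 - B) :=
      rpow_le_rpow_of_nonpos (by linarith) hlab (by linarith)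
    have h6 : 0 ≤ log a ^ (A - 1 - B) := by positivity
    rw [abs_mul]
    calc |φ b| * |J.card - α * M b|
        ≤ c / b * (C * (b * log b ^ (A - 1 - B) + a * log a ^ (A - 1 - B))) :=
          mul_le_mul (hφb b (right_mem_Icc.mpr hab)) (hcount a b ha hab) (abs_nonneg _)
            (by positivity)
      _ ≤ c / b * (C * (b * log a ^ (A - 1 - B) + b * log a ^ (A - 1 - B))) := by gcongr
      _ = c * C * 2 * log a ^ (A - 1 - B) := by field_simp; ring
      _ ≤ _ := by gcongr
  rw [hcomb]
  calc _ ≤ |φ b * (J.card - α * M b)| + _ := abs_sub _ _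
    _ ≤ c * C * 2 * log a ^ (A - B) + c * C * (1 / (B - A) + 1) * log a ^ (A - B) :=
        add_le_add hend hI
    _ = _ := by ring

end Counting

/-! ### Harmonic sums, sums of squares and growth of the counting function -/

section Harmonic

variable {q : ℕ+ → ℝ} {α β A B : ℝ}

lemma IsWellDistributed.sum_index_sdiff (hq : IsWellDistributed q α β A B) {x y : ℝ}
    (h : x ≤ y) (F : ℕ+ → ℝ) :
    ∑ n ∈ hq.index y, F n = ∑ n ∈ hq.index x, F n + ∑ n ∈ hq.index y \ hq.index x, F n := by
  rw [add_comm, Finset.sum_sdiff (hq.index_mono h)]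

lemma IsWellDistributed.harmonicSum_mono (hq : IsWellDistributed q α β A B) :
    Monotone (harmonicSum q) := by
  intro x y h
  rw [hq.harmonicSum_eq, hq.harmonicSum_eq, hq.sum_index_sdiff h]
  have : 0 ≤ ∑ n ∈ hq.index y \ hq.index x, 1 / q n :=
    Finset.sum_nonneg fun n _ => by have := hq.one_le_apply n; positivity
  linarith

lemma IsWellDistributed.harmonicSum_nonneg (hq : IsWellDistributed q α β A B) (x : ℝ) :
    0 ≤ harmonicSum q x := by
  rw [hq.harmonicSum_eq]
  exact Finset.sum_nonneg fun n _ => by have := hq.one_le_apply n; positivity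

/-- `harmonicMain` is an antiderivative of the density α (log (t/β))^(A-1) divided by t, in both
cases of its definition. -/
lemma integral_log_div_rpow_div (hβ : 0 < β) (hA : 0 ≤ A) {a b : ℝ} (ha : (2 + β) ^ 2 ≤ a)
    (hab : a ≤ b) :
    α * ∫ t in a..b, 1 / t * log (t / β) ^ (A - 1) =
      harmonicMain α β A b - harmonicMain α β A a := by
  rw [← intervalIntegral.integral_const_mul]
  have hb : 0 < (2 + β) ^ 2 := by positivity
  apply intervalIntegral.integral_eq_sub_of_hasDerivAt (f := harmonicMain α β A)
  · intro t ht
    rw [uIcc_of_le hab] at ht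
    have ht0 : 0 < t := by linarith [ht.1]
    have hl : 1 ≤ log (t / β) := (log_div_comparable hβ (ha.trans ht.1)).2.2.1
    have h1 : HasDerivAt (fun t => log (t / β)) (1 / t) t := by
      have := ((hasDerivAt_id t).div_const β).log (by positivity)
      exact this.congr_deriv (by simp only [id]; field_simp)
    have h2 := (hasDerivAt_powAntideriv α hA (by linarith : 0 < log (t / β))).comp t h1
    exact h2.congr_deriv (by ring)
  · apply ContinuousOn.intervalIntegrable
    rw [uIcc_of_le hab]
    refine ContinuousOn.mul continuousOn_const (ContinuousOn.mul ?_ ?_)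
    · exact ContinuousOn.div continuousOn_const continuousOn_id
        (fun t ht => by have := ht.1; simp; linarith)
    · exact (continuousOn_log_div_rpow _ hβ).mono fun t ht => lt_of_sq_le hβ (ha.trans ht.1)

lemma tendsto_harmonicMain_atTop (hα : 0 < α) (hβ : 0 < β) :
    Tendsto (harmonicMain α β A) atTop atTop := by
  have h1 : Tendsto (fun y => log (y / β)) atTop atTop :=
    tendsto_log_atTop.comp (tendsto_id.atTop_div_const hβ)
  unfold harmonicMain
  by_cases h : 0 < A
  · simp only [h, if_true]
    exact ((tendsto_rpow_atTop h).comp h1).const_mul_atTop (by positivity)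
  · simp only [h, if_false]
    exact (tendsto_log_atTop.comp h1).const_mul_atTop hα

/-- The bound is uniform in `b`: it yields the Cauchy property, and letting b → ∞ in it yields the
rate of convergence. -/
lemma exists_tendsto_of_abs_sub_le {D r : ℝ → ℝ} {x₀ : ℝ} (hr : Tendsto r atTop (𝓝 0))
    (h : ∀ a b, x₀ ≤ a → a ≤ b → |D b - D a| ≤ r a) :
    ∃ C, Tendsto D atTop (𝓝 C) ∧ ∀ a, x₀ ≤ a → |D a - C| ≤ r a := by
  have hcau : CauchySeq D := by
    rw [Metric.cauchySeq_iff']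
    intro ε hε
    obtain ⟨N, hN, hN'⟩ := ((hr.eventually_lt_const hε).and (eventually_ge_atTop x₀)).exists
    exact ⟨N, fun n hn => (h N n hN' hn).trans_lt hN⟩
  obtain ⟨C, hC⟩ := cauchySeq_tendsto_of_complete hcau
  refine ⟨C, hC, fun a ha => ?_⟩
  rw [abs_sub_comm]
  refine le_of_tendsto (hC.sub_const (D a)).abs ?_
  filter_upwards [eventually_ge_atTop a] with b hb using h a b ha hb

/-- The harmonic sum has the expansion `H(y) = main term + C + O((log y)^(A-B))`. -/
lemma IsWellDistributed.exists_harmonicSum_expansion (hq : IsWellDistributed q α β A B)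
    (hβ : 0 < β) (hA : 0 ≤ A) (hB : max A 1 < B) :
    ∃ C K, 0 ≤ K ∧
      Tendsto (fun y => harmonicSum q y - harmonicMain α β A y) atTop (𝓝 C) ∧
      ∀ y, 2 * (2 + β) ^ 2 ≤ y →
        |harmonicSum q y - harmonicMain α β A y - C| ≤ K * log y ^ (A - B) := by
  obtain ⟨K, hK, h⟩ := hq.exists_abs_sum_sub_integral_le hβ hB
  have hb0 : 0 < (2 + β) ^ 2 := by positivity
  set D := fun y => harmonicSum q y - harmonicMain α β A y with hD
  have key : ∀ a b, 2 * (2 + β) ^ 2 ≤ a → a ≤ b → |D b - D a| ≤ K * log a ^ (A - B) := by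
    intro a b ha hab
    have hpos : ∀ t ∈ Icc a b, 0 < t := fun t ht => by linarith [ht.1]
    have := h a b 1 (fun t => 1 / t) (fun t => -1 / t ^ 2) ha hab zero_le_one
      (fun t ht => by
        have := hasDerivAt_inv (hpos t ht).ne'
        simp only [one_div]
        exact this.congr_deriv (by ring))
      (ContinuousOn.div continuousOn_const (by fun_prop)
        fun t ht => pow_ne_zero 2 (hpos t ht).ne')
      (fun t ht => by rw [abs_of_pos (by have := hpos t ht; positivity)])
      (fun t ht => by
        rw [abs_div, abs_neg, abs_one, abs_of_pos (by have := hpos t ht; positivity)])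
    rw [integral_log_div_rpow_div hβ hA (by linarith) hab, mul_one] at this
    have e : D b - D a = ∑ n ∈ hq.index b \ hq.index a, 1 / q n -
        (harmonicMain α β A b - harmonicMain α β A a) := by
      simp only [hD, hq.harmonicSum_eq, hq.sum_index_sdiff hab]; ring
    rw [e]; exact this
  have hBA : 0 < B - A := by linarith [le_max_left A 1]
  have hz : Tendsto (fun y => K * log y ^ (A - B)) atTop (𝓝 0) := by
    have := ((tendsto_rpow_neg_atTop hBA).comp tendsto_log_atTop).const_mul K
    simpa using this
  obtain ⟨C, hC, hCb⟩ := exists_tendsto_of_abs_sub_le hz key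
  exact ⟨C, K, hK, hC, hCb⟩

lemma IsWellDistributed.tendsto_harmonicSum_atTop (hq : IsWellDistributed q α β A B)
    (hα : 0 < α) (hβ : 0 < β) (hA : 0 ≤ A) (hB : max A 1 < B) :
    Tendsto (harmonicSum q) atTop atTop := by
  obtain ⟨C, K, -, h, -⟩ := hq.exists_harmonicSum_expansion hβ hA hB
  have := h.add_atTop (tendsto_harmonicMain_atTop (A := A) hα hβ)
  simpa using this

/-- The harmonic sums reach every level first at some term of the sequence. -/
lemma IsWellDistributed.exists_isLeast (hq : IsWellDistributed q α β A B)
    (htop : Tendsto (harmonicSum q) atTop atTop) {V : ℝ} (hV : 0 < V) :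
    ∃ Z, IsLeast {z : ℝ | V ≤ harmonicSum q z} Z := by
  -- H jumps only at terms of the sequence, so its value at z is already taken at the largest q_n ≤
  -- z; positivity of V ensures that such a term exists. The well-ordering of the indices then
  -- supplies the minimum.
  have key : ∀ z, V ≤ harmonicSum q z → ∃ n, q n ≤ z ∧ V ≤ harmonicSum q (q n) := by
    intro z hz
    have hne : (hq.index z).Nonempty := by
      rw [Finset.nonempty_iff_ne_empty]
      intro h
      rw [hq.harmonicSum_eq, h, Finset.sum_empty] at hz
      linarith
    refine ⟨(hq.index z).max' hne, hq.mem_index.mp (Finset.max'_mem _ hne), ?_⟩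
    have : hq.index (q ((hq.index z).max' hne)) = hq.index z := by
      apply Finset.Subset.antisymm
      · exact hq.index_mono (hq.mem_index.mp (Finset.max'_mem _ hne))
      · intro m hm
        exact hq.mem_index.mpr (hq.mono (Finset.le_max' _ m hm))
    rwa [hq.harmonicSum_eq, this, ← hq.harmonicSum_eq]
  obtain ⟨z, hz⟩ := (htop.eventually_ge_atTop V).exists
  have hex : ∃ n, V ≤ harmonicSum q (q n) := (key z hz).imp fun n hn => hn.2
  refine ⟨q (PNat.find hex), PNat.find_spec hex, fun z hz => ?_⟩
  obtain ⟨n, hn, hn'⟩ := key z hz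
  exact (hq.mono (PNat.find_min' hex hn')).trans hn

/-- A crude upper bound for the harmonic sums. -/
lemma IsWellDistributed.exists_harmonicSum_le (hq : IsWellDistributed q α β A B)
    (hα : 0 < α) (hβ : 0 < β) (hA : 0 ≤ A) (hB : max A 1 < B) :
    ∃ K, 0 ≤ K ∧ ∀ y, 2 * (2 + β) ^ 2 ≤ y → 1 ≤ log (log y) →
      harmonicSum q y ≤ K * (log y ^ A * log (log y)) := by
  obtain ⟨C, K, hK, -, h⟩ := hq.exists_harmonicSum_expansion hβ hA hB
  obtain ⟨K₁, hK₁, h₁⟩ := log_div_rpow_le A hβ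
  set k := 2 + |log β| with hk
  have hk2 : 2 ≤ k := by rw [hk]; linarith [abs_nonneg (log β)]
  have hBA : 0 < B - A := by linarith [le_max_left A 1]
  refine ⟨K + |C| + |α / A| * K₁ + α * k, by positivity, fun y hy hll => ?_⟩
  have hb0 : 0 < (2 + β) ^ 2 := by positivity
  have hy' : (2 + β) ^ 2 ≤ y := by linarith
  obtain ⟨-, h2, h3, h4, h5⟩ := log_div_comparable hβ hy'
  have e1 : 1 ≤ log y ^ A := one_le_rpow h2 hA
  have e2 : log y ^ (A - B) ≤ 1 := rpow_le_one_of_one_le_of_nonpos h2 (by linarith)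
  have e3 : 1 ≤ log y ^ A * log (log y) := by nlinarith
  have e4 := (abs_le.mp (h y hy)).2
  -- The factor log log y is wasteful for A > 0, but it is the true size for A = 0 and lets one
  -- bound serve both cases.
  have e5 : harmonicMain α β A y ≤ (|α / A| * K₁ + α * k) * (log y ^ A * log (log y)) := by
    unfold harmonicMain
    split_ifs with hA0
    · have := (h₁ y hy').1
      have h7 : 0 ≤ log (y / β) ^ A := rpow_nonneg (by linarith) _
      calc α / A * log (y / β) ^ A ≤ |α / A| * (K₁ * log y ^ A) := by
            gcongr; exact le_abs_self _
        _ ≤ |α / A| * (K₁ * (log y ^ A * log (log y))) := by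
            gcongr; nlinarith
        _ ≤ _ := by nlinarith [show 0 ≤ α * k * (log y ^ A * log (log y)) by positivity]
    · have h6 : log (log (y / β)) ≤ log k + log (log y) := by
        rw [← log_mul (by linarith) (by linarith)]
        exact log_le_log (by linarith) h5
      have h7 : log k ≤ k - 1 := log_le_sub_one_of_pos (by linarith)
      have h8 : log (log (y / β)) ≤ k * (log y ^ A * log (log y)) := by
        have : k * log (log y) ≤ k * (log y ^ A * log (log y)) := by
          gcongr; nlinarith
        nlinarith
      calc α * log (log (y / β)) ≤ α * (k * (log y ^ A * log (log y))) := by gcongr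
        _ ≤ _ := by
          nlinarith [show 0 ≤ |α / A| * K₁ * (log y ^ A * log (log y)) by positivity]
  have e6 : K * log y ^ (A - B) ≤ K * (log y ^ A * log (log y)) := by gcongr; linarith
  have e7 : C ≤ |C| * (log y ^ A * log (log y)) := by
    nlinarith [le_abs_self C, abs_nonneg C]
  nlinarith

/-- The tail of the sum of the squares `1 / q_n ^ 2`. -/
lemma IsWellDistributed.exists_sum_sq_le (hq : IsWellDistributed q α β A B)
    (hα : 0 < α) (hβ : 0 < β) (hB : max A 1 < B) :
    ∃ K, 0 ≤ K ∧ ∀ y x, 2 * (2 + β) ^ 2 ≤ y → y ≤ x →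
      ∑ n ∈ hq.index x \ hq.index y, 1 / q n ^ 2 ≤ K * (log y ^ (A - 1) / y) := by
  obtain ⟨K, hK, h⟩ := hq.exists_abs_sum_sub_integral_le hβ hB
  obtain ⟨K₁, hK₁, h₁⟩ := log_div_rpow_le (A - 1) hβ
  obtain ⟨K₂, hK₂, h₂⟩ := log_rpow_slowly_varying (A - 1)
  refine ⟨2 * K + α * (K₁ * K₂ * 2), by positivity, fun y x hy hyx => ?_⟩
  have hb0 : 0 < (2 + β) ^ 2 := by positivity
  have hy' : (2 + β) ^ 2 ≤ y := by linarith
  have hy0 : 0 < y := by linarith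
  obtain ⟨he, h2, h3, -⟩ := log_div_comparable hβ hy'
  have hpos : ∀ t ∈ Icc y x, 0 < t := fun t ht => by linarith [ht.1]
  -- For t ≥ y, both 1/t² ≤ (2/y)/t and 2/t³ ≤ (2/y)/t²; this gives c = 2/y.
  have hmain := h y x (2 / y) (fun t => 1 / t ^ 2) (fun t => -2 / t ^ 3) hy hyx (by positivity)
      (fun t ht => by
        have := ((hasDerivAt_id t).pow 2).inv (pow_ne_zero 2 (hpos t ht).ne')
        simp only [one_div]
        refine this.congr_deriv ?_
        have := (hpos t ht).ne'
        simp only [id, Nat.cast_ofNat, Pi.pow_apply]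
        field_simp
        simp)
      (ContinuousOn.div continuousOn_const (by fun_prop)
        fun t ht => pow_ne_zero 3 (hpos t ht).ne')
      (fun t ht => by
        have h0 := hpos t ht
        rw [abs_of_pos (by positivity), div_div, div_le_div_iff₀ (by positivity) (by positivity)]
        nlinarith [ht.1])
      (fun t ht => by
        have h0 := hpos t ht
        rw [abs_div, abs_neg, abs_two, abs_of_pos (by positivity : 0 < t ^ 3), div_div,
          div_le_div_iff₀ (by positivity) (by positivity)]
        have : y * t ^ 2 ≤ t * t ^ 2 := by gcongr; exact ht.1
        nlinarith)
  have hint : ∫ t in y..x, 1 / t ^ 2 * log (t / β) ^ (A - 1) ≤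
      K₁ * K₂ * 2 * (log y ^ (A - 1) / y) := by
    have hI : IntervalIntegrable (fun t : ℝ => t ^ (-(3 / 2) : ℝ)) volume y x := by
      apply intervalIntegral.intervalIntegrable_rpow
      right
      rw [uIcc_of_le hyx]; exact fun h0 => by linarith [h0.1]
    calc ∫ t in y..x, 1 / t ^ 2 * log (t / β) ^ (A - 1)
        ≤ ∫ t in y..x, (K₁ * K₂ * log y ^ (A - 1) * y ^ (-(1 / 2) : ℝ)) * t ^ (-(3 / 2) : ℝ) := by
          apply intervalIntegral.integral_mono_on hyx
          · apply IntervalIntegrable.continuousOn_mul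
            · exact intervalIntegrable_log_div_rpow _ hβ hy' hyx
            · rw [uIcc_of_le hyx]
              exact ContinuousOn.div continuousOn_const (by fun_prop)
                fun t ht => pow_ne_zero 2 (hpos t ht).ne'
          · exact hI.const_mul _
          · intro t ht
            have ht0 := hpos t ht
            have e1 := (h₁ t (hy'.trans ht.1)).1
            have e2 := (h₂ y t he ht.1).2
            have e3 : t ^ (-(3 / 2) : ℝ) = 1 / t ^ 2 * t ^ (1 / 2 : ℝ) := by
              rw [one_div, ← rpow_natCast, ← rpow_neg ht0.le, ← rpow_add ht0]; norm_num
            have e4 : (t / y) ^ (1 / 2 : ℝ) = t ^ (1 / 2 : ℝ) * y ^ (-(1 / 2) : ℝ) := by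
              rw [div_rpow ht0.le hy0.le, rpow_neg hy0.le]; rfl
            rw [e3]
            calc 1 / t ^ 2 * log (t / β) ^ (A - 1)
                ≤ 1 / t ^ 2 * (K₁ * (K₂ * (t / y) ^ (1 / 2 : ℝ) * log y ^ (A - 1))) := by
                  gcongr; exact e1.trans (by gcongr)
              _ = _ := by rw [e4]; ring
      _ = (K₁ * K₂ * log y ^ (A - 1) * y ^ (-(1 / 2) : ℝ)) *
            ((y ^ (-(1 / 2) : ℝ) - x ^ (-(1 / 2) : ℝ)) * 2) := by
          rw [intervalIntegral.integral_const_mul, integral_rpow (Or.inr ⟨by norm_num, by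
            rw [uIcc_of_le hyx]; exact fun h0 => by linarith [h0.1]⟩)]
          norm_num
          left; ring
      _ ≤ (K₁ * K₂ * log y ^ (A - 1) * y ^ (-(1 / 2) : ℝ)) * (y ^ (-(1 / 2) : ℝ) * 2) := by
          have : 0 ≤ x ^ (-(1 / 2) : ℝ) := rpow_nonneg (by linarith) _
          gcongr
          linarith
      _ = K₁ * K₂ * 2 * (log y ^ (A - 1) * (y ^ (-(1 / 2) : ℝ) * y ^ (-(1 / 2) : ℝ))) := by ring
      _ = _ := by
          rw [← rpow_add hy0]; norm_num [rpow_neg_one]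
          left; rw [div_eq_mul_inv]
  have e8 : log y ^ (A - B) ≤ log y ^ (A - 1) :=
    rpow_le_rpow_of_exponent_le h2 (by linarith [le_max_right A 1])
  calc ∑ n ∈ hq.index x \ hq.index y, 1 / q n ^ 2
      ≤ α * (∫ t in y..x, 1 / t ^ 2 * log (t / β) ^ (A - 1)) + K * (2 / y) * log y ^ (A - B) := by
        linarith [(abs_le.mp hmain).2]
    _ ≤ α * (K₁ * K₂ * 2 * (log y ^ (A - 1) / y)) + K * (2 / y) * log y ^ (A - 1) := by gcongr
    _ = _ := by ring

/-- The counting function eventually exceeds the square root. -/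
lemma IsWellDistributed.eventually_rpow_le_count (hq : IsWellDistributed q α β A B)
    (hα : 0 < α) (hβ : 0 < β) (hB : max A 1 < B) :
    ∀ᶠ x in atTop, x ^ (1 / 2 : ℝ) ≤ (count q x : ℝ) := by
  obtain ⟨C, hC, h⟩ := hq.exists_abs_count_sub_le hβ
  obtain ⟨K₁, hK₁, h₁⟩ := log_div_rpow_le (A - 1) hβ
  obtain ⟨K₂, hK₂, h₂⟩ := log_rpow_slowly_varying (A - 1)
  have hb0 : 0 < (2 + β) ^ 2 := by positivity
  set c := α / (K₁ * K₂) * (1 / 4) with hc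
  have hc0 : 0 < c := by positivity
  -- The part of the integral over [x/2, x] suffices, since there (log (t/β))^(A-1) has the order of
  -- (log x)^(A-1).
  have hint : ∀ x, 4 * (2 + β) ^ 2 ≤ x →
      c * (x * log x ^ (A - 1)) ≤ α * ∫ t in ((2 + β) ^ 2)..x, log (t / β) ^ (A - 1) := by
    intro x hx
    have hx0 : 0 < x := by linarith
    have hbx : (2 + β) ^ 2 ≤ x := by linarith
    have hlx := (log_div_comparable hβ hbx).2.1
    have hhalf : x / 2 ≤ x := by linarith
    have hbh : (2 + β) ^ 2 ≤ x / 2 := by linarith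
    have hsplit := intervalIntegral.integral_add_adjacent_intervals
      (intervalIntegrable_log_div_rpow (A - 1) hβ le_rfl hbh)
      (intervalIntegrable_log_div_rpow (A - 1) hβ hbh hhalf)
    have hnn : 0 ≤ ∫ t in ((2 + β) ^ 2)..(x / 2), log (t / β) ^ (A - 1) :=
      intervalIntegral.integral_nonneg hbh fun t ht =>
        rpow_nonneg (by linarith [(log_div_comparable hβ ht.1).2.2.1]) _
    have hlow : ∫ t in (x / 2)..x, (1 / (K₁ * K₂) * (1 / 2) * log x ^ (A - 1)) ≤
        ∫ t in (x / 2)..x, log (t / β) ^ (A - 1) := by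
      apply intervalIntegral.integral_mono_on hhalf (by simp)
        (intervalIntegrable_log_div_rpow (A - 1) hβ hbh hhalf)
      intro t ht
      have htb := hbh.trans ht.1
      have ht0 : 0 < t := by linarith
      have e1 := (h₁ t htb).2
      have e2 := (h₂ t x (log_div_comparable hβ htb).1 ht.2).2
      have e3 : (x / t) ^ (1 / 2 : ℝ) ≤ 2 := by
        have h4 : (x / t) ^ (1 / 2 : ℝ) ≤ 4 ^ (1 / 2 : ℝ) := by
          apply rpow_le_rpow (by positivity) _ (by norm_num)
          rw [div_le_iff₀ ht0]; linarith [ht.1]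
        have h5 : (4 : ℝ) ^ (1 / 2 : ℝ) = 2 := by
          rw [show (4 : ℝ) = 2 ^ (2 : ℝ) by norm_num, ← rpow_mul (by norm_num)]; norm_num
        linarith
      have hlt : 0 ≤ log t ^ (A - 1) :=
        rpow_nonneg (by linarith [(log_div_comparable hβ htb).2.1]) _
      have e4 : log x ^ (A - 1) ≤ K₂ * 2 * (K₁ * log (t / β) ^ (A - 1)) := by
        calc _ ≤ K₂ * (x / t) ^ (1 / 2 : ℝ) * log t ^ (A - 1) := e2
          _ ≤ K₂ * 2 * (K₁ * log (t / β) ^ (A - 1)) := by gcongr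
      calc 1 / (K₁ * K₂) * (1 / 2) * log x ^ (A - 1)
          ≤ 1 / (K₁ * K₂) * (1 / 2) * (K₂ * 2 * (K₁ * log (t / β) ^ (A - 1))) := by gcongr
        _ = _ := by field_simp
    rw [intervalIntegral.integral_const, smul_eq_mul] at hlow
    rw [← hsplit]
    calc c * (x * log x ^ (A - 1)) =
        α * ((x - x / 2) * (1 / (K₁ * K₂) * (1 / 2) * log x ^ (A - 1))) := by
          rw [hc]; field_simp; ring
      _ ≤ _ := by gcongr; linarith
  have hB0 : 0 < B := by linarith [le_max_right A 1]
  have ev1 : ∀ᶠ x in atTop, C * log x ^ (-B) ≤ c / 2 := by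
    have := ((tendsto_rpow_neg_atTop hB0).comp tendsto_log_atTop).const_mul C
    simp only [mul_zero] at this
    exact this.eventually_le_const (by positivity)
  have ev2 : ∀ᶠ x : ℝ in atTop, log x ^ (1 - A) ≤ c / 2 * x ^ (1 / 2 : ℝ) := by
    have := (isLittleO_log_rpow_rpow_atTop (1 - A) (by norm_num : (0 : ℝ) < 1 / 2)).bound
      (half_pos hc0)
    filter_upwards [this, eventually_ge_atTop 1] with x hx hx1
    rw [norm_eq_abs, norm_eq_abs, abs_of_nonneg (rpow_nonneg (log_nonneg hx1) _),
      abs_of_nonneg (by positivity)] at hx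
    exact hx
  filter_upwards [ev1, ev2, eventually_ge_atTop (4 * (2 + β) ^ 2)] with x e1 e2 e3
  have hx0 : 0 < x := by linarith
  have hlx : 0 < log x := by linarith [(log_div_comparable hβ (by linarith : (2 + β) ^ 2 ≤ x)).2.1]
  have e4 := (abs_le.mp (h x (by linarith))).1
  have e5 := hint x e3
  have hp : 0 < log x ^ (A - 1) := by positivity
  have e6 : C * (x * log x ^ (A - 1 - B)) ≤ c / 2 * (x * log x ^ (A - 1)) := by
    rw [sub_eq_add_neg (A - 1) B, rpow_add hlx]
    calc C * (x * (log x ^ (A - 1) * log x ^ (-B))) = C * log x ^ (-B) * (x * log x ^ (A - 1)) := by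
          ring
      _ ≤ _ := by gcongr
  have e7 : x ^ (1 / 2 : ℝ) ≤ c / 2 * (x * log x ^ (A - 1)) := by
    have h9 : log x ^ (1 - A) * log x ^ (A - 1) = 1 := by rw [← rpow_add hlx]; simp
    have h10 : x ^ (1 / 2 : ℝ) * x ^ (1 / 2 : ℝ) = x := by rw [← rpow_add hx0]; norm_num
    calc x ^ (1 / 2 : ℝ) = x ^ (1 / 2 : ℝ) * (log x ^ (1 - A) * log x ^ (A - 1)) := by
          rw [h9, mul_one]
      _ ≤ x ^ (1 / 2 : ℝ) * (c / 2 * x ^ (1 / 2 : ℝ) * log x ^ (A - 1)) := by gcongr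
      _ = c / 2 * ((x ^ (1 / 2 : ℝ) * x ^ (1 / 2 : ℝ)) * log x ^ (A - 1)) := by ring
      _ = _ := by rw [h10]
  linarith

end Harmonic

/-! ### Bounds for cumulant generating functions and the integral η -/

/-- The bounds satisfied by the cumulant generating functions of the random variables
of the hypothesis `CRVH`. -/
structure CgfBounds (D : ℝ) (g : ℝ → ℝ) : Prop where
  nonneg : ∀ u, 0 ≤ u → 0 ≤ g u
  le_sq : ∀ u, 0 ≤ u → u ≤ 1 → g u ≤ u ^ 2
  le_self : ∀ u, 0 ≤ u → g u ≤ u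
  lower : ∀ u, 1 ≤ u → u - D * (u / (1 + log u / 2) ^ 2) ≤ g u

/-- The function `f` attached to a cumulant generating function `g`. -/
noncomputable def cutoff (g : ℝ → ℝ) (u : ℝ) : ℝ := if u < 1 then g u else g u - u

lemma CgfBounds.abs_sub_le {D : ℝ} {g : ℝ → ℝ} (h : CgfBounds D g) {u : ℝ} (hu : 1 ≤ u) :
    |g u - u| ≤ D * (u / (1 + log u / 2) ^ 2) := by
  rw [abs_le]
  have := h.lower u hu
  have := h.le_self u (by linarith)
  constructor <;> linarith

lemma CgfBounds.const_nonneg {D : ℝ} {g : ℝ → ℝ} (h : CgfBounds D g) : 0 ≤ D := by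
  have := h.abs_sub_le le_rfl
  simp only [log_one] at this
  norm_num at this
  exact (abs_nonneg _).trans this

/-- This derivative, times D, majorises |f(u)|/u² for u ≥ 1. Its antiderivative is explicit and
vanishes at infinity, which gives both the convergence of η and the size 2D/(1 + (log X)/2) of its
tail. -/
lemma hasDerivAt_inv_one_add_log {u : ℝ} (hu : 1 ≤ u) :
    HasDerivAt (fun u => -2 / (1 + log u / 2)) (1 / (u * (1 + log u / 2) ^ 2)) u := by
  have hl := log_nonneg hu
  have h1 : HasDerivAt (fun u => 1 + log u / 2) (u⁻¹ / 2) u :=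
    ((hasDerivAt_log (by linarith)).div_const 2).const_add 1
  have h2 := (hasDerivAt_const u (-2 : ℝ)).div h1 (by positivity)
  refine h2.congr_deriv ?_
  have : u ≠ 0 := by linarith
  have : 1 + log u / 2 ≠ 0 := by positivity
  field_simp
  ring

lemma tendsto_inv_one_add_log :
    Tendsto (fun u => -2 / (1 + log u / 2)) atTop (𝓝 0) := by
  apply Tendsto.div_atTop tendsto_const_nhds
  apply tendsto_atTop_add_const_left
  exact tendsto_log_atTop.atTop_div_const (by norm_num)

lemma integrableOn_inv_mul_sq {X : ℝ} (hX : 1 ≤ X) :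
    IntegrableOn (fun u => 1 / (u * (1 + log u / 2) ^ 2)) (Ioi X) := by
  refine integrableOn_Ioi_deriv_of_nonneg (g := fun u => -2 / (1 + log u / 2))
    (hasDerivAt_inv_one_add_log hX).continuousAt.continuousWithinAt
    (fun u hu => hasDerivAt_inv_one_add_log (hX.trans (le_of_lt hu))) (fun u hu => ?_)
    tendsto_inv_one_add_log
  have : 0 < u := by simp only [mem_Ioi] at hu; linarith
  positivity

lemma integral_inv_mul_sq {X : ℝ} (hX : 1 ≤ X) :
    ∫ u in Ioi X, 1 / (u * (1 + log u / 2) ^ 2) = 2 / (1 + log X / 2) := by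
  rw [integral_Ioi_of_hasDerivAt_of_nonneg (g := fun u => -2 / (1 + log u / 2))
    (hasDerivAt_inv_one_add_log hX).continuousAt.continuousWithinAt
    (fun u hu => hasDerivAt_inv_one_add_log (hX.trans (le_of_lt hu))) (fun u hu => ?_)
    tendsto_inv_one_add_log]
  · ring
  · have : 0 < u := by simp only [mem_Ioi] at hu; linarith
    positivity

section Eta

variable {D : ℝ} {g : ℝ → ℝ}

lemma CgfBounds.abs_cutoff_div_le_of_lt (h : CgfBounds D g) {u : ℝ} (hu : 0 < u) (hu1 : u < 1) :
    |cutoff g u / u ^ 2| ≤ 1 := by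
  rw [cutoff, if_pos hu1, abs_div, abs_of_nonneg (h.nonneg u hu.le), abs_of_pos (by positivity),
    div_le_one (by positivity)]
  exact h.le_sq u hu.le hu1.le

lemma CgfBounds.abs_cutoff_div_le_of_le (h : CgfBounds D g) {u : ℝ} (hu : 1 ≤ u) :
    |cutoff g u / u ^ 2| ≤ D * (1 / (u * (1 + log u / 2) ^ 2)) := by
  have hl := log_nonneg hu
  have hu0 : 0 < u := by linarith
  rw [cutoff, if_neg (not_lt.mpr hu), abs_div, abs_of_pos (by positivity : 0 < u ^ 2),
    div_le_iff₀ (by positivity)]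
  refine (h.abs_sub_le hu).trans (le_of_eq ?_)
  field_simp

lemma measurable_cutoff_div (hg : Continuous g) : Measurable fun u => cutoff g u / u ^ 2 := by
  unfold cutoff
  exact (Measurable.ite measurableSet_Iio hg.measurable
    (hg.measurable.sub measurable_id)).div (by fun_prop)

lemma CgfBounds.integrableOn_Ioi (h : CgfBounds D g) (hg : Continuous g) {X : ℝ} (hX : 1 ≤ X) :
    IntegrableOn (fun u => cutoff g u / u ^ 2) (Ioi X) := by
  refine Integrable.mono' ((integrableOn_inv_mul_sq hX).const_mul D)
    (measurable_cutoff_div hg).aestronglyMeasurable ?_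
  filter_upwards [ae_restrict_mem measurableSet_Ioi] with u hu
  exact h.abs_cutoff_div_le_of_le (hX.trans (le_of_lt hu))

lemma CgfBounds.integrableOn_Ioo (h : CgfBounds D g) (hg : Continuous g) :
    IntegrableOn (fun u => cutoff g u / u ^ 2) (Ioo 0 1) := by
  refine Integrable.mono' (g := fun _ => (1 : ℝ)) ?_
    (measurable_cutoff_div hg).aestronglyMeasurable ?_
  · rw [← IntegrableOn, integrableOn_const_iff]; simp
  · filter_upwards [ae_restrict_mem measurableSet_Ioo] with u hu
    exact h.abs_cutoff_div_le_of_lt hu.1 hu.2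

lemma CgfBounds.integrableOn_cutoff (h : CgfBounds D g) (hg : Continuous g) :
    IntegrableOn (fun u => cutoff g u / u ^ 2) (Ioi 0) := by
  have h1 := (h.integrableOn_Ioo hg).congr_set_ae Ioo_ae_eq_Ioc.symm
  rw [← Ioc_union_Ioi_eq_Ioi zero_le_one]
  exact h1.union (h.integrableOn_Ioi hg le_rfl)

/-- Truncation of the integral defining `η`. -/
lemma CgfBounds.abs_eta_sub_le (h : CgfBounds D g) (hg : Continuous g) {x X : ℝ} (hx : 0 < x)
    (hx1 : x ≤ 1) (hX : 1 ≤ X) :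
    |(∫ u in Ioi 0, cutoff g u / u ^ 2) -
      ((∫ u in x..1, g u / u ^ 2) + ∫ u in (1 : ℝ)..X, (g u - u) / u ^ 2)| ≤
        x + D * (2 / (1 + log X / 2)) := by
  set F := fun u => cutoff g u / u ^ 2 with hF
  have hI := h.integrableOn_cutoff hg
  have hI1 : IntegrableOn F (Ioc 0 x) := hI.mono_set Ioc_subset_Ioi_self
  have hI2 : IntegrableOn F (Ioi x) := hI.mono_set (Ioi_subset_Ioi hx.le)
  have hI3 : IntegrableOn F (Ioc x 1) := hI2.mono_set Ioc_subset_Ioi_self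
  have hI4 : IntegrableOn F (Ioi 1) := hI2.mono_set (Ioi_subset_Ioi hx1)
  have hI5 : IntegrableOn F (Ioc 1 X) := hI4.mono_set Ioc_subset_Ioi_self
  have hI6 : IntegrableOn F (Ioi X) := hI4.mono_set (Ioi_subset_Ioi hX)
  have e1 : ∫ u in Ioi 0, F u = (∫ u in Ioc 0 x, F u) + ∫ u in Ioi x, F u := by
    rw [← Ioc_union_Ioi_eq_Ioi hx.le, setIntegral_union Ioc_disjoint_Ioi_same measurableSet_Ioi
      hI1 hI2]
  have e2 : ∫ u in Ioi x, F u = (∫ u in Ioc x 1, F u) + ∫ u in Ioi 1, F u := by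
    rw [← Ioc_union_Ioi_eq_Ioi hx1, setIntegral_union Ioc_disjoint_Ioi_same measurableSet_Ioi
      hI3 hI4]
  have e3 : ∫ u in Ioi 1, F u = (∫ u in Ioc 1 X, F u) + ∫ u in Ioi X, F u := by
    rw [← Ioc_union_Ioi_eq_Ioi hX, setIntegral_union Ioc_disjoint_Ioi_same measurableSet_Ioi
      hI5 hI6]
  -- At u = 1 `cutoff` already takes its second branch, so the right endpoint has to be dropped
  -- before the integrands agree.
  have e4 : ∫ u in Ioc x 1, F u = ∫ u in x..1, g u / u ^ 2 := by
    rw [intervalIntegral.integral_of_le hx1, integral_Ioc_eq_integral_Ioo,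
      integral_Ioc_eq_integral_Ioo]
    refine setIntegral_congr_fun measurableSet_Ioo fun u hu => ?_
    simp only [hF, cutoff, if_pos hu.2]
  have e5 : ∫ u in Ioc 1 X, F u = ∫ u in (1 : ℝ)..X, (g u - u) / u ^ 2 := by
    rw [intervalIntegral.integral_of_le hX]
    refine setIntegral_congr_fun measurableSet_Ioc fun u hu => ?_
    simp only [hF, cutoff, if_neg (not_lt.mpr hu.1.le)]
  have b1 : |∫ u in Ioc 0 x, F u| ≤ x := by
    rw [integral_Ioc_eq_integral_Ioo]
    have := norm_setIntegral_le_of_norm_le_const (μ := volume) (s := Ioo 0 x) (f := F) (C := 1)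
      (by simp) (fun u hu => h.abs_cutoff_div_le_of_lt hu.1 (hu.2.trans_le hx1))
    simpa [hx.le] using this
  have b2 : |∫ u in Ioi X, F u| ≤ D * (2 / (1 + log X / 2)) := by
    rw [← integral_inv_mul_sq hX, ← integral_const_mul, ← norm_eq_abs]
    apply norm_integral_le_of_norm_le ((integrableOn_inv_mul_sq hX).const_mul D)
    filter_upwards [ae_restrict_mem measurableSet_Ioi] with u hu
    exact h.abs_cutoff_div_le_of_le (hX.trans (le_of_lt hu))
  rw [e1, e2, e3, e4, e5]
  have := abs_add_le (∫ u in Ioc 0 x, F u) (∫ u in Ioi X, F u)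
  rw [show ∀ a b c d : ℝ, a + (b + (c + d)) - (b + c) = a + d by intros; ring]
  linarith

/-- Truncation with x = X = 1, where both truncated integrals are empty. A bound on η in terms of D
alone confines the saddle point -η - 1 to an interval fixed in advance. -/
lemma CgfBounds.abs_eta_le (h : CgfBounds D g) (hg : Continuous g) :
    |∫ u in Ioi 0, cutoff g u / u ^ 2| ≤ 1 + 2 * D := by
  have := h.abs_eta_sub_le hg zero_lt_one le_rfl le_rfl
  simp only [intervalIntegral.integral_same, add_zero, sub_zero, log_one, zero_div, div_one] at this
  linarith

end Eta

/-! ### From integrals against the density of the sequence to η -/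

/-- The substitution `u = s / t`. -/
lemma integral_comp_div {F : ℝ → ℝ} (hF : Continuous F) {s a b : ℝ} (hs : 0 < s) (ha : 0 < a)
    (hab : a ≤ b) :
    ∫ t in a..b, F (s / t) = s * ∫ u in (s / b)..(s / a), F u / u ^ 2 := by
  have hb : 0 < b := by linarith
  have hpos : ∀ t ∈ uIcc a b, 0 < t := by
    rw [uIcc_of_le hab]; exact fun t ht => by linarith [ht.1]
  have h := intervalIntegral.integral_comp_mul_deriv'' (a := a) (b := b) (f := fun t => s / t)
    (f' := fun t => -s / t ^ 2) (g := fun u => F u / u ^ 2)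
    (ContinuousOn.div continuousOn_const continuousOn_id fun t ht => (hpos t ht).ne')
    (fun t ht => by
      have ht0 : t ≠ 0 := by
        rw [min_eq_left hab] at ht; have := ht.1; intro h; linarith
      have := ((hasDerivAt_const t s).div (hasDerivAt_id t) ht0)
      refine (this.congr_deriv ?_).hasDerivWithinAt
      simp)
    (ContinuousOn.div continuousOn_const (by fun_prop) fun t ht => pow_ne_zero 2 (hpos t ht).ne')
    (by
      apply ContinuousOn.div hF.continuousOn (by fun_prop)
      rintro u ⟨t, ht, rfl⟩
      have := hpos t ht
      positivity)
  have e : ∫ t in a..b, ((fun u => F u / u ^ 2) ∘ fun t => s / t) t * (-s / t ^ 2) =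
      ∫ t in a..b, (-(1 / s)) * F (s / t) := by
    apply intervalIntegral.integral_congr
    intro t ht
    have := hpos t ht
    simp only [Function.comp]
    field_simp
  rw [e, intervalIntegral.integral_const_mul] at h
  rw [intervalIntegral.integral_symm (s / a) (s / b), ← h]
  field_simp

section Weights

variable {α β A D : ℝ}

/-- The mean value theorem: log (t/β) and log s differ by at most |log β| + |log (s/t)|, and they
are comparable for √s ≤ t ≤ s². -/
lemma exists_abs_weight_sub_le (A : ℝ) (hβ : 0 < β) :
    ∃ C, 0 ≤ C ∧ ∀ s t : ℝ, (2 + β) ^ 2 ≤ √s → √s ≤ t → t ≤ s ^ 2 →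
      |log (t / β) ^ (A - 1) - log s ^ (A - 1)| ≤ C * log s ^ (A - 2) * (1 + |log (s / t)|) := by
  set m := 2 + |log β| with hm
  have hm2 : 2 ≤ m := by rw [hm]; linarith [abs_nonneg (log β)]
  refine ⟨|A - 1| * (2 * m) ^ |A - 2| * m, by positivity, fun s t hs hst hts => ?_⟩
  have hb : 0 < (2 + β) ^ 2 := by positivity
  have hs0 : 0 < s := by
    by_contra h
    rw [sqrt_eq_zero_of_nonpos (not_lt.mp h)] at hs
    linarith
  have ht0 : 0 < t := by linarith
  obtain ⟨-, h1, h2, h3, h4⟩ := log_div_comparable hβ (hs.trans hst)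
  have h5 : log s / 2 ≤ log t := by
    rw [← log_sqrt hs0.le]; exact log_le_log (by linarith) hst
  have h6 : log t ≤ 2 * log s := by
    have := log_le_log ht0 hts
    rwa [log_pow, Nat.cast_ofNat] at this
  have h7 : 0 < log s := by linarith
  have key := abs_rpow_sub_rpow_le (A - 1) (k := 2 * m) (by linarith) (by linarith) h7
    (h4.trans (by nlinarith)) (show log s ≤ 2 * m * log (t / β) by nlinarith)
  rw [show A - 1 - 1 = A - 2 by ring] at key
  have h8 : |log (t / β) - log s| ≤ m * (1 + |log (s / t)|) := by
    rw [log_div ht0.ne' hβ.ne', log_div hs0.ne' ht0.ne']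
    have e : log t - log β - log s = -((log s - log t) + log β) := by ring
    rw [e, abs_neg]
    have := abs_add_le (log s - log t) (log β)
    nlinarith [abs_nonneg (log s - log t), abs_nonneg (log β)]
  have h9 : 0 ≤ log s ^ (A - 2) := rpow_nonneg h7.le _
  calc _ ≤ _ := key
    _ ≤ |A - 1| * (2 * m) ^ |A - 2| * (m * (1 + |log (s / t)|)) * log s ^ (A - 2) := by gcongr
    _ = _ := by ring

/-- Freezing the weight at `s` loses a factor (1 + |log (s/t)|)/log s relative to the main size. The
majorant `bd` absorbs φ together with 1 + |log (s/t)|, and its antiderivative `Bd` evaluates the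
total loss. -/
lemma abs_integral_mul_weight_sub_le (hβ : 0 < β) {C s a b : ℝ} {φ bd Bd : ℝ → ℝ}
    (hC : ∀ t ∈ Icc a b,
      |log (t / β) ^ (A - 1) - log s ^ (A - 1)| ≤ C * log s ^ (A - 2) * (1 + |log (s / t)|))
    (ha : (2 + β) ^ 2 ≤ a) (hab : a ≤ b) (hφ : ContinuousOn φ (Icc a b))
    (hCnn : 0 ≤ C * log s ^ (A - 2))
    (hbd : ∀ t ∈ Icc a b, |φ t| * (1 + |log (s / t)|) ≤ bd t)
    (hBd : ∀ t ∈ Icc a b, HasDerivAt Bd (bd t) t) (hbdc : ContinuousOn bd (Icc a b)) :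
    |(∫ t in a..b, φ t * log (t / β) ^ (A - 1)) - (∫ t in a..b, φ t) * log s ^ (A - 1)| ≤
      C * log s ^ (A - 2) * (Bd b - Bd a) := by
  have hu := uIcc_of_le hab
  have hbdI : IntervalIntegrable bd volume a b := by
    apply ContinuousOn.intervalIntegrable; rwa [hu]
  have hφI : IntervalIntegrable φ volume a b := by
    apply ContinuousOn.intervalIntegrable; rwa [hu]
  have hw := intervalIntegrable_log_div_rpow (A - 1) hβ ha hab
  rw [← intervalIntegral.integral_mul_const, ← intervalIntegral.integral_sub
    (hw.continuousOn_mul (by rwa [hu])) (hφI.mul_const _),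
    ← intervalIntegral.integral_eq_sub_of_hasDerivAt (by rwa [hu]) hbdI,
    ← intervalIntegral.integral_const_mul, ← norm_eq_abs]
  apply intervalIntegral.norm_integral_le_of_norm_le hab _ (hbdI.const_mul _)
  filter_upwards with t ht
  have ht' := Ioc_subset_Icc_self ht
  rw [norm_eq_abs, ← mul_sub, abs_mul]
  calc |φ t| * |log (t / β) ^ (A - 1) - log s ^ (A - 1)|
      ≤ |φ t| * (C * log s ^ (A - 2) * (1 + |log (s / t)|)) := by gcongr; exact hC t ht'
    _ = C * log s ^ (A - 2) * (|φ t| * (1 + |log (s / t)|)) := by ring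
    _ ≤ _ := mul_le_mul_of_nonneg_left (hbd t ht') hCnn

set_option maxHeartbeats 600000 in
/-- The integral over the bulk range, with the weight of the sequence, in terms of `η`. -/
lemma exists_abs_integral_sub_eta_le (A : ℝ) (hβ : 0 < β) (D : ℝ) :
    ∃ K, 0 ≤ K ∧ ∀ g : ℝ → ℝ, CgfBounds D g → Continuous g → ∀ s : ℝ, (2 + β) ^ 2 ≤ √s →
      1 ≤ log (log s) →
      |((∫ t in (√s)..s, (g (s / t) - s / t) * log (t / β) ^ (A - 1)) +
        ∫ t in s..(s * log s), g (s / t) * log (t / β) ^ (A - 1)) -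
          s * (∫ u in Ioi 0, cutoff g u / u ^ 2) * log s ^ (A - 1)| ≤
        K * (s * (log s ^ (A - 2) * log (log s))) := by
  obtain ⟨C, hC0, hC⟩ := exists_abs_weight_sub_le A hβ
  refine ⟨C * (4 * |D|) + C + (1 + 8 * |D|), by positivity, fun g hg hgc s hs hll => ?_⟩
  have hD := hg.const_nonneg
  rw [abs_of_nonneg hD]
  have hb : 4 < (2 + β) ^ 2 := by nlinarith
  have hr0 : 0 < √s := by linarith
  have hs0 : 0 < s := by
    by_contra h
    rw [sqrt_eq_zero_of_nonpos (not_lt.mp h)] at hr0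
    linarith
  have hrr : √s * √s = s := mul_self_sqrt hs0.le
  have hrs : √s ≤ s := by nlinarith
  have hlpos : 0 < log s := log_pos (by linarith)
  have hle : exp 1 ≤ log s := by rwa [le_log_iff_exp_le hlpos] at hll
  have hl2 : 2 ≤ log s := by linarith [add_one_le_exp (1 : ℝ)]
  have hls : log s ≤ s := (log_le_sub_one_of_pos hs0).trans (by linarith)
  have hslog : s ≤ s * log s := by nlinarith
  have hslog2 : s * log s ≤ s ^ 2 := by nlinarith
  set w : ℝ := log s ^ (A - 2) with hw
  have hw0 : 0 ≤ w := rpow_nonneg hlpos.le _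
  have hCw : 0 ≤ C * w := by positivity
  have hpos1 : ∀ t ∈ Icc (√s) s, 0 < t := fun t ht => hr0.trans_le ht.1
  have hpos2 : ∀ t ∈ Icc s (s * log s), 0 < t := fun t ht => hs0.trans_le ht.1
  have hdiv : ∀ a b : ℝ, (∀ t ∈ Icc a b, 0 < t) → ContinuousOn (fun t => s / t) (Icc a b) :=
    fun a b h => ContinuousOn.div continuousOn_const continuousOn_id fun t ht => (h t ht).ne'
  have hge1 : ∀ t ∈ Icc (√s) s, 1 ≤ s / t := fun t ht => by
    rw [le_div_iff₀ (hpos1 t ht)]; linarith [ht.2]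
  -- One factor 1 + log (s/t) cancels one of the two logarithmic factors in the bound for u - g(u).
  -- What remains integrates to an iterated logarithm, one of the sources of log log s in `errSize`.
  have p1 := abs_integral_mul_weight_sub_le (A := A) (C := C) (s := s) (a := √s) (b := s)
    (φ := fun t => g (s / t) - s / t)
    (bd := fun t => 2 * D * s * ((1 / t) / (1 + log (s / t) / 2)))
    (Bd := fun t => 2 * D * s * (-2 * log (1 + log (s / t) / 2))) hβ
    (fun t ht => hC s t hs ht.1 (ht.2.trans (by nlinarith))) hs hrs
    ((hgc.comp_continuousOn (hdiv _ _ hpos1)).sub (hdiv _ _ hpos1)) hCw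
    (fun t ht => by
      have h1 := hge1 t ht
      have h2 := log_nonneg h1
      have ht0 := hpos1 t ht
      rw [abs_of_nonneg h2]
      calc |g (s / t) - s / t| * (1 + log (s / t))
          ≤ D * (s / t / (1 + log (s / t) / 2) ^ 2) * (2 * (1 + log (s / t) / 2)) := by
            gcongr
            · exact hg.abs_sub_le h1
            · linarith
        _ = _ := by field_simp)
    (fun t ht => by
      have h2 := log_nonneg (hge1 t ht)
      have ht0 := hpos1 t ht
      have d1 := ((hasDerivAt_const t s).div (hasDerivAt_id t) ht0.ne')
      have d2 := (((d1.log (by simp only [Pi.div_apply, id]; positivity)).div_const 2).const_add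
        1).log (by simp only [Pi.div_apply, id]; positivity)
      have d3 := (d2.const_mul (-2)).const_mul (2 * D * s)
      refine d3.congr_deriv ?_
      simp only [Pi.div_apply, id]
      field_simp
      ring)
    (by
      refine continuousOn_const.mul (ContinuousOn.div
        (ContinuousOn.div continuousOn_const continuousOn_id fun t ht => (hpos1 t ht).ne') ?_ ?_)
      · exact continuousOn_const.add (((hdiv _ _ hpos1).log fun t ht =>
          (zero_lt_one.trans_le (hge1 t ht)).ne').div_const 2)
      · intro t ht
        have := log_nonneg (hge1 t ht)
        positivity)
  -- Here g(u) ≤ u² and 1 + log (t/s) ≤ t/s leave the majorant s/t, whose integral over [s, s log s]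
  -- is s log log s.
  have p2 := abs_integral_mul_weight_sub_le (A := A) (C := C) (s := s) (a := s) (b := s * log s)
    (φ := fun t => g (s / t)) (bd := fun t => s * t⁻¹) (Bd := fun t => s * log t) hβ
    (fun t ht => hC s t hs (hrs.trans ht.1) (ht.2.trans hslog2)) (hs.trans hrs) hslog
    (hgc.comp_continuousOn (hdiv _ _ hpos2)) hCw
    (fun t ht => by
      have ht0 := hpos2 t ht
      have h1 : s / t ≤ 1 := by rw [div_le_one ht0]; exact ht.1
      have h2 : 0 < s / t := by positivity
      have h3 : 1 + |log (s / t)| ≤ t / s := by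
        rw [abs_of_nonpos (log_nonpos h2.le h1), ← log_inv, inv_div]
        have := log_le_sub_one_of_pos (show 0 < t / s by positivity)
        linarith
      rw [abs_of_nonneg (hg.nonneg _ h2.le)]
      calc g (s / t) * (1 + |log (s / t)|) ≤ (s / t) ^ 2 * (t / s) := by
            gcongr
            exact hg.le_sq _ h2.le h1
        _ = _ := by field_simp)
    (fun t ht => (hasDerivAt_log (hpos2 t ht).ne').const_mul s)
    (continuousOn_const.mul (continuousOn_inv₀.mono fun t ht => (hpos2 t ht).ne'))
  have s1 : ∫ t in (√s)..s, (g (s / t) - s / t) =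
      s * ∫ u in (1 : ℝ)..(√s), (g u - u) / u ^ 2 := by
    rw [integral_comp_div (F := fun u => g u - u) (by fun_prop) hs0 hr0 hrs, div_self hs0.ne',
      div_sqrt]
  have s2 : ∫ t in s..(s * log s), g (s / t) = s * ∫ u in (1 / log s)..1, g u / u ^ 2 := by
    rw [integral_comp_div hgc hs0 hs0 hslog, div_self hs0.ne']
    rw [show s / (s * log s) = 1 / log s by field_simp]
  -- The ranges t ≤ s log s and t ≥ √s become u ≥ 1/log s and u ≤ √s; both truncations of η cost
  -- O(1/log s).
  have s3 := hg.abs_eta_sub_le hgc (x := 1 / log s) (X := √s) (by positivity)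
    (by rw [div_le_one hlpos]; linarith) (by linarith)
  have b1 : 2 * D * s * (-2 * log (1 + log (s / s) / 2)) -
      2 * D * s * (-2 * log (1 + log (s / √s) / 2)) ≤ 4 * D * (s * log (log s)) := by
    rw [div_self hs0.ne', log_one, div_sqrt, log_sqrt hs0.le]
    have : log (1 + log s / 2 / 2) ≤ log (log s) := log_le_log (by positivity) (by linarith)
    have h2 : 0 ≤ 4 * D * s := by positivity
    norm_num
    nlinarith
  have b2 : s * log (s * log s) - s * log s = s * log (log s) := by
    rw [log_mul hs0.ne' hlpos.ne']; ring
  have b3 : 1 / log s + D * (2 / (1 + log (√s) / 2)) ≤ (1 + 8 * D) * (1 / log s) := by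
    rw [log_sqrt hs0.le]
    have : 2 / (1 + log s / 2 / 2) ≤ 8 * (1 / log s) := by
      rw [div_le_iff₀ (by positivity)]
      have : 8 * (1 / log s) * (1 + log s / 2 / 2) = 8 / log s + 2 := by field_simp; ring
      rw [this]
      have : 0 ≤ 8 / log s := by positivity
      linarith
    nlinarith
  have hwl : log s ^ (A - 1) * (1 / log s) = w := by
    rw [hw, show A - 2 = A - 1 - 1 by ring, rpow_sub_one hlpos.ne' (A - 1)]; ring
  have hw1 : 0 ≤ log s ^ (A - 1) := rpow_nonneg hlpos.le _
  rw [s1] at p1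
  rw [s2, b2] at p2
  set I1 := ∫ t in (√s)..s, (g (s / t) - s / t) * log (t / β) ^ (A - 1)
  set I2 := ∫ t in s..(s * log s), g (s / t) * log (t / β) ^ (A - 1)
  set J1 := ∫ u in (1 : ℝ)..(√s), (g u - u) / u ^ 2
  set J2 := ∫ u in (1 / log s)..1, g u / u ^ 2
  set η := ∫ u in Ioi 0, cutoff g u / u ^ 2
  have q1 : |I1 - s * J1 * log s ^ (A - 1)| ≤ C * w * (4 * D * (s * log (log s))) :=
    p1.trans (mul_le_mul_of_nonneg_left b1 hCw)
  have q3 : |s * log s ^ (A - 1) * (η - (J2 + J1))| ≤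
      s * log s ^ (A - 1) * ((1 + 8 * D) * (1 / log s)) := by
    rw [abs_mul, abs_of_nonneg (by positivity)]
    exact mul_le_mul_of_nonneg_left (s3.trans b3) (by positivity)
  have q4 : s * log s ^ (A - 1) * ((1 + 8 * D) * (1 / log s)) ≤
      (1 + 8 * D) * (s * (w * log (log s))) := by
    calc s * log s ^ (A - 1) * ((1 + 8 * D) * (1 / log s)) =
        (1 + 8 * D) * (s * (log s ^ (A - 1) * (1 / log s))) := by ring
      _ = (1 + 8 * D) * (s * (w * 1)) := by rw [hwl, mul_one]
      _ ≤ _ := by gcongr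
  rw [abs_le] at q1 p2 q3 ⊢
  constructor <;> linarith

end Weights

/-! ### Expansion of the cumulant generating function of the random sum -/

/-- The size of the error terms, relative to `s`. -/
noncomputable def errSize (A B s : ℝ) : ℝ :=
  log s ^ (A - 2) * log (log s) + log s ^ (A - B)

section Expansion

variable {q : ℕ+ → ℝ} {α β A B : ℝ}

/-- Converts a lower bound for q_n into one for the index n, in terms of which the closeness of Y(n)
to the limiting law is measured. -/
lemma IsWellDistributed.count_le_of_lt (hq : IsWellDistributed q α β A B) {y : ℝ} {n : ℕ+}
    (h : y < q n) : (count q y : ℝ) ≤ n := by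
  have hsub : hq.index y ⊆ Finset.Icc 1 n := fun m hm => by
    rw [hq.mem_index] at hm
    rw [Finset.mem_Icc]
    refine ⟨_root_.one_le, ?_⟩
    by_contra hmn
    exact absurd (hq.mono (not_le.mp hmn).le) (not_le.mpr (hm.trans_lt h))
  have := Finset.card_le_card hsub
  rw [PNat.card_Icc] at this
  rw [hq.count_eq]
  exact_mod_cast this

lemma IsWellDistributed.abs_sum_le (hq : IsWellDistributed q α β A B) {T : Finset ℕ+} {y c s : ℝ}
    {F : ℕ+ → ℝ} (hc : 0 ≤ c) (hs : 0 ≤ s) (hT : T ⊆ hq.index y)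
    (hF : ∀ n ∈ T, |F n| ≤ c * (s / q n)) : |∑ n ∈ T, F n| ≤ c * s * harmonicSum q y := by
  rw [hq.harmonicSum_eq, Finset.mul_sum]
  refine (Finset.abs_sum_le_sum_abs _ _).trans ((Finset.sum_le_sum hF).trans ?_)
  have e : ∀ n, c * (s / q n) = c * s * (1 / q n) := fun n => by ring
  simp_rw [e]
  refine Finset.sum_le_sum_of_subset_of_nonneg hT fun n _ _ => ?_
  have := hq.one_le_apply n
  positivity

/-- Partial summation for the cumulant generating function over the bulk range. -/
lemma IsWellDistributed.exists_abs_sum_cgf_sub_le (hq : IsWellDistributed q α β A B)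
    (hβ : 0 < β) (hB : max A 1 < B) :
    ∃ K, 0 ≤ K ∧ ∀ g g' : ℝ → ℝ, (∀ u, HasDerivAt g (g' u) u) → Continuous g' →
      (∀ u, 0 ≤ u → |g' u| ≤ 1) → (∀ u, 0 ≤ u → 0 ≤ g u) → (∀ u, 0 ≤ u → g u ≤ u) →
      ∀ s : ℝ, 2 * (2 + β) ^ 2 ≤ √s → 1 ≤ log (log s) →
      |∑ n ∈ hq.index s \ hq.index (√s), (g (s / q n) - s / q n) -
          α * ∫ t in (√s)..s, (g (s / t) - s / t) * log (t / β) ^ (A - 1)| ≤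
        K * (s * log s ^ (A - B)) ∧
      |∑ n ∈ hq.index (s * log s) \ hq.index s, g (s / q n) -
          α * ∫ t in s..(s * log s), g (s / t) * log (t / β) ^ (A - 1)| ≤
        K * (s * log s ^ (A - B)) := by
  obtain ⟨C, hC, h⟩ := hq.exists_abs_sum_sub_integral_le hβ hB
  refine ⟨2 * C * (1 / 2) ^ (A - B), by positivity, ?_⟩
  intro g g' hg hg'c hg' hg0 hg1 s hs hll
  have hb : 4 < (2 + β) ^ 2 := by nlinarith
  have hr0 : 0 < √s := by linarith
  have hs0 : 0 < s := by
    by_contra h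
    rw [sqrt_eq_zero_of_nonpos (not_lt.mp h)] at hr0
    linarith
  have hrr : √s * √s = s := mul_self_sqrt hs0.le
  have hrs : √s ≤ s := by nlinarith
  have hlpos : 0 < log s := log_pos (by linarith)
  have hle : exp 1 ≤ log s := by rwa [le_log_iff_exp_le hlpos] at hll
  have hslog : s ≤ s * log s := by nlinarith [add_one_le_exp (1 : ℝ)]
  have hpos1 : ∀ t ∈ Icc (√s) s, 0 < t := fun t ht => hr0.trans_le ht.1
  have hpos2 : ∀ t ∈ Icc s (s * log s), 0 < t := fun t ht => hs0.trans_le ht.1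
  have hdiv : ∀ a b : ℝ, (∀ t ∈ Icc a b, 0 < t) → ContinuousOn (fun t => s / t) (Icc a b) :=
    fun a b h => ContinuousOn.div continuousOn_const continuousOn_id fun t ht => (h t ht).ne'
  have hder : ∀ t, 0 < t → HasDerivAt (fun t => s / t) (-s / t ^ 2) t := fun t ht =>
    ((hasDerivAt_const t s).div (hasDerivAt_id t) ht.ne').congr_deriv (by simp)
  have hcd : ∀ a b : ℝ, (∀ t ∈ Icc a b, 0 < t) →
      ContinuousOn (fun t => -s / t ^ 2) (Icc a b) := fun a b h =>
    ContinuousOn.div continuousOn_const (by fun_prop) fun t ht => pow_ne_zero 2 (h t ht).ne'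
  -- From 0 ≤ g(u) ≤ u and |g'| ≤ 1, the function is at most s/t and its derivative at most 2s/t²;
  -- hence c = 2s.
  have r1 := h (√s) s (2 * s) (fun t => g (s / t) - s / t)
    (fun t => g' (s / t) * (-s / t ^ 2) - (-s / t ^ 2)) hs hrs (by positivity)
    (fun t ht => ((hg (s / t)).comp t (hder t (hpos1 t ht))).sub (hder t (hpos1 t ht)))
    (((hg'c.comp_continuousOn (hdiv _ _ hpos1)).mul (hcd _ _ hpos1)).sub (hcd _ _ hpos1))
    (fun t ht => by
      have ht0 := hpos1 t ht
      have hu : 0 ≤ s / t := by positivity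
      have e1 := hg0 _ hu
      have e2 := hg1 _ hu
      rw [abs_le, mul_div_assoc]
      constructor <;> linarith)
    (fun t ht => by
      have ht0 := hpos1 t ht
      have hu : 0 ≤ s / t := by positivity
      have e1 := abs_le.mp (hg' _ hu)
      rw [← sub_one_mul, abs_mul, abs_div, abs_neg, abs_of_pos hs0, abs_of_pos (by positivity :
        0 < t ^ 2), mul_div_assoc]
      gcongr
      rw [abs_le]; constructor <;> linarith)
  have r2 := h s (s * log s) (2 * s) (fun t => g (s / t)) (fun t => g' (s / t) * (-s / t ^ 2))
    (hs.trans hrs) hslog (by positivity)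
    (fun t ht => ((hg (s / t)).comp t (hder t (hpos2 t ht))))
    ((hg'c.comp_continuousOn (hdiv _ _ hpos2)).mul (hcd _ _ hpos2))
    (fun t ht => by
      have ht0 := hpos2 t ht
      have hu : 0 ≤ s / t := by positivity
      have e1 := hg0 _ hu
      have e2 := hg1 _ hu
      rw [abs_le, mul_div_assoc]
      constructor <;> linarith)
    (fun t ht => by
      have ht0 := hpos2 t ht
      have hu : 0 ≤ s / t := by positivity
      have e1 := hg' _ hu
      rw [abs_mul, abs_div, abs_neg, abs_of_pos hs0, abs_of_pos (by positivity :
        0 < t ^ 2), mul_div_assoc]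
      gcongr
      linarith)
  have hl : log (√s) ^ (A - B) = (1 / 2) ^ (A - B) * log s ^ (A - B) := by
    rw [log_sqrt hs0.le, ← mul_rpow (by norm_num) hlpos.le]; congr 1; ring
  have hp : 0 ≤ log s ^ (A - B) := rpow_nonneg hlpos.le _
  have h2 : (1 : ℝ) ≤ (1 / 2) ^ (A - B) := by
    apply one_le_rpow_of_pos_of_le_one_of_nonpos (by norm_num) (by norm_num)
    linarith [le_max_left A 1]
  constructor
  · refine r1.trans (le_of_eq ?_)
    rw [hl]; ring
  · refine r2.trans ?_
    calc C * (2 * s) * log s ^ (A - B) = 2 * C * 1 * (s * log s ^ (A - B)) := by ring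
      _ ≤ _ := by gcongr

set_option maxHeartbeats 800000 in
/-- The expansion of the cumulant generating function of the random sum. -/
theorem IsWellDistributed.exists_cgf_sum_expansion (hq : IsWellDistributed q α β A B)
    (hα : 0 < α) (hβ : 0 < β) (hA : 0 ≤ A) (hB : max A 1 < B) (D C₁ : ℝ) :
    ∃ K s₀, 0 ≤ K ∧ ∀ (gn : ℕ+ → ℝ → ℝ) (g g' : ℝ → ℝ), (∀ n, CgfBounds D (gn n)) →
      CgfBounds D g → (∀ u, HasDerivAt g (g' u) u) → Continuous g' →
      (∀ u, 0 ≤ u → |g' u| ≤ 1) →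
      (∀ n : ℕ+, 2 ≤ n → ∀ u, 0 ≤ u → |gn n u - g u| ≤ C₁ / log n ^ 2 * u) →
      ∀ s Q, s₀ ≤ s → s * log s ≤ Q →
      |∑ n ∈ hq.index Q, gn n (s / q n) - s * harmonicSum q s -
        α * (∫ u in Ioi 0, cutoff g u / u ^ 2) * s * log s ^ (A - 1)| ≤ K * (s * errSize A B s) := by
  obtain ⟨K₁, hK₁, h₁⟩ := hq.exists_abs_sum_cgf_sub_le hβ hB
  obtain ⟨K₂, hK₂, h₂⟩ := exists_abs_integral_sub_eta_le A hβ D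
  obtain ⟨K₃, hK₃, h₃⟩ := hq.exists_harmonicSum_le hα hβ hA hB
  obtain ⟨K₄, hK₄, h₄⟩ := hq.exists_sum_sq_le hα hβ hB
  have hsqrt : Tendsto (fun s : ℝ => √s) atTop atTop := tendsto_sqrt_atTop
  have hll : Tendsto (fun s : ℝ => log (log s)) atTop atTop :=
    tendsto_log_atTop.comp tendsto_log_atTop
  obtain ⟨s₀, hs₀⟩ := ((hsqrt.eventually_ge_atTop (2 * (2 + β) ^ 2)).and
    ((hll.eventually_ge_atTop 1).and (hsqrt.eventually
      (hq.eventually_rpow_le_count hα hβ hB)))).exists_forall_of_atTop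
  refine ⟨(16 * |D| + 2 * (16 * |C₁|)) * (K₃ * (2 ^ A * 2)) + 2 * K₁ + K₄ * 2 ^ |A - 1| + α * K₂,
    s₀, by positivity, ?_⟩
  intro gn g g' hgn hg hgd hg'c hg' hclose s Q hs hQ
  obtain ⟨hs1, hs2, hs3⟩ := hs₀ s hs
  have hD := hg.const_nonneg
  rw [abs_of_nonneg hD]
  have hb : 4 < (2 + β) ^ 2 := by nlinarith
  have hr0 : 0 < √s := by linarith
  have hs0 : 0 < s := by
    by_contra h
    rw [sqrt_eq_zero_of_nonpos (not_lt.mp h)] at hr0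
    linarith
  have hrr : √s * √s = s := mul_self_sqrt hs0.le
  have hrs : √s ≤ s := by nlinarith
  have hlpos : 0 < log s := log_pos (by linarith)
  have hle : exp 1 ≤ log s := by rwa [le_log_iff_exp_le hlpos] at hs2
  have hl2 : 2 ≤ log s := by linarith [add_one_le_exp (1 : ℝ)]
  have hls : log s ≤ s := (log_le_sub_one_of_pos hs0).trans (by linarith)
  have hslog : s ≤ s * log s := by nlinarith
  have hslog2 : s * log s ≤ s ^ 2 := by nlinarith
  set w : ℝ := log s ^ (A - 2) with hw
  have hw0 : 0 ≤ w := rpow_nonneg hlpos.le _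
  have hsA : log s ^ A = w * log s ^ 2 := by
    rw [hw, ← rpow_natCast, ← rpow_add hlpos]; congr 1; norm_num
  have hH : harmonicSum q (s ^ 2) ≤ K₃ * (2 ^ A * 2) * (w * log s ^ 2 * log (log s)) := by
    have hlog : log (s ^ 2) = 2 * log s := by rw [log_pow]; norm_num
    have e1 : log (log (s ^ 2)) = log 2 + log (log s) := by
      rw [hlog, log_mul (by norm_num) hlpos.ne']
    have e2 : log 2 ≤ 1 := by linarith [log_two_lt_d9]
    have e3 : 0 ≤ log 2 := log_nonneg (by norm_num)
    have := h₃ (s ^ 2) (by nlinarith) (by linarith)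
    rw [e1, hlog, mul_rpow (by norm_num) hlpos.le, hsA] at this
    refine this.trans ?_
    calc K₃ * (2 ^ A * (w * log s ^ 2) * (log 2 + log (log s)))
        ≤ K₃ * (2 ^ A * (w * log s ^ 2) * (2 * log (log s))) := by gcongr; linarith
      _ = _ := by ring
  have hH0 := hq.harmonicSum_nonneg (s ^ 2)
  have hq0 : ∀ n, 0 < q n := fun n => zero_lt_one.trans_le (hq.one_le_apply n)
  -- A saving of (log s)² over the trivial size s/q_n suffices: H(s²) ≪ (log s)^A log log s then
  -- leaves s (log s)^(A-2) log log s.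
  have crude : ∀ (T : Finset ℕ+) (F : ℕ+ → ℝ) (c : ℝ), 0 ≤ c → T ⊆ hq.index (s ^ 2) →
      (∀ n ∈ T, |F n| ≤ c / log s ^ 2 * (s / q n)) →
      |∑ n ∈ T, F n| ≤ c * (K₃ * (2 ^ A * 2)) * (s * (w * log (log s))) := by
    intro T F c hc hT hF
    refine (hq.abs_sum_le (by positivity) hs0.le hT hF).trans ?_
    calc c / log s ^ 2 * s * harmonicSum q (s ^ 2)
        ≤ c / log s ^ 2 * s * (K₃ * (2 ^ A * 2) * (w * log s ^ 2 * log (log s))) := by gcongr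
      _ = _ := by field_simp
  -- For q_n ≤ √s the index may be small and Y(n) far from the limiting law. But u = s/q_n ≥ √s, so
  -- the bound for u - g_n(u) alone saves (log s)².
  have low : |∑ n ∈ hq.index (√s), (gn n (s / q n) - s / q n)| ≤
      16 * D * (K₃ * (2 ^ A * 2)) * (s * (w * log (log s))) := by
    refine crude _ _ _ (by positivity) (hq.index_mono (by nlinarith)) fun n hn => ?_
    rw [hq.mem_index] at hn
    have hu : √s ≤ s / q n := by
      rw [le_div_iff₀ (hq0 n)]
      calc √s * q n ≤ √s * √s := by gcongr
        _ = s := hrr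
    have hlu : log s / 2 ≤ log (s / q n) := by
      rw [← log_sqrt hs0.le]; exact log_le_log hr0 hu
    refine ((hgn n).abs_sub_le (by linarith)).trans ?_
    have hl0 : 0 < log (s / q n) := by linarith
    have : 1 / (1 + log (s / q n) / 2) ^ 2 ≤ 16 / log s ^ 2 := by
      rw [div_le_div_iff₀ (by positivity) (by positivity)]
      nlinarith
    have hu0 : 0 ≤ s / q n := by linarith
    calc D * (s / q n / (1 + log (s / q n) / 2) ^ 2) =
        D * (s / q n) * (1 / (1 + log (s / q n) / 2) ^ 2) := by ring
      _ ≤ D * (s / q n) * (16 / log s ^ 2) := by gcongr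
      _ = _ := by ring
  -- For q_n > √s the index satisfies n ≥ s^(1/4), so g_n may be replaced by the single function g,
  -- as partial summation requires.
  have mid : ∀ x y, √s ≤ x → y ≤ s ^ 2 →
      |∑ n ∈ hq.index y \ hq.index x, (gn n (s / q n) - g (s / q n))| ≤
      16 * |C₁| * (K₃ * (2 ^ A * 2)) * (s * (w * log (log s))) := by
    intro x y hx hy
    refine crude _ _ _ (by positivity)
      (Finset.sdiff_subset.trans (hq.index_mono hy)) fun n hn => ?_
    rw [Finset.mem_sdiff, hq.mem_index, hq.mem_index, not_le] at hn
    have hn1 := hs3.trans (hq.count_le_of_lt (hx.trans_lt hn.2))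
    have hn2 : log s / 4 ≤ log n := by
      have := log_le_log (by positivity) hn1
      rw [log_rpow hr0, log_sqrt hs0.le] at this
      linarith
    have hn3 : 2 ≤ n := by
      rcases eq_or_lt_of_le (_root_.one_le : 1 ≤ n) with h1 | h1
      · rw [← h1] at hn2; norm_num at hn2; linarith
      · exact PNat.add_one_le_iff.mpr h1
    have hu0 : 0 ≤ s / q n := by have := hq0 n; positivity
    refine (hclose n hn3 _ hu0).trans (mul_le_mul_of_nonneg_right ?_ hu0)
    calc C₁ / log n ^ 2 ≤ |C₁| / log n ^ 2 := by gcongr; exact le_abs_self _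
      _ ≤ |C₁| / (log s / 4) ^ 2 := by gcongr
      _ = _ := by ring
  -- Beyond s log s the quadratic bound g_n(u) ≤ u² and the tail of ∑ 1/q_n² gain a factor log s
  -- over s (log s)^(A-1).
  have high : |∑ n ∈ hq.index Q \ hq.index (s * log s), gn n (s / q n)| ≤
      K₄ * 2 ^ |A - 1| * (s * w) := by
    have hbound : ∀ n ∈ hq.index Q \ hq.index (s * log s),
        |gn n (s / q n)| ≤ s ^ 2 * (1 / q n ^ 2) := by
      intro n hn
      rw [Finset.mem_sdiff, hq.mem_index, hq.mem_index, not_le] at hn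
      have hqn := hq0 n
      have hu0 : 0 ≤ s / q n := by positivity
      rw [abs_of_nonneg ((hgn n).nonneg _ hu0)]
      refine ((hgn n).le_sq _ hu0 ?_).trans (le_of_eq (by rw [div_pow]; ring))
      rw [div_le_one hqn]; linarith
    refine (Finset.abs_sum_le_sum_abs _ _).trans ((Finset.sum_le_sum hbound).trans ?_)
    rw [← Finset.mul_sum]
    have hy := h₄ (s * log s) Q (by linarith) hQ
    have hly : log (s * log s) = log s + log (log s) := log_mul hs0.ne' hlpos.ne'
    have hlls : log (log s) ≤ log s := by
      have := log_le_sub_one_of_pos hlpos; linarith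
    have hcmp := rpow_le_mul_rpow_of_comparable (A - 1) one_le_two
      (by linarith : 0 < log (s * log s)) hlpos (by linarith) (by linarith)
    have hw1 : log s ^ (A - 1) = w * log s := by
      rw [hw, ← rpow_add_one hlpos.ne']; congr 1; ring
    rw [hw1] at hcmp
    calc s ^ 2 * ∑ n ∈ hq.index Q \ hq.index (s * log s), 1 / q n ^ 2
        ≤ s ^ 2 * (K₄ * (log (s * log s) ^ (A - 1) / (s * log s))) := by gcongr
      _ ≤ s ^ 2 * (K₄ * ((2 ^ |A - 1| * (w * log s)) / (s * log s))) := by gcongr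
      _ = _ := by field_simp
  obtain ⟨a1, a2⟩ := h₁ g g' hgd hg'c hg' hg.nonneg hg.le_self s hs1 hs2
  have a3 := h₂ g hg (continuous_iff_continuousAt.mpr fun u => (hgd u).continuousAt) s
    (by linarith) hs2
  have m1 := mid (√s) s le_rfl (by nlinarith)
  have m2 := mid s (s * log s) hrs hslog2
  rw [hq.sum_index_sdiff hQ, hq.sum_index_sdiff hslog, hq.sum_index_sdiff hrs, hq.harmonicSum_eq,
    hq.sum_index_sdiff hrs, mul_add, Finset.mul_sum, Finset.mul_sum]
  simp only [mul_one_div]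
  simp only [Finset.sum_sub_distrib] at low m1 m2 a1
  have hp : 0 ≤ log s ^ (A - B) := rpow_nonneg hlpos.le _
  have hwll : s * w ≤ s * (w * log (log s)) := by gcongr; nlinarith
  have hX : s * errSize A B s = s * (w * log (log s)) + s * log s ^ (A - B) := by
    rw [errSize]; ring
  rw [hX]
  set I1 := ∫ t in (√s)..s, (g (s / t) - s / t) * log (t / β) ^ (A - 1)
  set I2 := ∫ t in s..(s * log s), g (s / t) * log (t / β) ^ (A - 1)
  set η := ∫ u in Ioi 0, cutoff g u / u ^ 2
  have a4 : |α * (I1 + I2 - s * η * log s ^ (A - 1))| ≤ α * (K₂ * (s * (w * log (log s)))) := by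
    rw [abs_mul, abs_of_pos hα]
    exact mul_le_mul_of_nonneg_left a3 hα.le
  have hh : K₄ * 2 ^ |A - 1| * (s * w) ≤ K₄ * 2 ^ |A - 1| * (s * (w * log (log s))) := by gcongr
  set X := s * (w * log (log s))
  set Y := s * log s ^ (A - B)
  have hX0 : 0 ≤ X := by positivity
  have hY0 : 0 ≤ Y := by positivity
  have f1 : 0 ≤ K₁ * X := by positivity
  have f2 : 0 ≤ (16 * D + 2 * (16 * |C₁|)) * (K₃ * (2 ^ A * 2)) * Y := by positivity
  have f3 : 0 ≤ K₄ * 2 ^ |A - 1| * Y := by positivity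
  have f4 : 0 ≤ α * K₂ * Y := by positivity
  rw [abs_le] at low m1 m2 a1 a2 a4 high ⊢
  constructor <;> linarith [low.1, low.2, m1.1, m1.2, m2.1, m2.2, a1.1, a1.2, a2.1, a2.2, a4.1,
    a4.2, high.1, high.2]

end Expansion

/-! ### Cumulant generating functions of bounded random variables -/

section Cgf

variable {Ω : Type*} [MeasurableSpace Ω] {P : Measure Ω} [IsProbabilityMeasure P] {X : Ω → ℝ}

lemma abs_cgf_sub_le_of_ae_abs_sub_le {X' : Ω → ℝ} {δ u : ℝ}
    (h1 : Integrable (fun ω => exp (u * X ω)) P) (h2 : Integrable (fun ω => exp (u * X' ω)) P)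
    (hu : 0 ≤ u) (h : ∀ᵐ ω ∂P, |X ω - X' ω| ≤ δ) : |cgf X P u - cgf X' P u| ≤ δ * u := by
  have aux : ∀ Z Z' : Ω → ℝ, Integrable (fun ω => exp (u * Z ω)) P →
      Integrable (fun ω => exp (u * Z' ω)) P → (∀ᵐ ω ∂P, |Z ω - Z' ω| ≤ δ) →
      cgf Z P u ≤ cgf Z' P u + δ * u := by
    intro Z Z' hZ hZ' h
    have : mgf Z P u ≤ mgf Z' P u * exp (δ * u) := by
      unfold mgf
      rw [← integral_mul_const]
      apply integral_mono_ae hZ (hZ'.mul_const _)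
      filter_upwards [h] with ω hω
      rw [← exp_add, exp_le_exp]
      nlinarith [(abs_le.mp hω).2]
    have hpos := mgf_pos hZ
    have hpos' := mgf_pos hZ'
    have := log_le_log hpos this
    rwa [log_mul hpos'.ne' (exp_pos _).ne', log_exp] at this
  rw [abs_le]
  have a1 := aux X X' h1 h2 h
  have a2 := aux X' X h2 h1 (h.mono fun ω hω => by rwa [abs_sub_comm])
  constructor <;> linarith

lemma abs_cgf_sub_cgf_le (hX : Measurable X) (hb : ∀ᵐ ω ∂P, X ω ∈ Icc (-1 : ℝ) 1) (u v : ℝ) :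
    |cgf X P u - cgf X P v| ≤ |u - v| := by
  have aux : ∀ u v : ℝ, cgf X P u ≤ cgf X P v + |u - v| := by
    intro u v
    have hu := integrable_exp_mul_of_mem_Icc (t := u) hX.aemeasurable hb
    have hv := integrable_exp_mul_of_mem_Icc (t := v) hX.aemeasurable hb
    have : mgf X P u ≤ mgf X P v * exp |u - v| := by
      unfold mgf
      rw [← integral_mul_const]
      apply integral_mono_ae hu (hv.mul_const _)
      filter_upwards [hb] with ω hω
      rw [← exp_add, exp_le_exp]
      have h1 : (u - v) * X ω ≤ |u - v| * |X ω| := by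
        rw [← abs_mul]; exact le_abs_self _
      have h2 : |X ω| ≤ 1 := abs_le.mpr hω
      nlinarith [abs_nonneg (u - v)]
    have hpos := mgf_pos hu
    have hpos' := mgf_pos hv
    have := log_le_log hpos this
    rwa [log_mul hpos'.ne' (exp_pos _).ne', log_exp] at this
  rw [abs_le]
  have a1 := aux u v
  have a2 := aux v u
  rw [abs_sub_comm] at a2
  constructor <;> linarith

/-- The constant in `CgfBounds` that `CRVH` provides. -/
noncomputable def cgfConst (c₀ κ : ℝ) : ℝ := 1 + 2 * |log κ| + 2 * (exp 1 * c₀)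

/-- Mean zero enters through 1 + y ≤ e^y, and through e^y ≤ 1 + y + y² for |y| ≤ 1; the support
gives the linear bound. The lower bound restricts the expectation to the event X > 1 - 1/t with t
chosen in terms of u. -/
lemma cgfBounds_of_mem_Icc {c₀ κ : ℝ} (hc₀ : 0 < c₀) (hκ : 0 < κ) (hX : Measurable X)
    (hb : ∀ᵐ ω ∂P, X ω ∈ Icc (-1 : ℝ) 1) (hmean : ∫ ω, X ω ∂P = 0)
    (hlow : ∀ t : ℝ, 1 ≤ t → κ * exp (-(c₀ * exp (√t))) ≤ P.real {ω | 1 - 1 / t < X ω}) :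
    CgfBounds (cgfConst c₀ κ) (cgf X P) := by
  have hint : ∀ u, Integrable (fun ω => exp (u * X ω)) P := fun u =>
    integrable_exp_mul_of_mem_Icc hX.aemeasurable hb
  have hXint : Integrable X P := Integrable.of_mem_Icc (-1) 1 hX.aemeasurable hb
  have hlin : ∀ u, ∫ ω, (u * X ω + 1) ∂P = 1 := fun u => by
    rw [integral_add (hXint.const_mul u) (integrable_const 1), integral_const_mul, hmean]
    simp
  refine ⟨fun u hu => ?_, fun u hu hu1 => ?_, fun u hu => ?_, fun u hu => ?_⟩
  · apply log_nonneg
    rw [← hlin u]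
    exact integral_mono ((hXint.const_mul u).add (integrable_const 1)) (hint u)
      fun ω => add_one_le_exp _
  · have : mgf X P u ≤ 1 + u ^ 2 := by
      rw [← hlin u]
      unfold mgf
      have hI : Integrable (fun ω => u * X ω + 1) P :=
        (hXint.const_mul u).add (integrable_const 1)
      have e : ∫ ω, (u * X ω + 1) ∂P + u ^ 2 = ∫ ω, ((u * X ω + 1) + u ^ 2) ∂P := by
        rw [integral_add hI (integrable_const _)]
        simp
      rw [e]
      apply integral_mono_ae (hint u) (hI.add (integrable_const _))
      filter_upwards [hb] with ω hω
      have h2 : |X ω| ≤ 1 := abs_le.mpr hω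
      have h3 : |u * X ω| ≤ 1 := by
        rw [abs_mul, abs_of_nonneg hu]; nlinarith [abs_nonneg (X ω)]
      have h4 := (abs_le.mp (abs_exp_sub_one_sub_id_le h3)).2
      have h5 : X ω ^ 2 ≤ 1 := by nlinarith [hω.1, hω.2]
      show exp (u * X ω) ≤ u * X ω + 1 + u ^ 2
      nlinarith [sq_nonneg u]
    have h2 := log_le_log (mgf_pos (hint u)) this
    have h3 := log_le_sub_one_of_pos (show 0 < 1 + u ^ 2 by positivity)
    unfold cgf
    linarith
  · have h := abs_cgf_sub_cgf_le hX hb u 0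
    rw [cgf_zero, sub_zero, sub_zero, abs_of_nonneg hu] at h
    exact (le_abs_self _).trans h
  · set x := log u / 2 with hx
    have hx0 : 0 ≤ x := by have := log_nonneg hu; positivity
    have hu0 : 0 < u := by linarith
    have hux : u = exp x * exp x := by rw [← exp_add, hx, add_halves, exp_log hu0]
    -- With √t = 1 + (log u)/2 one has e^√t = e √u. The loss is then u/t + e c₀ √u + |log κ|, and
    -- every part is O(u/t).
    have hlt := hlow ((1 + x) ^ 2) (by nlinarith)
    rw [sqrt_sq (by linarith), exp_add] at hlt
    have hm : exp (u * (1 - 1 / (1 + x) ^ 2)) * P.real {ω | 1 - 1 / (1 + x) ^ 2 < X ω} ≤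
        mgf X P u := by
      unfold mgf
      have hms : MeasurableSet {ω | 1 - 1 / (1 + x) ^ 2 < X ω} :=
        measurableSet_lt measurable_const hX
      rw [mul_comm, ← smul_eq_mul, ← setIntegral_const]
      refine (setIntegral_mono_on (by simp) (hint u).integrableOn hms fun ω hω => ?_).trans
        (setIntegral_le_integral (hint u) (Eventually.of_forall fun ω => (exp_pos _).le))
      rw [exp_le_exp]
      exact mul_le_mul_of_nonneg_left (le_of_lt hω) hu0.le
    have hm2 := (mul_le_mul_of_nonneg_left hlt (exp_pos (u * (1 - 1 / (1 + x) ^ 2))).le).trans hm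
    have hm3 := log_le_log (by positivity) hm2
    rw [log_mul (exp_pos _).ne' (by positivity), log_exp, log_mul hκ.ne' (exp_pos _).ne',
      log_exp] at hm3
    have hE1 : (1 + x) ^ 2 ≤ 2 * exp x := by
      have := quadratic_le_exp_of_nonneg hx0
      nlinarith
    have hE2 : exp x ≤ 2 * (u / (1 + x) ^ 2) := by
      rw [← mul_div_assoc, le_div_iff₀ (by positivity), hux]
      nlinarith [exp_pos x]
    have hE3 : 1 ≤ exp x := one_le_exp hx0
    have hE4 := neg_abs_le (log κ)
    have hE5 : |log κ| ≤ |log κ| * (2 * (u / (1 + x) ^ 2)) := by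
      nlinarith [abs_nonneg (log κ)]
    have hE6 : c₀ * (exp 1 * exp x) ≤ c₀ * (exp 1 * (2 * (u / (1 + x) ^ 2))) := by gcongr
    have hE7 : u * (1 - 1 / (1 + x) ^ 2) = u - u / (1 + x) ^ 2 := by ring
    unfold cgf cgfConst
    linarith

end Cgf

/-! ### Consequences of the hypothesis `CRVH` -/

section Hypothesis

variable {Ω Ω' : Type*} [MeasurableSpace Ω] [MeasurableSpace Ω'] {P : Measure Ω}
  {P' : Measure Ω'} {Y : ℕ+ → Ω → ℝ}
  {𝕐 : Ω' → ℝ} {c₀ κ C₁ : ℝ}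

lemma CRVH.cgfBounds [IsProbabilityMeasure P] (h : CRVH P P' Y 𝕐 c₀ κ C₁) (hc₀ : 0 < c₀) (hκ : 0 < κ) (n : ℕ+) :
    CgfBounds (cgfConst c₀ κ) (cgf (Y n) P) :=
  cgfBounds_of_mem_Icc hc₀ hκ (h.measurable n) (h.support n) (h.mean_zero n) (h.lower_bound n)

lemma CRVH.exists_ae_mem_Icc (h : CRVH P P' Y 𝕐 c₀ κ C₁) :
    ∃ M, ∀ᵐ ω ∂P', 𝕐 ω ∈ Icc (-M) M := by
  obtain ⟨Y', -, -, hid, hcl⟩ := h.approx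
  refine ⟨1 + C₁ / log ((2 : ℕ+) : ℝ) ^ 2, (hid 2).ae_snd measurableSet_Icc ?_⟩
  filter_upwards [h.support 2, hcl 2 le_rfl] with ω h1 h2
  rw [abs_le] at h2
  constructor <;> linarith [h1.1, h1.2]

lemma CRVH.abs_cgf_sub_le [IsProbabilityMeasure P] (h : CRVH P P' Y 𝕐 c₀ κ C₁) {n : ℕ+} (hn : 2 ≤ n) {u : ℝ}
    (hu : 0 ≤ u) : |cgf (Y n) P u - cgf 𝕐 P' u| ≤ C₁ / log n ^ 2 * u := by
  obtain ⟨Y', hm, -, hid, hcl⟩ := h.approx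
  have e : cgf 𝕐 P' u = cgf (Y' n) P u := by
    unfold cgf mgf
    congr 1
    exact ((hid n).comp (by fun_prop : Measurable fun x : ℝ => exp (u * x))).integral_eq.symm
  obtain ⟨M, hM⟩ := h.exists_ae_mem_Icc
  rw [e]
  refine abs_cgf_sub_le_of_ae_abs_sub_le
    (integrable_exp_mul_of_mem_Icc (h.measurable n).aemeasurable (h.support n))
    (integrable_exp_mul_of_mem_Icc (hm n).aemeasurable
      ((hid n).symm.ae_snd measurableSet_Icc hM)) hu (hcl n hn)

/-- The support, mean and tail conditions are imposed on the Y(n) only. The limiting law inherits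
their consequences through this limit. -/
lemma CRVH.tendsto_cgf [IsProbabilityMeasure P] (h : CRVH P P' Y 𝕐 c₀ κ C₁) {u : ℝ} (hu : 0 ≤ u) :
    Tendsto (fun n => cgf (Y n) P u) atTop (𝓝 (cgf 𝕐 P' u)) := by
  rw [tendsto_iff_norm_sub_tendsto_zero]
  have hlim : Tendsto (fun n : ℕ+ => C₁ / log n ^ 2 * u) atTop (𝓝 0) := by
    have h1 : Tendsto (fun n : ℕ+ => ((n : ℕ) : ℝ)) atTop atTop :=
      tendsto_natCast_atTop_atTop.comp tendsto_PNat_val_atTop_atTop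
    have h2 := (tendsto_pow_atTop two_ne_zero).comp (tendsto_log_atTop.comp h1)
    have := (h2.const_div_atTop C₁).mul_const u
    simpa using this
  refine squeeze_zero' (Eventually.of_forall fun n => norm_nonneg _) ?_ hlim
  filter_upwards [eventually_ge_atTop 2] with n hn using h.abs_cgf_sub_le hn hu

lemma CRVH.cgfBounds_limit [IsProbabilityMeasure P] (h : CRVH P P' Y 𝕐 c₀ κ C₁) (hc₀ : 0 < c₀) (hκ : 0 < κ) :
    CgfBounds (cgfConst c₀ κ) (cgf 𝕐 P') where
  nonneg u hu := ge_of_tendsto' (h.tendsto_cgf hu) fun n => (h.cgfBounds hc₀ hκ n).nonneg u hu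
  le_sq u hu hu1 :=
    le_of_tendsto' (h.tendsto_cgf hu) fun n => (h.cgfBounds hc₀ hκ n).le_sq u hu hu1
  le_self u hu := le_of_tendsto' (h.tendsto_cgf hu) fun n => (h.cgfBounds hc₀ hκ n).le_self u hu
  lower u hu := ge_of_tendsto' (h.tendsto_cgf (by linarith)) fun n =>
    (h.cgfBounds hc₀ hκ n).lower u hu

/-- The limiting variable is essentially bounded, so its cumulant generating function is analytic
everywhere. The derivative bound is the Lipschitz bound for the Y(n) carried to the limit; as that
limit is available for nonnegative arguments, the point 0 is reached by continuity. -/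
lemma CRVH.exists_deriv_cgf [IsProbabilityMeasure P] [IsProbabilityMeasure P'] (h : CRVH P P' Y 𝕐 c₀ κ C₁) :
    ∃ g' : ℝ → ℝ, (∀ u, HasDerivAt (cgf 𝕐 P') (g' u) u) ∧ Continuous g' ∧
      ∀ u, 0 ≤ u → |g' u| ≤ 1 := by
  obtain ⟨M, hM⟩ := h.exists_ae_mem_Icc
  obtain ⟨Y', hm, -, hid, -⟩ := h.approx
  have hset : integrableExpSet 𝕐 P' = univ := by
    ext t
    simp only [integrableExpSet, mem_ofPred_eq, mem_univ, iff_true]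
    exact integrable_exp_mul_of_mem_Icc (hid 1).aemeasurable_snd hM
  have han : ∀ u, AnalyticAt ℝ (cgf 𝕐 P') u := fun u =>
    analyticAt_cgf (by rw [hset, interior_univ]; exact mem_univ u)
  have hc : Continuous (deriv (cgf 𝕐 P')) :=
    continuous_iff_continuousAt.mpr fun u => (han u).deriv.continuousAt
  have hpos : ∀ u, 0 < u → |deriv (cgf 𝕐 P') u| ≤ 1 := by
    intro u hu
    have hd := (han u).differentiableAt.hasDerivAt
    rw [← norm_eq_abs]
    refine hd.le_of_lip' zero_le_one ?_
    filter_upwards [Ioi_mem_nhds hu] with v hv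
    simp only [norm_eq_abs, one_mul]
    refine le_of_tendsto' ((h.tendsto_cgf (le_of_lt hv)).sub (h.tendsto_cgf hu.le)).abs fun n => ?_
    exact abs_cgf_sub_cgf_le (h.measurable n) (h.support n) v u
  refine ⟨deriv (cgf 𝕐 P'), fun u => (han u).differentiableAt.hasDerivAt, hc, fun u hu => ?_⟩
  rcases hu.eq_or_lt with rfl | hu
  · have : Tendsto (fun u => |deriv (cgf 𝕐 P') u|) (𝓝[>] 0) (𝓝 |deriv (cgf 𝕐 P') 0|) :=
      (hc.abs.tendsto 0).mono_left nhdsWithin_le_nhds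
    refine le_of_tendsto this ?_
    filter_upwards [self_mem_nhdsWithin] with u hu using hpos u hu
  · exact hpos u hu

section RandomSum

variable {q : ℕ+ → ℝ} {α β A B : ℝ}

lemma CRVH.measurable_randomSum (h : CRVH P P' Y 𝕐 c₀ κ C₁)
    (hq : IsWellDistributed q α β A B) (Q : ℝ) : Measurable (randomSum q Y Q) := by
  have e : randomSum q Y Q = fun ω => ∑ n ∈ hq.index Q, Y n ω / q n :=
    funext fun ω => hq.randomSum_eq Y Q ω
  rw [e]
  exact Finset.measurable_sum _ fun n _ => (h.measurable n).div_const _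

lemma CRVH.integrable_exp_randomSum [IsProbabilityMeasure P] (h : CRVH P P' Y 𝕐 c₀ κ C₁)
    (hq : IsWellDistributed q α β A B) (Q s : ℝ) :
    Integrable (fun ω => exp (s * randomSum q Y Q ω)) P := by
  refine integrable_exp_mul_of_mem_Icc (a := -harmonicSum q Q) (b := harmonicSum q Q)
    (h.measurable_randomSum hq Q).aemeasurable ?_
  filter_upwards [ae_all_iff.mpr h.support] with ω hω
  have hq0 : ∀ n, 0 < q n := fun n => zero_lt_one.trans_le (hq.one_le_apply n)
  rw [hq.randomSum_eq, hq.harmonicSum_eq, ← Finset.sum_neg_distrib]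
  constructor <;> refine Finset.sum_le_sum fun n _ => ?_
  · rw [← neg_div]
    exact div_le_div_of_nonneg_right (hω n).1 (hq0 n).le
  · exact div_le_div_of_nonneg_right (hω n).2 (hq0 n).le

lemma CRVH.mgf_randomSum [IsProbabilityMeasure P] (h : CRVH P P' Y 𝕐 c₀ κ C₁) (hq : IsWellDistributed q α β A B)
    (Q s : ℝ) :
    mgf (randomSum q Y Q) P s = exp (∑ n ∈ hq.index Q, cgf (Y n) P (s / q n)) := by
  have hind : iIndepFun (fun n ω => Y n ω / q n) P :=
    h.indep.comp (fun n x => x / q n) fun n => by fun_prop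
  have e : randomSum q Y Q = ∑ n ∈ hq.index Q, fun ω => Y n ω / q n := by
    ext ω; rw [hq.randomSum_eq, Finset.sum_apply]
  rw [e, hind.mgf_sum fun n => (h.measurable n).div_const _, exp_sum]
  refine Finset.prod_congr rfl fun n _ => ?_
  rw [exp_cgf (integrable_exp_mul_of_mem_Icc (h.measurable n).aemeasurable (h.support n))]
  refine integral_congr_ae (Eventually.of_forall fun ω => ?_)
  simp only [div_mul_eq_mul_div, mul_div_assoc]

end RandomSum

end Hypothesis

/-! ### Lower bounds by exponential tilting -/

section Tilting

variable {Ω : Type*} [MeasurableSpace Ω] {P : Measure Ω} [IsProbabilityMeasure P] {X : Ω → ℝ}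

/-- A lower bound for tail probabilities by exponential tilting. -/
lemma half_exp_cgf_le_measureReal (hX : Measurable X)
    (hint : ∀ s, Integrable (fun ω => exp (s * X ω)) P) {s₀ s₁ s₂ V ε : ℝ} (h0 : 0 ≤ s₁)
    (h01 : s₀ ≤ s₁) (h12 : s₁ ≤ s₂)
    (hlow : cgf X P s₀ - s₀ * V - (cgf X P s₁ - s₁ * V) ≤ -log 4)
    (hup : cgf X P s₂ - s₂ * V - (s₂ - s₁) * ε - (cgf X P s₁ - s₁ * V) ≤ -log 4) :
    1 / 2 * exp (cgf X P s₁ - s₁ * V - s₁ * ε) ≤ P.real {ω | V < X ω} := by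
  have hms : MeasurableSet {ω | V < X ω} := measurableSet_lt measurable_const hX
  have hI1 : Integrable (fun ω => exp ((s₁ - s₀) * V) * exp (s₀ * X ω)) P :=
    (hint s₀).const_mul _
  have hI2 : Integrable ({ω | V < X ω}.indicator fun _ => exp (s₁ * (V + ε))) P :=
    (integrable_const _).indicator hms
  have hI3 : Integrable (fun ω => exp (-(s₂ - s₁) * (V + ε)) * exp (s₂ * X ω)) P :=
    (hint s₂).const_mul _
  have hI12 : Integrable (fun ω => exp ((s₁ - s₀) * V) * exp (s₀ * X ω) +
      {ω | V < X ω}.indicator (fun _ => exp (s₁ * (V + ε))) ω) P := hI1.add hI2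
  -- The three terms dominate e^(s₁X) on X ≤ V, on V < X ≤ V + ε and on X > V + ε. The hypotheses
  -- make the outer two at most a quarter of the left side each, so the window carries at least
  -- half.
  have hle : mgf X P s₁ ≤ exp ((s₁ - s₀) * V) * mgf X P s₀ +
      P.real {ω | V < X ω} * exp (s₁ * (V + ε)) +
        exp (-(s₂ - s₁) * (V + ε)) * mgf X P s₂ := by
    unfold mgf
    rw [← integral_const_mul, ← integral_const_mul, ← smul_eq_mul (P.real _),
      ← integral_indicator_const _ hms, ← integral_add hI1 hI2, ← integral_add hI12 hI3]
    refine integral_mono (hint s₁) (hI12.add hI3) fun ω => ?_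
    simp only [indicator_apply, mem_ofPred_eq]
    have p1 := exp_pos ((s₁ - s₀) * V)
    have p2 := exp_pos (s₀ * X ω)
    have p3 := exp_pos (-(s₂ - s₁) * (V + ε))
    have p4 := exp_pos (s₂ * X ω)
    have p12 := mul_pos p1 p2
    have p34 := mul_pos p3 p4
    by_cases h1 : V < X ω
    · rw [if_pos h1]
      by_cases h2 : X ω ≤ V + ε
      · have : exp (s₁ * X ω) ≤ exp (s₁ * (V + ε)) := by
          rw [exp_le_exp]; exact mul_le_mul_of_nonneg_left h2 h0
        linarith
      · have : exp (s₁ * X ω) ≤ exp (-(s₂ - s₁) * (V + ε)) * exp (s₂ * X ω) := by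
          rw [← exp_add, exp_le_exp]
          nlinarith
        linarith [exp_pos (s₁ * (V + ε))]
    · rw [if_neg h1]
      have : exp (s₁ * X ω) ≤ exp ((s₁ - s₀) * V) * exp (s₀ * X ω) := by
        rw [← exp_add, exp_le_exp]
        nlinarith
      linarith
  rw [← exp_cgf (hint s₀), ← exp_cgf (hint s₁), ← exp_cgf (hint s₂)] at hle
  have hquarter : ∀ a : ℝ, a ≤ -log 4 → exp a ≤ 1 / 4 := fun a ha => by
    refine (exp_le_exp.mpr ha).trans (le_of_eq ?_)
    rw [exp_neg, exp_log (by norm_num)]; norm_num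
  have q1 : exp ((s₁ - s₀) * V) * exp (cgf X P s₀) ≤ 1 / 4 * exp (cgf X P s₁) := by
    calc _ = exp (cgf X P s₀ - s₀ * V - (cgf X P s₁ - s₁ * V)) * exp (cgf X P s₁) := by
          rw [← exp_add, ← exp_add]; congr 1; ring
      _ ≤ _ := by gcongr; exact hquarter _ hlow
  have q2 : exp (-(s₂ - s₁) * (V + ε)) * exp (cgf X P s₂) ≤ 1 / 4 * exp (cgf X P s₁) := by
    calc _ = exp (cgf X P s₂ - s₂ * V - (s₂ - s₁) * ε - (cgf X P s₁ - s₁ * V)) *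
          exp (cgf X P s₁) := by
          rw [← exp_add, ← exp_add]; congr 1; ring
      _ ≤ _ := by gcongr; exact hquarter _ hup
  have q3 : 1 / 2 * exp (cgf X P s₁) ≤ P.real {ω | V < X ω} * exp (s₁ * (V + ε)) := by linarith
  have e : exp (cgf X P s₁ - s₁ * V - s₁ * ε) = exp (cgf X P s₁) / exp (s₁ * (V + ε)) := by
    rw [← exp_sub]; congr 1; ring
  rw [e, ← mul_div_assoc, div_le_iff₀ (exp_pos _)]
  exact q3

end Tilting

/-! ### The exponent near the saddle point and the range of V -/

section Saddle

variable {q : ℕ+ → ℝ} {α β A B : ℝ}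

lemma exists_abs_powAntideriv_add_sub_le (α : ℝ) (hA : 0 ≤ A) {m : ℝ} (hm : 0 ≤ m) :
    ∃ K, 0 ≤ K ∧ ∀ l v, 2 * m + 1 ≤ l → |v| ≤ m →
      |powAntideriv α A (l + v) - powAntideriv α A l - α * v * l ^ (A - 1)| ≤
        K * l ^ (A - 2) := by
  refine ⟨|α| * (|A - 1| * 2 ^ |A - 2|) * m ^ 2, by positivity, fun l v hl hv => ?_⟩
  have hv' := abs_le.mp hv
  have h := abs_powAntideriv_sub_le α hA one_le_two (x := l + v) (y := l) (by linarith)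
    (by linarith) (by linarith) (by linarith)
  rw [add_sub_cancel_left] at h
  refine h.trans ?_
  have : v ^ 2 ≤ m ^ 2 := sq_le_sq' hv'.1 hv'.2
  have h0 : 0 ≤ l ^ (A - 2) := rpow_nonneg (by linarith) _
  gcongr

/-- A shift that is small compared to `l` changes the powers of `l` by bounded factors only. -/
lemma rpow_log_add_le (p : ℝ) {m l v : ℝ} (hm : 0 ≤ m) (hl : 2 * m + 1 ≤ l) (hv : |v| ≤ m) :
    (l + v) ^ p ≤ 2 ^ |p| * l ^ p := by
  have hv' := abs_le.mp hv
  exact rpow_le_mul_rpow_of_comparable p one_le_two (by linarith) (by linarith) (by linarith)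
    (by linarith)

lemma log_exp_mul {Z : ℝ} (hZ : 0 < Z) (v : ℝ) : log (exp v * Z) = log Z + v := by
  rw [log_mul (exp_pos v).ne' hZ.ne', log_exp, add_comm]

lemma rpow_sub_two_le_errSize {A B Z : ℝ} (hl : 0 ≤ log Z) (hll : 1 ≤ log (log Z)) :
    log Z ^ (A - 2) ≤ errSize A B Z := by
  have h1 : 0 ≤ log Z ^ (A - 2) := rpow_nonneg hl _
  have h2 : 0 ≤ log Z ^ (A - B) := rpow_nonneg hl _
  unfold errSize
  nlinarith

lemma rpow_sub_le_errSize {A B Z : ℝ} (hl : 0 ≤ log Z) (hll : 1 ≤ log (log Z)) :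
    log Z ^ (A - B) ≤ errSize A B Z := by
  have h1 : 0 ≤ log Z ^ (A - 2) := rpow_nonneg hl _
  unfold errSize
  nlinarith

lemma errSize_exp_mul_le (A B : ℝ) {m Z v : ℝ} (hm : 0 ≤ m) (hZ : 0 < Z)
    (hl : 2 * m + 1 ≤ log Z) (hll : 1 ≤ log (log Z)) (hv : |v| ≤ m) :
    errSize A B (exp v * Z) ≤ (2 ^ |A - 2| * 2 + 2 ^ |A - B|) * errSize A B Z := by
  have h1 := rpow_log_add_le (A - 2) hm hl hv
  have h2 := rpow_log_add_le (A - B) hm hl hv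
  have hv' := abs_le.mp hv
  have h3 : log (log Z + v) ≤ 2 * log (log Z) := by
    have : log (log Z + v) ≤ log (2 * log Z) := log_le_log (by linarith) (by linarith)
    rw [log_mul two_ne_zero (by linarith)] at this
    linarith [log_two_lt_d9]
  have p1 : 0 ≤ log Z ^ (A - 2) := rpow_nonneg (by linarith) _
  have p2 : 0 ≤ log Z ^ (A - B) := rpow_nonneg (by linarith) _
  have p3 : 0 ≤ (log Z + v) ^ (A - 2) := rpow_nonneg (by linarith) _
  have q1 : (0 : ℝ) ≤ 2 ^ |A - 2| := by positivity
  have q2 : (0 : ℝ) ≤ 2 ^ |A - B| := by positivity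
  unfold errSize
  rw [log_exp_mul hZ]
  calc (log Z + v) ^ (A - 2) * log (log Z + v) + (log Z + v) ^ (A - B)
      ≤ (log Z + v) ^ (A - 2) * (2 * log (log Z)) + (log Z + v) ^ (A - B) := by gcongr
    _ ≤ 2 ^ |A - 2| * log Z ^ (A - 2) * (2 * log (log Z)) + 2 ^ |A - B| * log Z ^ (A - B) := by
        gcongr
    _ ≤ _ := by
        have r1 : 0 ≤ 2 ^ |A - B| * (log Z ^ (A - 2) * log (log Z)) := by positivity
        have r2 : 0 ≤ 2 ^ |A - 2| * log Z ^ (A - B) := by positivity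
        nlinarith

/-- The variation of the harmonic sum on multiplicatively short scales. -/
lemma IsWellDistributed.exists_abs_harmonicSum_exp_mul_sub_le
    (hq : IsWellDistributed q α β A B) (hβ : 0 < β) (hA : 0 ≤ A)
    (hB : max A 1 < B) {m : ℝ} (hm : 0 ≤ m) :
    ∃ K z₀, 0 ≤ K ∧ ∀ Z v, z₀ ≤ Z → |v| ≤ m →
      |harmonicSum q (exp v * Z) - harmonicSum q Z - α * v * log Z ^ (A - 1)| ≤
        K * errSize A B Z := by
  obtain ⟨C, K₁, hK₁, -, h₁⟩ := hq.exists_harmonicSum_expansion hβ hA hB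
  have hM : 0 ≤ m + |log β| := by positivity
  obtain ⟨K₂, hK₂, h₂⟩ := exists_abs_powAntideriv_add_sub_le α hA hM
  obtain ⟨z₀, hz₀⟩ := ((tendsto_log_atTop.eventually_ge_atTop (2 * (m + |log β|) + 1)).and
    ((((tendsto_log_atTop.comp tendsto_log_atTop).eventually_ge_atTop (1 : ℝ))).and
    ((eventually_ge_atTop (exp m * (2 * (2 + β) ^ 2)))))).exists_forall_of_atTop
  refine ⟨K₁ * (2 ^ |A - B|) + K₁ + 2 * K₂, z₀, by positivity, fun Z v hZ hv => ?_⟩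
  obtain ⟨a1, a2, a3⟩ := hz₀ Z hZ
  simp only [Function.comp] at a2
  have hb := abs_nonneg (log β)
  have hb0 : 0 < 2 * (2 + β) ^ 2 := by positivity
  have hZ0 : 0 < Z := lt_of_lt_of_le (by positivity) a3
  have hv' := abs_le.mp hv
  have hZb : 2 * (2 + β) ^ 2 ≤ Z := by nlinarith [one_le_exp hm]
  have hsb : 2 * (2 + β) ^ 2 ≤ exp v * Z := by
    have e1 : exp (-m) ≤ exp v := exp_le_exp.mpr hv'.1
    calc 2 * (2 + β) ^ 2 = exp (-m) * (exp m * (2 * (2 + β) ^ 2)) := by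
          rw [← mul_assoc, ← exp_add, neg_add_cancel, exp_zero, one_mul]
      _ ≤ exp v * Z := by gcongr
  have b1 := h₁ _ hsb
  have b2 := h₁ _ hZb
  have hl : 2 * m + 1 ≤ log Z := by linarith
  rw [log_exp_mul hZ0] at b1
  have b3 := rpow_log_add_le (A - B) hm hl hv
  have hm1 : harmonicMain α β A (exp v * Z) = powAntideriv α A (log Z + (v - log β)) := by
    rw [harmonicMain_eq, log_div (by positivity) hβ.ne', log_exp_mul hZ0]; congr 1; ring
  have hm2 : harmonicMain α β A Z = powAntideriv α A (log Z + -log β) := by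
    rw [harmonicMain_eq, log_div hZ0.ne' hβ.ne']; congr 1
  have c1 := h₂ (log Z) (v - log β) a1 ((abs_sub _ _).trans (by linarith))
  have c2 := h₂ (log Z) (-log β) a1 (by rw [abs_neg]; linarith)
  rw [← hm1] at c1
  rw [← hm2] at c2
  have d1 := rpow_sub_two_le_errSize (A := A) (B := B) (by linarith : 0 ≤ log Z) a2
  have d2 := rpow_sub_le_errSize (A := A) (B := B) (by linarith : 0 ≤ log Z) a2
  have f1 : K₁ * (log Z + v) ^ (A - B) ≤ K₁ * (2 ^ |A - B| * errSize A B Z) := by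
    gcongr
    exact b3.trans (by gcongr)
  have f2 : K₁ * log Z ^ (A - B) ≤ K₁ * errSize A B Z := by gcongr
  have f3 : K₂ * log Z ^ (A - 2) ≤ K₂ * errSize A B Z := by gcongr
  rw [abs_le] at *
  constructor <;> linarith [b1.1, b1.2, b2.1, b2.2, c1.1, c1.2, c2.1, c2.2]

/-- By minimality H is still below V at e^(-1/log Z) Z. The step 1/log Z is short enough that the
main increment of H is α (log Z)^(A-2), within the error, so the overshoot is bounded without any
information on gaps or multiplicities in the sequence. -/
lemma IsWellDistributed.exists_abs_harmonicSum_sub_le_of_isLeast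
    (hq : IsWellDistributed q α β A B) (hα : 0 < α) (hβ : 0 < β) (hA : 0 ≤ A)
    (hB : max A 1 < B) :
    ∃ K z₀, 0 ≤ K ∧ ∀ Z V, z₀ ≤ Z → IsLeast {z : ℝ | V ≤ harmonicSum q z} Z →
      |harmonicSum q Z - V| ≤ K * errSize A B Z := by
  obtain ⟨K, z₁, hK, h⟩ := hq.exists_abs_harmonicSum_exp_mul_sub_le hβ hA hB zero_le_one
  obtain ⟨z₀, hz₀⟩ := ((tendsto_log_atTop.eventually_ge_atTop (1 : ℝ)).and
    ((((tendsto_log_atTop.comp tendsto_log_atTop).eventually_ge_atTop (1 : ℝ))).and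
    ((eventually_ge_atTop z₁).and (eventually_gt_atTop 0)))).exists_forall_of_atTop
  refine ⟨α + K, z₀, by positivity, fun Z V hZ hleast => ?_⟩
  obtain ⟨a1, a2, a3, a4⟩ := hz₀ Z hZ
  simp only [Function.comp] at a2
  have hl : 0 < log Z := by linarith
  have hinv : 0 < 1 / log Z := by positivity
  have b := h Z (-(1 / log Z)) a3 (by
    rw [abs_neg, abs_of_pos hinv, div_le_one hl]; exact a1)
  have hlt : harmonicSum q (exp (-(1 / log Z)) * Z) < V := by
    by_contra hcon
    have h1 := hleast.2 (show exp (-(1 / log Z)) * Z ∈ {z : ℝ | V ≤ harmonicSum q z} from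
      not_lt.mp hcon)
    have h2 : exp (-(1 / log Z)) < 1 :=
      (exp_lt_exp.mpr (by linarith : -(1 / log Z) < 0)).trans_eq exp_zero
    nlinarith
  have hV : V ≤ harmonicSum q Z := hleast.1
  have e : 1 / log Z * log Z ^ (A - 1) = log Z ^ (A - 2) := by
    rw [show A - 2 = A - 1 - 1 by ring, rpow_sub_one hl.ne' (A - 1)]; ring
  have d1 := rpow_sub_two_le_errSize (A := A) (B := B) hl.le a2
  rw [abs_of_nonneg (by linarith)]
  have b' := (abs_le.mp b).1
  have e2 : α * -(1 / log Z) * log Z ^ (A - 1) = -(α * log Z ^ (A - 2)) := by rw [← e]; ring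
  rw [e2] at b'
  have e3 : α * log Z ^ (A - 2) ≤ α * errSize A B Z := by gcongr
  linarith

/-- The exponent in Chernoff's bound near the saddle point. -/
lemma IsWellDistributed.exists_abs_exponent_sub_le
    (hq : IsWellDistributed q α β A B) (hα : 0 < α) (hβ : 0 < β) (hA : 0 ≤ A)
    (hB : max A 1 < B) {m K₀ s₀ : ℝ} (hm : 0 ≤ m) (hK₀ : 0 ≤ K₀) :
    ∃ K z₀, 0 ≤ K ∧ ∀ (η V Z v Λ : ℝ), z₀ ≤ Z → |v| ≤ m → |η| ≤ m →
      IsLeast {z : ℝ | V ≤ harmonicSum q z} Z →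
      (s₀ ≤ exp v * Z → |Λ - exp v * Z * harmonicSum q (exp v * Z) -
        α * η * (exp v * Z) * log (exp v * Z) ^ (A - 1)| ≤
          K₀ * (exp v * Z * errSize A B (exp v * Z))) →
      |Λ - exp v * Z * V - α * Z * log Z ^ (A - 1) * (exp v * (v + η))| ≤
        K * (Z * errSize A B Z) := by
  obtain ⟨K₁, z₁, hK₁, h₁⟩ := hq.exists_abs_harmonicSum_exp_mul_sub_le hβ hA hB hm
  obtain ⟨K₂, z₂, hK₂, h₂⟩ := hq.exists_abs_harmonicSum_sub_le_of_isLeast hα hβ hA hB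
  obtain ⟨z₀, hz₀⟩ := ((tendsto_log_atTop.eventually_ge_atTop (2 * m + 1)).and
    ((((tendsto_log_atTop.comp tendsto_log_atTop).eventually_ge_atTop (1 : ℝ))).and
    ((eventually_ge_atTop z₁).and ((eventually_ge_atTop z₂).and
      ((eventually_ge_atTop (exp m * s₀)).and
        (eventually_gt_atTop 0)))))).exists_forall_of_atTop
  refine ⟨exp m * (K₀ * (2 ^ |A - 2| * 2 + 2 ^ |A - B|) + K₁ + K₂ +
    α * m * (|A - 1| * 2 ^ |A - 2| * m)), z₀, by positivity, ?_⟩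
  intro η V Z v Λ hZ hv hη hleast hΛ
  obtain ⟨a1, a2, a3, a4, a5, a6⟩ := hz₀ Z hZ
  simp only [Function.comp] at a2
  have hv' := abs_le.mp hv
  have hl : 0 < log Z := by linarith
  have hs₀ : s₀ ≤ exp v * Z := by
    have e1 : exp (-m) ≤ exp v := exp_le_exp.mpr hv'.1
    calc s₀ = exp (-m) * (exp m * s₀) := by
          rw [← mul_assoc, ← exp_add, neg_add_cancel, exp_zero, one_mul]
      _ ≤ exp (-m) * Z := by gcongr
      _ ≤ exp v * Z := by gcongr
  have b1 := hΛ hs₀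
  have b2 := h₁ Z v a3 hv
  have b3 := h₂ Z V a4 hleast
  have b4 := abs_rpow_sub_rpow_le (A - 1) one_le_two (x := log Z + v) (y := log Z)
    (by linarith) hl (by linarith) (by linarith)
  rw [add_sub_cancel_left, show A - 1 - 1 = A - 2 by ring] at b4
  have b5 := errSize_exp_mul_le A B hm a6 a1 a2 hv
  have d1 := rpow_sub_two_le_errSize (A := A) (B := B) hl.le a2
  rw [log_exp_mul a6] at b1
  set E := errSize A B Z with hE
  have hE0 : 0 ≤ E := (rpow_nonneg hl.le _).trans d1
  have hem : exp v ≤ exp m := exp_le_exp.mpr hv'.2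
  have hev := exp_pos v
  have hev2 := exp_pos m
  have c4 : |(log Z + v) ^ (A - 1) - log Z ^ (A - 1)| ≤ |A - 1| * 2 ^ |A - 2| * m * E := by
    refine b4.trans ?_
    have : 0 ≤ log Z ^ (A - 2) := rpow_nonneg hl.le _
    gcongr
  -- The increment of H supplies v and the expansion of Λ supplies η. The four differences are the
  -- errors in Λ, in that increment, in V ≈ H(Z), and in replacing log (e^v Z) by log Z.
  have e : Λ - exp v * Z * V - α * Z * log Z ^ (A - 1) * (exp v * (v + η)) =
      (Λ - exp v * Z * harmonicSum q (exp v * Z) -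
        α * η * (exp v * Z) * (log Z + v) ^ (A - 1)) +
      exp v * Z * ((harmonicSum q (exp v * Z) - harmonicSum q Z - α * v * log Z ^ (A - 1)) +
        (harmonicSum q Z - V) + α * η * ((log Z + v) ^ (A - 1) - log Z ^ (A - 1))) := by ring
  have f1 : |α * η * ((log Z + v) ^ (A - 1) - log Z ^ (A - 1))| ≤
      α * m * (|A - 1| * 2 ^ |A - 2| * m * E) := by
    rw [abs_mul, abs_mul, abs_of_pos hα]
    gcongr
  have f2 : |(harmonicSum q (exp v * Z) - harmonicSum q Z - α * v * log Z ^ (A - 1)) +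
        (harmonicSum q Z - V) + α * η * ((log Z + v) ^ (A - 1) - log Z ^ (A - 1))| ≤
      K₁ * E + K₂ * E + α * m * (|A - 1| * 2 ^ |A - 2| * m * E) :=
    (abs_add_three _ _ _).trans (add_le_add (add_le_add b2 b3) f1)
  rw [e]
  refine (abs_add_le _ _).trans ?_
  rw [abs_mul, abs_of_pos (by positivity : 0 < exp v * Z)]
  calc _ ≤ K₀ * (exp v * Z * ((2 ^ |A - 2| * 2 + 2 ^ |A - B|) * E)) + exp v * Z *
        (K₁ * E + K₂ * E + α * m * (|A - 1| * 2 ^ |A - 2| * m * E)) := by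
        refine add_le_add (b1.trans ?_) (mul_le_mul_of_nonneg_left f2 (by positivity))
        gcongr
    _ ≤ K₀ * (exp m * Z * ((2 ^ |A - 2| * 2 + 2 ^ |A - B|) * E)) + exp m * Z *
        (K₁ * E + K₂ * E + α * m * (|A - 1| * 2 ^ |A - 2| * m * E)) := by gcongr
    _ = _ := by ring

/-- The admissible range of `V` keeps `Z` well below `Q / log Q`. -/
lemma exists_rangeBound_le (hα : 0 < α)
    (hβ : 0 < β) (hA : 0 ≤ A) (hB : max A 1 < B) {C K₁ : ℝ} (hK₁ : 0 ≤ K₁)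
    (h₁ : ∀ y, 2 * (2 + β) ^ 2 ≤ y →
        |harmonicSum q y - harmonicMain α β A y - C| ≤ K₁ * log y ^ (A - B)) (m : ℝ) :
    ∃ Θ Q₀, 0 < Θ ∧ ∀ Q, Q₀ ≤ Q →
      rangeBound α A C Θ Q ≤ harmonicSum q (Q / (exp m * log Q)) := by
  set d := m + log β with hd
  set K₂ := |α| * (|A - 1| * 2 ^ |A - 2|) with hK₂
  have hK₂0 : 0 ≤ K₂ := by positivity
  have hlim : Tendsto (fun Q : ℝ => log Q) atTop atTop := tendsto_log_atTop
  have hlog2 : ∀ᶠ L : ℝ in atTop, (log L + |d| + |m| + 1) ^ 2 ≤ L ∧ 4 ≤ L ∧ 1 ≤ log L := by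
    have o1 : (fun L : ℝ => log L + (|d| + |m| + 1)) =o[atTop] fun L : ℝ => L ^ (1 / 2 : ℝ) := by
      refine (isLittleO_log_rpow_atTop (by norm_num)).add ?_
      refine Asymptotics.isLittleO_const_left.mpr (Or.inr ?_)
      exact tendsto_norm_atTop_atTop.comp (tendsto_rpow_atTop (by norm_num))
    filter_upwards [o1.bound one_pos, eventually_ge_atTop 4,
      tendsto_log_atTop.eventually_ge_atTop 1] with L h1 h2 h3
    refine ⟨?_, h2, h3⟩
    have hL0 : 0 ≤ L := by linarith
    rw [norm_eq_abs, norm_eq_abs, one_mul, abs_of_nonneg (rpow_nonneg hL0 _)] at h1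
    have h4 := (abs_le.mp h1).2
    have h5 : 0 ≤ log L + (|d| + |m| + 1) := by positivity
    have h6 : L ^ (1 / 2 : ℝ) * L ^ (1 / 2 : ℝ) = L := by
      rw [← rpow_add (by linarith)]; norm_num
    calc (log L + |d| + |m| + 1) ^ 2 =
        (log L + (|d| + |m| + 1)) * (log L + (|d| + |m| + 1)) := by ring
      _ ≤ L ^ (1 / 2 : ℝ) * L ^ (1 / 2 : ℝ) := mul_self_le_mul_self h5 h4
      _ = L := h6
  have hy : Tendsto (fun Q : ℝ => Q / (exp m * log Q)) atTop atTop := by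
    have h1 : Tendsto (fun x : ℝ => exp x / x ^ 1 * (exp m)⁻¹) atTop atTop :=
      (tendsto_exp_div_pow_atTop 1).atTop_mul_const (by positivity)
    refine (h1.comp tendsto_log_atTop).congr' ?_
    filter_upwards [eventually_gt_atTop 0] with Q hQ
    simp only [Function.comp, exp_log hQ, pow_one]
    rw [← div_eq_mul_inv, div_div, mul_comm]
  obtain ⟨Q₀, hQ₀⟩ := ((hlim.eventually hlog2).and
    ((hy.eventually_ge_atTop (2 * (2 + β) ^ 2)).and
      (eventually_gt_atTop 0))).exists_forall_of_atTop
  -- With y the argument of H, log (y/β) = L - (log L + d) where L = log Q. The first-order Taylor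
  -- term is -α (log L + d) L^(A-1), which explains the shape of R; Θ absorbs d, the second-order
  -- term (as (log L + d)² ≤ L) and the error in the expansion of H.
  refine ⟨α * |d| + K₂ + K₁ * 2 ^ |A - 1| + 1, Q₀, by positivity, fun Q hQ => ?_⟩
  obtain ⟨⟨a1, a2, a2'⟩, a3, a4⟩ := hQ₀ Q hQ
  set L := log Q with hL
  set y := Q / (exp m * L) with hyd
  have hL0 : 0 < L := by linarith
  have hy0 : 0 < y := by positivity
  have hly : log y = L - (m + log L) := by
    rw [hyd, log_div a4.ne' (by positivity), log_mul (exp_pos m).ne' hL0.ne', log_exp]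
  have hlyb : log (y / β) = L - (log L + d) := by
    rw [log_div hy0.ne' hβ.ne', hly, hd]; ring
  have hd1 := abs_nonneg d
  have hm1 := abs_nonneg m
  have hda := abs_le.mp (le_refl |d|)
  have hma := abs_le.mp (le_refl |m|)
  have hhalf : log L + |d| + |m| + 1 ≤ L / 2 := by nlinarith
  have hbw : |log L + d| ≤ log L + |d| := by
    rw [abs_le]; constructor <;> linarith [hda.1, hda.2]
  have hsq : (log L + d) ^ 2 ≤ L := by
    rw [← sq_abs]
    refine le_trans ?_ a1
    gcongr
    linarith
  have c1 := abs_powAntideriv_sub_le α hA one_le_two (x := L - (log L + d)) (y := L)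
    (by linarith [(abs_le.mp hbw).2]) hL0 (by linarith [(abs_le.mp hbw).1])
    (by linarith [(abs_le.mp hbw).2])
  rw [← hK₂, ← hlyb, ← harmonicMain_eq, hlyb] at c1
  have c2 : K₂ * (L - (log L + d) - L) ^ 2 * L ^ (A - 2) ≤ K₂ * L ^ (A - 1) := by
    have e1 : (L - (log L + d) - L) ^ 2 = (log L + d) ^ 2 := by ring
    have e2 : L * L ^ (A - 2) = L ^ (A - 1) := by
      rw [mul_comm, ← rpow_add_one hL0.ne']; congr 1; ring
    have h0 : 0 ≤ L ^ (A - 2) := rpow_nonneg hL0.le _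
    rw [e1, mul_assoc, ← e2]
    gcongr
  have c3 := h₁ y a3
  have c4 : log y ^ (A - B) ≤ 2 ^ |A - 1| * L ^ (A - 1) := by
    have hly1 : 1 ≤ log y := by rw [hly]; linarith [hma.2]
    calc log y ^ (A - B) ≤ log y ^ (A - 1) :=
          rpow_le_rpow_of_exponent_le hly1 (by linarith [le_max_right A 1])
      _ ≤ _ := rpow_le_mul_rpow_of_comparable _ one_le_two (by linarith) hL0
          (by rw [hly]; linarith [hma.1]) (by rw [hly]; linarith [hma.2])
  have c5 : K₁ * log y ^ (A - B) ≤ K₁ * (2 ^ |A - 1| * L ^ (A - 1)) := by gcongr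
  have hrange : ∀ Θ, rangeBound α A C Θ Q =
      powAntideriv α A L + C - (α * log L + Θ) * L ^ (A - 1) := by
    intro Θ
    unfold rangeBound powAntideriv
    rw [← hL]
    split_ifs with hA0
    · rfl
    · have : A = 0 := le_antisymm (not_lt.mp hA0) hA
      rw [this, zero_sub, rpow_neg_one, div_eq_mul_inv]
  rw [hrange]
  have hLp : 0 ≤ L ^ (A - 1) := rpow_nonneg hL0.le _
  have c6 : α * d * L ^ (A - 1) ≤ α * |d| * L ^ (A - 1) := by
    gcongr; exact le_abs_self d
  have c1' := (abs_le.mp c1).1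
  have c3' := (abs_le.mp c3).1
  nlinarith

end Saddle

/-! ### Curvature at the saddle point and the tail probability -/

/-- Up to scaling, e^w (w - 1) is the exponent at distance w from the saddle point, with minimum -1
at w = 0. Its quadratic growth makes the tilt at w = 0 negligible against the one at w = δ. -/
lemma exp_mul_sub_one_ge {δ : ℝ} (h0 : 0 ≤ δ) (h1 : δ ≤ 1) :
    -1 + δ ^ 2 / 2 ≤ exp δ * (δ - 1) := by
  have h := exp_bound' h0 h1 (n := 3) (by norm_num)
  simp only [Finset.sum_range_succ, Finset.sum_range_zero, Nat.factorial] at h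
  norm_num at h
  have h3 : 0 ≤ δ ^ 3 := by positivity
  nlinarith [mul_le_mul_of_nonneg_right h (by linarith : 0 ≤ 1 - δ)]

lemma exp_le_two_of_le_half {δ : ℝ} (h : δ ≤ 1 / 2) : exp δ ≤ 2 := by
  have h1 : exp (1 / 2) * exp (1 / 2) ≤ 4 := by
    rw [← exp_add]; norm_num; linarith [exp_one_lt_d9]
  have h2 := exp_le_exp.mpr h
  have h3 := exp_pos (1 / 2 : ℝ)
  nlinarith

/-- The counterpart for the tilt at 2δ: the exponent rises by O(δ²) only, which the width of the
window has to outweigh. -/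
lemma exp_mul_sub_one_sub_le {δ : ℝ} (h1 : δ ≤ 1 / 2) :
    exp (2 * δ) * (2 * δ - 1) - exp δ * (δ - 1) ≤ 4 * δ ^ 2 := by
  have e : exp (2 * δ) = exp δ * exp δ := by rw [← exp_add]; ring_nf
  have h2 := add_one_le_exp δ
  have h3 := exp_le_two_of_le_half h1
  have h4 : exp δ * (2 * δ - 1) - (δ - 1) ≤ 2 * δ ^ 2 := by nlinarith
  have h5 := exp_pos δ
  rw [e]
  calc exp δ * exp δ * (2 * δ - 1) - exp δ * (δ - 1) =
      exp δ * (exp δ * (2 * δ - 1) - (δ - 1)) := by ring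
    _ ≤ exp δ * (2 * δ ^ 2) := by gcongr
    _ ≤ 2 * (2 * δ ^ 2) := by gcongr
    _ = _ := by ring

lemma tendsto_errE {B : ℝ} (hB : 1 < B) : Tendsto (errE B) atTop (𝓝 0) := by
  have h1 : Tendsto (fun Z => log (log Z) / log Z) atTop (𝓝 0) :=
    (isLittleO_log_id_atTop.tendsto_div_nhds_zero).comp tendsto_log_atTop
  have h2 : Tendsto (fun Z => 1 / log Z ^ (B - 1)) atTop (𝓝 0) := by
    have := ((tendsto_rpow_atTop (by linarith : 0 < B - 1)).comp tendsto_log_atTop)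
    exact (this.const_div_atTop 1)
  have h3 := h1.add h2
  rw [add_zero] at h3
  exact h3

lemma rpow_mul_errE_eq {A B Z : ℝ} (hZ : 0 < log Z) :
    log Z ^ (A - 1) * errE B Z = errSize A B Z := by
  unfold errE errSize
  rw [mul_add, show A - B = A - 1 - (B - 1) by ring, rpow_sub hZ (A - 1) (B - 1),
    show A - 2 = A - 1 - 1 by ring, rpow_sub_one hZ.ne' (A - 1)]
  ring

/-- Needed to make W E ≥ log 4, so that the constant factors lost in tilting are absorbed by the
error. For A ≥ 0 the quantity is at least Z/(log Z)². -/
lemma tendsto_mul_errSize {A B : ℝ} (hA : 0 ≤ A) :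
    Tendsto (fun Z => Z * errSize A B Z) atTop atTop := by
  have h1 : Tendsto (fun x : ℝ => exp x / x ^ 2) atTop atTop := tendsto_exp_div_pow_atTop 2
  refine tendsto_atTop_mono' _ ?_ (h1.comp tendsto_log_atTop)
  filter_upwards [tendsto_log_atTop.eventually_ge_atTop 1, eventually_gt_atTop 0,
    (tendsto_log_atTop.comp tendsto_log_atTop).eventually_ge_atTop (1 : ℝ)] with Z hl hZ hll
  simp only [Function.comp] at *
  rw [exp_log hZ, div_eq_mul_inv]
  have h2 : (log Z ^ 2)⁻¹ ≤ log Z ^ (A - 2) := by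
    rw [← rpow_natCast, ← rpow_neg (by linarith)]
    apply rpow_le_rpow_of_exponent_le hl
    push_cast
    linarith
  gcongr
  exact h2.trans (rpow_sub_two_le_errSize (by linarith) hll)

set_option maxHeartbeats 800000 in
/-- From the expansion of the exponent near the saddle point to the tail probability. -/
lemma exists_tailProb_eq {Ω : Type*} [MeasurableSpace Ω] {P : Measure Ω} [IsProbabilityMeasure P]
    {X : Ω → ℝ} (hX : Measurable X) (hint : ∀ s, Integrable (fun ω => exp (s * X ω)) P)
    {α L Z W E V η x K M : ℝ} (hα : 0 < α) (hL : 0 ≤ L) (hZ : 0 < Z) (hW : W = α * Z * L)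
    (hE0 : 0 ≤ E) (hE1 : E ≤ 1) (hK : 0 ≤ K) (hM : 0 ≤ M) (hx : 0 < x)
    (hxη : x ≤ exp (-η - 1)) (hMK : 2 * (2 * K + 1) ≤ x * M ^ 2) (hδ : M * √E ≤ 1 / 2)
    (hWE : log 4 ≤ W * E)
    (hexp : ∀ w, 0 ≤ w → w ≤ 1 →
      |cgf X P (exp (-η - 1 + w) * Z) - exp (-η - 1 + w) * Z * V -
        W * (exp (-η - 1 + w) * (-η - 1 + w + η))| ≤ K * (W * E)) :
    ∃ θ, |θ| ≤ (10 * M + (K + 1) / x) * √E ∧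
      P.real {ω | V < X ω} = exp (-(α * exp (-η - 1) * Z * L * (1 + θ))) := by
  set x₀ := exp (-η - 1) with hx₀
  have hx₀0 : 0 < x₀ := exp_pos _
  set δ := M * √E with hδd
  have hδ0 : 0 ≤ δ := by positivity
  have hδ2 : δ ^ 2 = M ^ 2 * E := by rw [hδd, mul_pow, sq_sqrt hE0]
  have hWpos : 0 < W := by
    have h4 : 0 < log 4 := log_pos (by norm_num)
    by_contra h
    nlinarith
  have hkey : ∀ w, 0 ≤ w → w ≤ 1 → |cgf X P (x₀ * exp w * Z) - x₀ * exp w * Z * V -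
      W * x₀ * (exp w * (w - 1))| ≤ K * (W * E) := by
    intro w h0 h1
    have h := hexp w h0 h1
    rw [exp_add, ← hx₀] at h
    rwa [show W * (x₀ * exp w * (-η - 1 + w + η)) = W * x₀ * (exp w * (w - 1)) by ring] at h
  set s : ℝ → ℝ := fun w => x₀ * exp w * Z with hs
  have k0 := hkey 0 le_rfl zero_le_one
  have k1 := hkey δ hδ0 (by linarith)
  have k2 := hkey (2 * δ) (by linarith) (by linarith)
  rw [exp_zero, one_mul, mul_one] at k0
  have hWx : 0 < W * x₀ := by positivity
  have g1 := mul_le_mul_of_nonneg_left (exp_mul_sub_one_ge hδ0 (by linarith)) hWx.le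
  have g2 := mul_le_mul_of_nonneg_left (exp_mul_sub_one_sub_le hδ) hWx.le
  -- The quadratic saving pays for the errors 2K W E of two exponents and leaves W E ≥ log 4.
  have hsave : (2 * K + 1) * (W * E) ≤ W * x₀ * (δ ^ 2 / 2) := by
    rw [hδ2]
    have h1 : 2 * (2 * K + 1) * (W * E) ≤ x * M ^ 2 * (W * E) := by gcongr
    have h2 : x * M ^ 2 * (W * E) ≤ x₀ * M ^ 2 * (W * E) := by gcongr
    linarith
  have hW2 : W * x₀ * (δ ^ 2 / 2) ≤ W * x₀ * δ ^ 2 := by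
    have : 0 ≤ W * x₀ * δ ^ 2 := by positivity
    linarith
  -- The coefficient 5 makes (s₂ - s₁) ε at least 5 W x₀ δ²: four parts cancel the rise of the
  -- exponent between δ and 2δ, and one remains as the saving. The price is s₁ ε ≤ 10 W x₀ δ.
  set ε := 5 * α * δ * L with hε
  have he1 := add_one_le_exp δ
  have he2 : exp (2 * δ) = exp δ * exp δ := by rw [← exp_add]; ring_nf
  have heδ2 := exp_le_two_of_le_half hδ
  have hgap : δ ≤ exp (2 * δ) - exp δ := by rw [he2]; nlinarith
  have hεs : 5 * (W * x₀ * δ ^ 2) ≤ (x₀ * exp (2 * δ) * Z - x₀ * exp δ * Z) * ε := by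
    have : 5 * (W * x₀ * δ ^ 2) = (x₀ * Z * δ) * ε := by rw [hε, hW]; ring
    rw [this]
    have hε0 : 0 ≤ ε := by positivity
    apply mul_le_mul_of_nonneg_right _ hε0
    have : x₀ * Z * δ ≤ x₀ * Z * (exp (2 * δ) - exp δ) := by gcongr
    linarith
  have hs1ε : x₀ * exp δ * Z * ε ≤ 10 * (W * x₀ * δ) := by
    have : x₀ * exp δ * Z * ε = 5 * (W * x₀ * δ) * exp δ := by rw [hε, hW]; ring
    rw [this]
    have h0 : 0 ≤ 5 * (W * x₀ * δ) := by positivity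
    nlinarith
  have k0' := abs_le.mp k0
  have k1' := abs_le.mp k1
  have k2' := abs_le.mp k2
  -- The middle tilt lies past the minimum, so its mass sits above V; the outer two tilts, at the
  -- minimum and at twice the displacement, bound the mass outside the window.
  have hlower := half_exp_cgf_le_measureReal hX hint (s₀ := x₀ * Z) (s₁ := x₀ * exp δ * Z)
    (s₂ := x₀ * exp (2 * δ) * Z) (V := V) (ε := ε) (by positivity)
    (by
      have : x₀ * Z * 1 ≤ x₀ * Z * exp δ := by gcongr; linarith
      linarith)
    (by gcongr; linarith)
    (by linarith [k0'.2, k1'.1])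
    (by linarith [k2'.2, k1'.1])
  have hupper : P.real {ω | V < X ω} ≤ exp (cgf X P (x₀ * Z) - x₀ * Z * V) := by
    have h1 := measure_ge_le_exp_cgf (μ := P) (X := X) V (by positivity : 0 ≤ x₀ * Z)
      (hint (x₀ * Z))
    refine (measureReal_mono fun ω hω => ?_).trans (h1.trans (le_of_eq ?_))
    · simp only [mem_ofPred_eq] at hω ⊢
      exact hω.le
    · congr 1; ring
  set p := P.real {ω | V < X ω} with hp
  have hp0 : 0 < p := lt_of_lt_of_le (by positivity) hlower
  have hlp1 : log p ≤ -(W * x₀) + K * (W * E) := by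
    have := log_le_log hp0 hupper
    rw [log_exp] at this
    linarith [k0'.2]
  have hlp2 : -(W * x₀) - K * (W * E) - 10 * (W * x₀ * δ) - W * E ≤ log p := by
    have := log_le_log (by positivity) hlower
    rw [log_mul (by norm_num) (exp_pos _).ne', log_exp, one_div, log_inv] at this
    have h24 : log 2 ≤ log 4 := log_le_log (by norm_num) (by norm_num)
    have hδ3 : 0 ≤ W * x₀ * (δ ^ 2 / 2) := by positivity
    linarith [k1'.1]
  have hEs : E ≤ √E := by
    have h1 : √E ≤ 1 := sqrt_le_one.mpr hE1
    have h2 := mul_self_sqrt hE0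
    nlinarith [sqrt_nonneg E]
  refine ⟨-log p / (W * x₀) - 1, ?_, ?_⟩
  · have hb : (K + 1) * (W * E) ≤ W * x₀ * ((K + 1) / x * √E) := by
      have h1 : (K + 1) * (W * E) = W * x * ((K + 1) / x * E) := by field_simp
      rw [h1]
      gcongr
    have e : -log p / (W * x₀) - 1 = (-log p - W * x₀) / (W * x₀) := by
      field_simp
    rw [e, abs_div, abs_of_pos hWx, div_le_iff₀ hWx, abs_le]
    have hWE0 : 0 ≤ W * E := by positivity
    have hd : 0 ≤ W * x₀ * δ := by positivity
    have e2 : (10 * M + (K + 1) / x) * √E * (W * x₀) =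
        10 * (W * x₀ * δ) + W * x₀ * ((K + 1) / x * √E) := by rw [hδd]; ring
    rw [e2]
    constructor
    · linarith only [hlp1, hb, hWE0, hd]
    · linarith only [hlp2, hb]
  · rw [add_sub_cancel, show α * x₀ * Z * L = W * x₀ by rw [hW]; ring,
      mul_div_cancel₀ _ hWx.ne', neg_neg, exp_log hp0]

end LargeDev

/-! ### Choice of constants and conclusion -/

open LargeDev in
theorem theorem6p1 (q : ℕ+ → ℝ) (α β A B : ℝ) (hα : 0 < α) (hβ : 0 < β) (hA : 0 ≤ A)
    (hB : max A 1 < B) (hq : LargeDev.IsWellDistributed q α β A B) :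
    -- the constant `C` of the sequence `q`
    ∃ C : ℝ, Tendsto (fun y : ℝ => LargeDev.harmonicSum q y - LargeDev.harmonicMain α β A y)
        atTop (𝓝 C) ∧
      ∀ c₀ κ C₁ : ℝ, 0 < c₀ → 0 < κ →
        ∃ Θ c K Q₀ : ℝ, 0 < Θ ∧ 1 < c ∧
          ∀ (Ω : Type u) (Ω' : Type v) [MeasurableSpace Ω] [MeasurableSpace Ω']
            (P : Measure Ω) (P' : Measure Ω') [IsProbabilityMeasure P] [IsProbabilityMeasure P']
            (Y : ℕ+ → Ω → ℝ) (𝕐 : Ω' → ℝ), LargeDev.CRVH P P' Y 𝕐 c₀ κ C₁ →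
            IntegrableOn (fun u : ℝ => LargeDev.fFun P' 𝕐 u / u ^ 2) (Set.Ioi 0) ∧
            ∀ Q V : ℝ, Q₀ ≤ Q → c ≤ V → V ≤ LargeDev.rangeBound α A C Θ Q →
              ∃ Z : ℝ, IsLeast {z : ℝ | V ≤ LargeDev.harmonicSum q z} Z ∧ 1 < Real.log Z ∧
                ∃ θ : ℝ, |θ| ≤ K * Real.sqrt (LargeDev.errE B Z) ∧
                  LargeDev.tailProb P q Y Q V =
                    Real.exp (-(α * Real.exp (-LargeDev.eta P' 𝕐 - 1) * Z *
                      Real.log Z ^ (A - 1) * (1 + θ))) := by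
  obtain ⟨C, K₁, hK₁, hC, hCb⟩ := hq.exists_harmonicSum_expansion hβ hA hB
  refine ⟨C, hC, fun c₀ κ C₁ hc₀ hκ => ?_⟩
  set D := cgfConst c₀ κ with hD
  have hD0 : 0 ≤ D := by rw [hD, cgfConst]; positivity
  -- Since |η| ≤ 1 + 2D, this bounds |η| and |-η - 1 + w| for 0 ≤ w ≤ 1, and makes e^(-m) a lower
  -- bound for e^(-η-1).
  set m := 3 + 2 * D with hm
  have hm0 : 0 ≤ m := by positivity
  obtain ⟨K₂, s₀, hK₂, h₂⟩ := hq.exists_cgf_sum_expansion hα hβ hA hB D C₁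
  obtain ⟨K₃, z₀, hK₃, h₃⟩ := hq.exists_abs_exponent_sub_le (s₀ := s₀) hα hβ hA hB hm0 hK₂
  obtain ⟨Θ, Q₁, hΘ, hrange⟩ := exists_rangeBound_le hα hβ hA hB hK₁ hCb m
  have hB1 : 1 < B := (le_max_right A 1).trans_lt hB
  set x := Real.exp (-m) with hx
  have hx0 : 0 < x := Real.exp_pos _
  set K := K₃ / α with hK
  have hK0 : 0 ≤ K := by positivity
  -- Chosen so that x M² ≥ 2(2K + 1): with δ = M √E the quadratic saving then exceeds the errors in
  -- the exponent.
  set M := 2 * (2 * K + 1) / x + 1 with hM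
  have hM1 : 1 ≤ M := by
    have : 0 ≤ 2 * (2 * K + 1) / x := by positivity
    linarith
  have hMK : 2 * (2 * K + 1) ≤ x * M ^ 2 := by
    have e : 2 * (2 * K + 1) = x * (M - 1) := by rw [hM]; field_simp; ring
    rw [e]
    gcongr
    nlinarith
  have hE := tendsto_errE hB1
  have hdel : Tendsto (fun Z => M * Real.sqrt (errE B Z)) atTop (𝓝 0) := by
    have := (Real.continuous_sqrt.tendsto 0).comp hE
    simp only [Real.sqrt_zero] at this
    simpa using this.const_mul M
  obtain ⟨z₁, hz₁⟩ := ((eventually_ge_atTop z₀).and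
    ((Real.tendsto_log_atTop.eventually_gt_atTop 1).and
    (((Real.tendsto_log_atTop.comp Real.tendsto_log_atTop).eventually_ge_atTop (1 : ℝ)).and
    ((hE.eventually_le_const zero_lt_one).and
    ((hdel.eventually_le_const one_half_pos).and
    (((tendsto_mul_errSize (B := B) hA).eventually_ge_atTop (Real.log 4 / α)).and
      (eventually_gt_atTop 0))))))).exists_forall_of_atTop
  obtain ⟨Q₂, hQ₂⟩ := ((Real.tendsto_log_atTop.eventually_ge_atTop 1).and
    (eventually_gt_atTop 0)).exists_forall_of_atTop
  have hHnn := hq.harmonicSum_nonneg z₁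
  -- V ≥ c exceeds H(z₁), so monotonicity forces Z ≥ z₁, where all asymptotic conditions hold; the
  -- summand 2 also secures c > 1.
  refine ⟨Θ, harmonicSum q z₁ + 2, 10 * M + (K + 1) / x, max Q₁ Q₂, hΘ, by linarith, ?_⟩
  intro Ω Ω' _ _ P P' _ _ Y 𝕐 h
  have hlim := h.cgfBounds_limit hc₀ hκ
  obtain ⟨g', hg', hg'c, hg'1⟩ := h.exists_deriv_cgf
  have hgc : Continuous (cgf 𝕐 P') :=
    continuous_iff_continuousAt.mpr fun u => (hg' u).continuousAt
  refine ⟨hlim.integrableOn_cutoff hgc, fun Q V hQ hcV hV => ?_⟩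
  have heta : |eta P' 𝕐| ≤ 1 + 2 * D := hlim.abs_eta_le hgc
  set η := eta P' 𝕐 with hη
  obtain ⟨Z, hZ⟩ := hq.exists_isLeast (hq.tendsto_harmonicSum_atTop hα hβ hA hB)
    (show 0 < V by linarith)
  have hZz : z₁ ≤ Z := by
    by_contra hcon
    have := hq.harmonicSum_mono (not_le.mp hcon).le
    have hV' : V ≤ harmonicSum q Z := hZ.1
    linarith
  obtain ⟨b1, b2, b3, b4, b5, b6, b7⟩ := hz₁ Z hZz
  simp only [Function.comp] at b3
  obtain ⟨d1, d2⟩ := hQ₂ Q ((le_max_right _ _).trans hQ)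
  have hZQ : Z ≤ Q / (Real.exp m * Real.log Q) :=
    hZ.2 (hV.trans (hrange Q ((le_max_left _ _).trans hQ)))
  have hl0 : 0 < Real.log Z := by linarith
  have hLn : 0 ≤ Real.log Z ^ (A - 1) := Real.rpow_nonneg hl0.le _
  have hEn : 0 ≤ errE B Z := by
    unfold errE
    have : 0 ≤ Real.log Z ^ (B - 1) := Real.rpow_nonneg hl0.le _
    positivity
  have hWE : α * Z * Real.log Z ^ (A - 1) * errE B Z = α * (Z * errSize A B Z) := by
    rw [← rpow_mul_errE_eq hl0]; ring
  refine ⟨Z, hZ, b2, ?_⟩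
  have hcgf : ∀ s, cgf (randomSum q Y Q) P s = ∑ n ∈ hq.index Q, cgf (Y n) P (s / q n) := by
    intro s
    rw [cgf, h.mgf_randomSum hq, Real.log_exp]
  have hη' := abs_le.mp heta
  refine exists_tailProb_eq (h.measurable_randomSum hq Q) (h.integrable_exp_randomSum hq Q)
    (x := x) (K := K) (M := M) hα hLn b7 rfl hEn b4 hK0 (by linarith) hx0
    (Real.exp_le_exp.mpr (by linarith [hη'.2])) hMK b5 ?_ ?_
  · rw [hWE, ← div_le_iff₀' hα]
    exact b6
  · intro w hw0 hw1
    have hv : |-η - 1 + w| ≤ m := by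
      rw [abs_le]; constructor <;> linarith [hη'.1, hη'.2]
    have hKe : K * (α * Z * Real.log Z ^ (A - 1) * errE B Z) = K₃ * (Z * errSize A B Z) := by
      rw [hWE, hK]; field_simp
    rw [hKe]
    refine h₃ η V Z (-η - 1 + w) _ b1 hv (heta.trans (by linarith)) hZ fun hs => ?_
    rw [hcgf]
    refine h₂ (fun n => cgf (Y n) P) (cgf 𝕐 P') g' (h.cgfBounds hc₀ hκ) hlim hg' hg'c hg'1
      (fun n hn u hu => h.abs_cgf_sub_le hn hu) _ Q hs ?_
    -- The factor e^m in the range bound was reserved for this: every s = e^v Z in use is at most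
    -- Q/log Q, hence s log s ≤ Q.
    have e1 : Real.exp (-η - 1 + w) * Z ≤ Q / Real.log Q := by
      calc Real.exp (-η - 1 + w) * Z ≤ Real.exp m * (Q / (Real.exp m * Real.log Q)) := by
            gcongr
            exact (abs_le.mp hv).2
        _ = _ := by field_simp
    have e2 : Real.exp (-η - 1 + w) * Z ≤ Q := e1.trans (div_le_self d2.le d1)
    calc Real.exp (-η - 1 + w) * Z * Real.log (Real.exp (-η - 1 + w) * Z)
        ≤ Real.exp (-η - 1 + w) * Z * Real.log Q := by
          gcongr
      _ ≤ Q / Real.log Q * Real.log Q := by gcongr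
      _ = Q := by field_simp
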